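/- Let $d\ge 2$, $s\in(\frac12,\frac d2)$ and let $\theta:[0,\infty)\to\mathbb C$ be arbitrary. Let $\mathrm d\sigma$ be the surface measure on the unit sphere $\mathbb S^{d-1}\subset\mathbb R^d$, let $\mathcal H_k\subset L^2(\mathbb S^{d-1})$ be the space of complex-valued spherical harmonics of degree $k\in\mathbb N_0$, and let $H_k$ be the orthogonal projection of $L^2(\mathbb S^{d-1})$ onto $\mathcal H_k$, extended to functions on $\mathbb R^d$ by acting on each sphere centred at the origin: $H_kf(x)=\big(H_k[f(|x|\,\cdot)]\big)(x/|x|)$. The Fourier transform is $\widehat f(\xi)=\int_{\mathbb R^d} f(x)e^{-ix\cdot\xi}\,\mathrm dx$, with inverse $f\mapsto f^\vee$, and $\widehat{G\,\mathrm d\sigma}(\xi)=\int_{\mathbb S^{d-1}} G(\omega)e^{-i\omega\cdot\xi}\,\mathrm d\sigma(\omega)$. Put $D=\sqrt{-\Delta}$ (so $\widehat{D^{-s}g}(\xi)=|\xi|^{-s}\,\widehat g(\xi)$), let $\mathcal R:\dot H^s(\mathbb R^d)\to L^2(\mathbb S^{d-1})$ be the trace operator (the continuous extension of restriction to the sphere),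 and let $\Lambda$ be the Laplace--Beltrami operator on $\mathbb S^{d-1}$, so that $\theta(-\Lambda)=\sum_{k\ge0}\theta(k(k+d-2))H_k$. Define, on their maximal domains, $$\mathcal S_\theta g=\mathcal R\,\overline\theta(-\Lambda)D^{-s}g=\sum_{k\ge0}\overline{\theta(k(k+d-2))}\;\mathcal R H_kD^{-s}g\quad(g\in L^2(\mathbb R^d)),$$ $$\mathcal S_\theta^*G=\big(|\cdot|^{-s}\theta(-\Lambda)\widehat{G\,\mathrm d\sigma}\big)^\vee=\Big(\sum_{k\ge0}\theta(k(k+d-2))\,|\cdot|^{-s}H_k\widehat{G\,\mathrm d\sigma}\Big)^\vee\quad(G\in L^2(\mathbb S^{d-1})),$$ the series converging in $L^2(\mathbb S^{d-1})$ and $L^2(\mathbb R^d)$ respectively; put $\|\mathcal S_\theta^*G\|=\infty$ if $G$ is not in the domain of $\mathcal S_\theta^*$. Let $$\lambda_k(\theta)=2^{1-2s}\frac{\Gamma(2s-1)\Gamma(k+\frac d2-s)}{\Gamma(s)^2\,\Gamma(k+\frac d2-1+s)}\,|\theta(k(k+d-2))|^2,$$ $\mathbf k=\{k:\lambda_k(\theta)=\inf_\ell\lambda_\ell(\theta)\}$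 and $\mathbf K=\{k:\lambda_k(\theta)=\sup_\ell\lambda_\ell(\theta)\}$. Then $\mathcal S_\theta^*$ is the Hilbert space adjoint of $\mathcal S_\theta$, and the following hold. (a) For every $k\in\mathbb N_0$ and every $P_k\in\mathcal H_k$, $\mathcal S_\theta\mathcal S_\theta^*P_k=\lambda_k(\theta)P_k$ (in particular, $P_k$ lies in the domain of $\mathcal S_\theta\mathcal S_\theta^*$). (b) For every $G\in L^2(\mathbb S^{d-1})$, $$\inf_k\lambda_k(\theta)\,\|G\|^2_{L^2(\mathbb S^{d-1})}\le\|\mathcal S_\theta^*G\|^2_{L^2(\mathbb R^d)}\le\sup_k\lambda_k(\theta)\,\|G\|^2_{L^2(\mathbb S^{d-1})}$$ (values in $[0,\infty]$, with $\infty\cdot0=0$), and both constants are optimal: $\inf_k\lambda_k(\theta)$ is the largest and $\sup_k\lambda_k(\theta)$ the smallest constant in $[0,\infty]$ for which the respective inequality holds for all $G$. (c) If $\inf_k\lambda_k(\theta)>0$, then the extremisers for the lower bound (the nonzero $G$ for which equality holds) are precisely the nonzero elements of the closed direct sum $\bigoplus_{k\in\mathbf k}\mathcal H_k$; there are none if $\mathbf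 k=\emptyset$. (d) If $\sup_k\lambda_k(\theta)<\infty$, then the extremisers for the upper bound are precisely the nonzero elements of the closed direct sum $\bigoplus_{k\in\mathbf K}\mathcal H_k$; there are none if $\mathbf K=\emptyset$. -/

import Mathlib

open MeasureTheory Filter Topology
open scoped ENNReal NNReal FourierTransform ComplexConjugate

namespace SphereTrace

/-- Euclidean space `ℝ^d`. -/
abbrev E (d : ℕ) : Type := EuclideanSpace ℝ (Fin d)

/-- The unit sphere `𝕊^{d-1}` of `ℝ^d`. -/
abbrev S (d : ℕ) : Type := Metric.sphere (0 : E d) 1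

/-- The surface measure `dσ` on the unit sphere (not normalised). -/
noncomputable def surf (d : ℕ) : Measure (S d) := (volume : Measure (E d)).toSphere

instance (d : ℕ) : IsFiniteMeasure (surf d) := by unfold surf; infer_instance

/-- `L²(ℝ^d)`, complex valued. -/
abbrev L2E (d : ℕ) : Type := Lp ℂ 2 (volume : Measure (E d))

/-- `L²(𝕊^{d-1})`, complex valued. -/
abbrev L2S (d : ℕ) : Type := Lp ℂ 2 (surf d)

/-! ### Spherical harmonics -/

/-- The Laplacian on complex polynomials in `d` variables. -/
noncomputable def polyLaplacian (d : ℕ) :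
    MvPolynomial (Fin d) ℂ →ₗ[ℂ] MvPolynomial (Fin d) ℂ :=
  ∑ i : Fin d, (MvPolynomial.pderiv i).toLinearMap ∘ₗ (MvPolynomial.pderiv i).toLinearMap

/-- Homogeneous harmonic polynomials of degree `k` in `d` variables. -/
noncomputable def harmonicPoly (d k : ℕ) : Submodule ℂ (MvPolynomial (Fin d) ℂ) :=
  MvPolynomial.homogeneousSubmodule (Fin d) ℂ k ⊓ LinearMap.ker (polyLaplacian d)

/-- Restriction of a polynomial to the unit sphere. -/
noncomputable def restrictPoly (d : ℕ) : MvPolynomial (Fin d) ℂ →ₗ[ℂ] C(S d, ℂ) :=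
  (MvPolynomial.aeval
    (fun i : Fin d => (⟨fun ω => ((ω : E d) i : ℂ), by fun_prop⟩ : C(S d, ℂ)))).toLinearMap

/-- Spherical harmonics of degree `k`, as continuous functions on the sphere. -/
noncomputable def harmC (d k : ℕ) : Submodule ℂ C(S d, ℂ) :=
  (harmonicPoly d k).map (restrictPoly d)

/-- The space `ℋ_k` of spherical harmonics of degree `k`, as a subspace of `L²(𝕊^{d-1})`. -/
noncomputable def harm (d k : ℕ) : Submodule ℂ (L2S d) :=
  (harmC d k).map (ContinuousMap.toLp (E := ℂ) 2 (surf d) ℂ : C(S d, ℂ) →ₗ[ℂ] L2S d)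

instance finiteDimensional_harm (d k : ℕ) : FiniteDimensional ℂ (harm d k) := by
  have hle : harmonicPoly d k ≤ MvPolynomial.restrictTotalDegree (Fin d) ℂ k := by
    intro p hp
    rw [MvPolynomial.mem_restrictTotalDegree]
    exact MvPolynomial.IsHomogeneous.totalDegree_le hp.1
  have : FiniteDimensional ℂ (harmonicPoly d k) :=
    Submodule.finiteDimensional_of_le hle
  unfold harm harmC
  infer_instance

/-- Every `L²` spherical harmonic has a continuous representative that is a spherical harmonic. -/
theorem exists_harmC (d k : ℕ) (u : L2S d) :
    ∃ Y ∈ harmC d k,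
      ContinuousMap.toLp (E := ℂ) 2 (surf d) ℂ Y = (harm d k).starProjection u :=
  Submodule.mem_map.1 ((harm d k).starProjection_apply_mem u)

open Classical in
/-- The projection `H_k u` of a square integrable function `u` on the sphere onto `ℋ_k`,
as a continuous function on the sphere. -/
noncomputable def projSphere (d k : ℕ) (u : S d → ℂ) : C(S d, ℂ) :=
  if hu : MemLp u 2 (surf d) then (exists_harmC d k (hu.toLp u)).choose else 0

/-- The direction `x / |x|` of a nonzero vector. -/
noncomputable def dir {d : ℕ} (x : E d) (hx : x ≠ 0) : S d :=
  ⟨‖x‖⁻¹ • x, by simp [norm_smul, hx]⟩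

open Classical in
/-- `H_k` for functions on `ℝ^d`: the projection onto `ℋ_k` on each sphere centred at the origin,
`H_k f (x) = (H_k (f (|x| ·))) (x / |x|)`. -/
noncomputable def projSpace (d k : ℕ) (f : E d → ℂ) (x : E d) : ℂ :=
  if hx : x = 0 then 0 else projSphere d k (fun φ => f (‖x‖ • (φ : E d))) (dir x hx)

/-! ### Fourier transforms (convention: kernel `exp (-i x · ξ)`) -/

/-- The Fourier transform `ĝ(ξ) = ∫ g(x) exp (-i x · ξ) dx` of `g ∈ L²(ℝ^d)`. -/
noncomputable def fourierL2 {d : ℕ} (g : L2E d) (ξ : E d) : ℂ :=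
  (𝓕 g : L2E d) ((2 * Real.pi)⁻¹ • ξ)

/-- The Fourier extension `(G dσ)^(ξ) = ∫ G(ω) exp (-i ω · ξ) dσ(ω)`. -/
noncomputable def extension {d : ℕ} (G : L2S d) (ξ : E d) : ℂ :=
  ∫ ω : S d, G ω * Complex.exp (-(Complex.I * (inner ℝ (ω : E d) ξ : ℝ))) ∂(surf d)

/-- `D^{-s}` applied to the part of `g ∈ L²(ℝ^d)` with frequencies `|ξ| ≤ N`, where
`D = √(-Δ)`: the continuous function
`x ↦ (2π)^{-d} ∫_{|ξ| ≤ N} |ξ|^{-s} ĝ(ξ) exp (i x · ξ) dξ`. -/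
noncomputable def negPowD {d : ℕ} (s : ℝ) (N : ℕ) (g : L2E d) (x : E d) : ℂ :=
  ((2 * Real.pi) ^ d : ℝ)⁻¹ *
    ∫ ξ in Metric.closedBall (0 : E d) N,
      ((‖ξ‖ ^ (-s) : ℝ) : ℂ) * fourierL2 g ξ * Complex.exp (Complex.I * (inner ℝ x ξ : ℝ))

/-! ### The operators -/

/-- The value `θ(k(k+d-2))`. -/
def thetaAt (d : ℕ) (θ : ℝ≥0 → ℂ) (k : ℕ) : ℂ := θ ((k * (k + d - 2) : ℕ) : ℝ≥0)

/-- `F = ℛ H_k D^{-s} g`, the trace on the sphere of `H_k D^{-s} g`. The functions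
`H_k D^{-s} g_N` (`g_N` the part of `g` with frequencies at most `N`) are continuous away from the
origin and are simply restricted; `ℛ` is extended by continuity to their limit as `N → ∞`. -/
def IsTraceComponent {d : ℕ} (s : ℝ) (k : ℕ) (g : L2E d) (F : L2S d) : Prop :=
  Tendsto (fun N : ℕ =>
    eLpNorm (fun ω : S d => projSpace d k (negPowD s N g) (ω : E d) - F ω) 2 (surf d))
    atTop (𝓝 0)

/-- The graph of `S_θ = ℛ θ̄(-Λ) D^{-s}`, i.e. `S_θ g = ∑_k conj θ(k(k+d-2)) ℛ H_k D^{-s} g`,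
on its maximal domain in `L²(ℝ^d)`: `IsStheta s θ g F` says that the series converges
in `L²(𝕊^{d-1})`, with sum `F`. -/
def IsStheta {d : ℕ} (s : ℝ) (θ : ℝ≥0 → ℂ) (g : L2E d) (F : L2S d) : Prop :=
  ∃ Φ : ℕ → L2S d, (∀ k, IsTraceComponent s k g (Φ k)) ∧
    HasSum (fun k => conj (thetaAt d θ k) • Φ k) F

/-- The graph of `S_θ^* G = (|·|^{-s} θ(-Λ) (G dσ)^)^∨` on its maximal domain in `L²(𝕊^{d-1})`:
`IsSthetaStar s θ G h` says that
`|·|^{-s} θ(-Λ) (G dσ)^ = ∑_k θ(k(k+d-2)) |·|^{-s} H_k (G dσ)^` converges in `L²(ℝ^d)` and that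
its sum is the Fourier transform of `h`. -/
def IsSthetaStar {d : ℕ} (s : ℝ) (θ : ℝ≥0 → ℂ) (G : L2S d) (h : L2E d) : Prop :=
  ∃ (Ψ : ℕ → L2E d) (W : L2E d),
    (∀ k, Ψ k =ᵐ[volume] fun ξ => ((‖ξ‖ ^ (-s) : ℝ) : ℂ) * projSpace d k (extension G) ξ) ∧
    HasSum (fun k => thetaAt d θ k • Ψ k) W ∧ fourierL2 h =ᵐ[volume] W

/-- `‖S_θ^* G‖²` in `[0, ∞]`, equal to `∞` when `G` is not in the domain of `S_θ^*`. -/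
noncomputable def normSqSthetaStar {d : ℕ} (s : ℝ) (θ : ℝ≥0 → ℂ) (G : L2S d) : ℝ≥0∞ :=
  ⨅ (h : L2E d) (_ : IsSthetaStar s θ G h), ‖h‖ₑ ^ 2

/-- `λ_k(θ)`. -/
noncomputable def lam (d : ℕ) (s : ℝ) (θ : ℝ≥0 → ℂ) (k : ℕ) : ℝ :=
  2 ^ (1 - 2 * s) * (Real.Gamma (2 * s - 1) * Real.Gamma (k + d / 2 - s)) /
    (Real.Gamma s ^ 2 * Real.Gamma (k + d / 2 - 1 + s)) * ‖thetaAt d θ k‖ ^ 2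

/-- `inf_k λ_k(θ)`, in `[0, ∞]`. -/
noncomputable def infLam (d : ℕ) (s : ℝ) (θ : ℝ≥0 → ℂ) : ℝ≥0∞ :=
  ⨅ k, ENNReal.ofReal (lam d s θ k)

/-- `sup_k λ_k(θ)`, in `[0, ∞]`. -/
noncomputable def supLam (d : ℕ) (s : ℝ) (θ : ℝ≥0 → ℂ) : ℝ≥0∞ :=
  ⨆ k, ENNReal.ofReal (lam d s θ k)

/-- The set of degrees at which the infimum is attained. -/
def argInf (d : ℕ) (s : ℝ) (θ : ℝ≥0 → ℂ) : Set ℕ :=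
  {k | ENNReal.ofReal (lam d s θ k) = infLam d s θ}

/-- The set of degrees at which the supremum is attained. -/
def argSup (d : ℕ) (s : ℝ) (θ : ℝ≥0 → ℂ) : Set ℕ :=
  {k | ENNReal.ofReal (lam d s θ k) = supLam d s θ}

/-- The Hilbert space direct sum `⨁_{k ∈ A} ℋ_k`, a closed subspace of `L²(𝕊^{d-1})`. -/
noncomputable def harmSum (d : ℕ) (A : Set ℕ) : Submodule ℂ (L2S d) :=
  (⨆ k ∈ A, harm d k).topologicalClosure

/-- On the unit sphere the two projections agree. -/
theorem projSpace_coe (d k : ℕ) (f : E d → ℂ) (ω : S d) :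
    projSpace d k f (ω : E d) = projSphere d k (fun φ => f φ) ω := by
  have h1 : ‖(ω : E d)‖ = 1 := by simp
  have h0 : (ω : E d) ≠ 0 := by
    intro h
    simp [h] at h1
  have h2 : dir (ω : E d) h0 = ω := by
    apply Subtype.ext
    simp [dir]
  simp [projSpace, h0, h2]

/-- The trace is single valued. -/
theorem IsTraceComponent.unique {d : ℕ} {s : ℝ} {k : ℕ} {g : L2E d} {F F' : L2S d}
    (h : IsTraceComponent s k g F) (h' : IsTraceComponent s k g F') : F = F' := by
  have hm : ∀ N : ℕ, AEStronglyMeasurable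
      (fun ω : S d => projSpace d k (negPowD s N g) (ω : E d)) (surf d) := by
    intro N
    simp only [projSpace_coe]
    exact (ContinuousMap.continuous _).aestronglyMeasurable
  have h0 : eLpNorm ((F' : S d → ℂ) - (F : S d → ℂ)) 2 (surf d) = 0 := by
    refine le_antisymm (ge_of_tendsto' (by simpa using h.add h') fun N => ?_) bot_le
    refine le_trans (le_of_eq ?_) (eLpNorm_sub_le ((hm N).sub (Lp.aestronglyMeasurable F))
      ((hm N).sub (Lp.aestronglyMeasurable F')) (by norm_num))
    congr 1
    funext ω
    simp
  rw [eLpNorm_eq_zero_iff ((Lp.aestronglyMeasurable F').sub (Lp.aestronglyMeasurable F))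
    (by norm_num)] at h0
  apply Lp.ext
  filter_upwards [h0] with ω hω
  exact (sub_eq_zero.1 hω).symm

/-- `S_θ` is single valued. -/
theorem IsStheta.unique {d : ℕ} {s : ℝ} {θ : ℝ≥0 → ℂ} {g : L2E d} {F F' : L2S d}
    (h : IsStheta s θ g F) (h' : IsStheta s θ g F') : F = F' := by
  obtain ⟨Φ, h1, h2⟩ := h
  obtain ⟨Φ', h1', h2'⟩ := h'
  have hΦ : Φ = Φ' := funext fun k => (h1 k).unique (h1' k)
  subst hΦ
  exact h2.unique h2'

/-- `S_θ^*` is single valued. -/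
theorem IsSthetaStar.unique {d : ℕ} {s : ℝ} {θ : ℝ≥0 → ℂ} {G : L2S d} {h h' : L2E d}
    (H : IsSthetaStar s θ G h) (H' : IsSthetaStar s θ G h') : h = h' := by
  obtain ⟨Ψ, W, h1, h2, h3⟩ := H
  obtain ⟨Ψ', W', h1', h2', h3'⟩ := H'
  have hΨ : Ψ = Ψ' := by
    funext k
    exact Lp.ext ((h1 k).trans (h1' k).symm)
  subst hΨ
  have hW : W = W' := h2.unique h2'
  subst hW
  have hF : (fun ξ => (𝓕 h : L2E d) ((2 * Real.pi)⁻¹ • ξ)) =ᵐ[volume]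
      fun ξ => (𝓕 h' : L2E d) ((2 * Real.pi)⁻¹ • ξ) := h3.trans h3'.symm
  have hq : Measure.QuasiMeasurePreserving (fun ξ : E d => (2 * Real.pi) • ξ) volume volume := by
    refine ⟨measurable_const_smul _, ?_⟩
    rw [Measure.map_addHaar_smul _ (by positivity)]
    exact Measure.smul_absolutelyContinuous
  have := hq.ae_eq_comp hF
  have h4 : (𝓕 h : L2E d) = 𝓕 h' := by
    apply Lp.ext
    filter_upwards [this] with ξ hξ
    have h5 : (2 * Real.pi)⁻¹ • (2 * Real.pi) • ξ = ξ := inv_smul_smul₀ (by positivity) ξ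
    simpa only [Function.comp, h5] using hξ
  exact (Lp.fourierTransformₗᵢ (E d) ℂ).injective h4

end SphereTrace

namespace SphereTrace

/-! ### Polar coordinates -/

section Polar

variable {d : ℕ}

/-! Let T_k G have Fourier transform |ξ|^(-s) (H_k G dσ)^. Since H_k commutes with the extension
operator, S_θ^* = ∑ θ_k T_k and S_θ = ∑ conj θ_k T_k^*, where θ_k = θ(k(k+d-2)) and every T_k is
bounded (`adjTrace`, `isSthetaStar_iff`, `isStheta_iff`). Two facts carry the theorem: the ranges of
the T_k are mutually orthogonal (`inner_adjTrace_of_ne`), and T_k^* T_k = λ_k(1) H_k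
(`inner_adjTrace_self`). They give (a), and also ‖S_θ^* G‖² = ∑ λ_k(θ) ‖H_k G‖² in [0, ∞]
(`normSqSthetaStar_eq_tsum`). Comparing this term by term with ‖G‖² = ∑ ‖H_k G‖² gives both bounds.
Single harmonics show that the constants are optimal, and extremisers are the G with equality in
every term.

The eigenvalue comes from the Funk–Hecke formula (`funk_hecke`): (Y dσ)^(rφ) = m_k(-ir) Y(φ) for Y
of degree k, with m_k = `funkCoef d k`. In polar coordinates the angular factor yields
orthogonality, and what remains is ∫ r^(d-1-2s) |m_k(-ir)|² dr = (2π)^d λ_k(1)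
(`lintegral_funkCoef`). No Bessel functions are needed: r^(-2s) is a superposition of Gaussians
exp(-r²/(2τ)), and the Fourier transform of such a Gaussian at φ - ω is a multiple of exp(τ ω·φ).
The Gaussian average of |m_k(-ir)|² is therefore a multiple of m_k(τ), by Funk–Hecke at a real
argument (`integral_gauss_funkCoef`). The τ-integral is then a Gamma integral followed by a beta
integral, and Legendre duplication brings the result to the stated form.

Funk–Hecke and orthogonality of degrees both follow from Gaussian integration by parts on
polynomials (`natCast_mul_gaussInt_mul`), because a homogeneous polynomial has proportional Gaussian
and spherical integrals. Completeness of the harmonics is Stone–Weierstrass together with the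
decomposition p = harmonic + |x|² q.

For adjointness, testing a candidate h on the ranges of the T_k forces its components to be θ_k T_k
G. Bessel's inequality makes their sum converge, and the remainder lies in the kernel of S_θ, which
forces it to vanish. -/

theorem nontrivial_E (hd : 2 ≤ d) : Nontrivial (E d) := by
  have : Nonempty (Fin d) := ⟨⟨0, by omega⟩⟩
  infer_instance

instance isOpenPosMeasure_surf (d : ℕ) : (surf d).IsOpenPosMeasure := by
  unfold surf; infer_instance

/-- The radial measure `r^(d-1) dr`. -/
noncomputable def radial (d : ℕ) : Measure (Set.Ioi (0 : ℝ)) := Measure.volumeIoiPow (d - 1)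

instance (d : ℕ) : SigmaFinite (radial d) := by unfold radial; infer_instance

theorem integral_radial (f : ℝ → ℂ) :
    ∫ r : Set.Ioi (0 : ℝ), f r ∂(radial d) =
      ∫ r in Set.Ioi (0 : ℝ), ((r ^ (d - 1) : ℝ) : ℂ) * f r := by
  simp only [radial, Measure.volumeIoiPow, ENNReal.ofReal]
  rw [integral_withDensity_eq_integral_smul,
    integral_subtype_comap measurableSet_Ioi fun a ↦ Real.toNNReal (a ^ (d - 1)) • f a,
    setIntegral_congr_fun measurableSet_Ioi fun x hx ↦ ?_]
  · rw [NNReal.smul_def, Real.coe_toNNReal _ (pow_nonneg hx.out.le _)]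
    simp
  · exact (measurable_subtype_coe.pow_const _).real_toNNReal

theorem lintegral_radial (f : ℝ → ℝ≥0∞) :
    ∫⁻ r : Set.Ioi (0 : ℝ), f r ∂(radial d) =
      ∫⁻ r in Set.Ioi (0 : ℝ), ENNReal.ofReal (r ^ (d - 1)) * f r := by
  simp only [radial, Measure.volumeIoiPow]
  rw [lintegral_withDensity_eq_lintegral_mul_non_measurable _ (by fun_prop)
    (by simp)]
  exact lintegral_subtype_comap measurableSet_Ioi fun a => ENNReal.ofReal (a ^ (d - 1)) * f a

theorem measurePreserving_polar (d : ℕ) :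
    MeasurePreserving (homeomorphUnitSphereProd (E d)) ((volume : Measure (E d)).comap (↑))
      ((surf d).prod (radial d)) := by
  have := (volume : Measure (E d)).measurePreserving_homeomorphUnitSphereProd
  rwa [finrank_euclideanSpace_fin] at this

theorem measurePreserving_polar_symm (d : ℕ) :
    MeasurePreserving (homeomorphUnitSphereProd (E d)).symm ((surf d).prod (radial d))
      ((volume : Measure (E d)).comap (↑)) :=
  (measurePreserving_polar d).symm (homeomorphUnitSphereProd (E d)).toMeasurableEquiv

variable [Nontrivial (E d)]

theorem integral_eq_prod (f : E d → ℂ) :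
    ∫ x, f x = ∫ p : S d × Set.Ioi (0 : ℝ), f ((p.2 : ℝ) • (p.1 : E d))
      ∂((surf d).prod (radial d)) := by
  have := (measurePreserving_polar_symm d).integral_comp
    (homeomorphUnitSphereProd (E d)).symm.measurableEmbedding (fun x => f x)
  simp only [homeomorphUnitSphereProd_symm_apply_coe] at this
  rw [this, integral_subtype_comap (measurableSet_singleton _).compl f,
    restrict_compl_singleton]

theorem integrable_iff_prod (f : E d → ℂ) :
    Integrable f ↔ Integrable (fun p : S d × Set.Ioi (0 : ℝ) => f ((p.2 : ℝ) • (p.1 : E d)))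
      ((surf d).prod (radial d)) := by
  have := (measurePreserving_polar_symm d).integrable_comp_emb (g := fun x => f x)
    (homeomorphUnitSphereProd (E d)).symm.measurableEmbedding
  simp only [Function.comp_def, homeomorphUnitSphereProd_symm_apply_coe] at this
  rw [this]
  conv_lhs => rw [← restrict_compl_singleton (μ := volume) (0 : E d), ← IntegrableOn,
    integrableOn_iff_comap_subtypeVal (measurableSet_singleton _).compl]
  rfl

theorem lintegral_eq_prod (f : E d → ℝ≥0∞) :
    ∫⁻ x, f x = ∫⁻ p : S d × Set.Ioi (0 : ℝ), f ((p.2 : ℝ) • (p.1 : E d))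
      ∂((surf d).prod (radial d)) := by
  have := (measurePreserving_polar_symm d).lintegral_comp_emb
    (homeomorphUnitSphereProd (E d)).symm.measurableEmbedding (fun x => f x)
  simp only [homeomorphUnitSphereProd_symm_apply_coe] at this
  rw [this, lintegral_subtype_comap (measurableSet_singleton _).compl f,
    restrict_compl_singleton]

theorem integral_polar {f : E d → ℂ} (hf : Integrable f) :
    ∫ x, f x = ∫ r in Set.Ioi (0 : ℝ), ((r ^ (d - 1) : ℝ) : ℂ) *
      ∫ ω : S d, f (r • (ω : E d)) ∂(surf d) := by
  rw [integral_eq_prod, integral_prod_symm _ ((integrable_iff_prod f).1 hf)]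
  exact integral_radial fun r => ∫ ω : S d, f (r • (ω : E d)) ∂(surf d)

/-- No integrability is assumed, because `integral_prod_mul` splits a product integrand
unconditionally. Radial factors whose convergence is unknown are therefore allowed. -/
theorem integral_polar_mul {F : E d → ℂ} {f : ℝ → ℂ} {g : S d → ℂ}
    (h : ∀ r : ℝ, 0 < r → ∀ ω : S d, F (r • (ω : E d)) = f r * g ω) :
    ∫ x, F x = (∫ r in Set.Ioi (0 : ℝ), ((r ^ (d - 1) : ℝ) : ℂ) * f r) *
      ∫ ω, g ω ∂(surf d) := by
  rw [integral_eq_prod, ← integral_radial, mul_comm,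
    ← integral_prod_mul (μ := surf d) (ν := radial d) g (fun r => f r)]
  congr 1
  funext p
  rw [h _ p.2.2, mul_comm]

theorem lintegral_polar_mul {F : E d → ℝ≥0∞} {f : ℝ → ℝ≥0∞} {g : S d → ℝ≥0∞}
    (hf : Measurable f) (hg : Measurable g)
    (h : ∀ r : ℝ, 0 < r → ∀ ω : S d, F (r • (ω : E d)) = f r * g ω) :
    ∫⁻ x, F x = (∫⁻ r in Set.Ioi (0 : ℝ), ENNReal.ofReal (r ^ (d - 1)) * f r) *
      ∫⁻ ω, g ω ∂(surf d) := by
  rw [lintegral_eq_prod, ← lintegral_radial, mul_comm,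
    ← lintegral_prod_mul (μ := surf d) (ν := radial d) (f := g) (g := fun r => f r)
      hg.aemeasurable (hf.comp measurable_subtype_coe).aemeasurable]
  congr 1
  funext p
  rw [h _ p.2.2, mul_comm]

end Polar

/-! ### Polynomials on Euclidean space and their Gaussian integrals -/

section Gauss

variable {d : ℕ}

/-- The function on `ℝ^d` defined by a polynomial with complex coefficients. -/
noncomputable def polyFun (p : MvPolynomial (Fin d) ℂ) (x : E d) : ℂ :=
  MvPolynomial.eval (fun i => (x i : ℂ)) p

theorem restrictPoly_apply (p : MvPolynomial (Fin d) ℂ) (ω : S d) :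
    restrictPoly d p ω = polyFun p ω := by
  simp only [restrictPoly, polyFun, AlgHom.toLinearMap_apply]
  induction p using MvPolynomial.induction_on with
  | C a => simp
  | add p q hp hq => simp [hp, hq]
  | mul_X p i hp => simp [hp]

theorem continuous_polyFun (p : MvPolynomial (Fin d) ℂ) : Continuous (polyFun p) := by
  unfold polyFun
  induction p using MvPolynomial.induction_on with
  | C a => simp [continuous_const]
  | add p q hp hq => exact (hp.add hq).congr (by simp)
  | mul_X p i hp =>
    simp only [map_mul, MvPolynomial.eval_X]
    exact hp.mul (by fun_prop)

theorem polyFun_smul {p : MvPolynomial (Fin d) ℂ} {n : ℕ} (hp : p.IsHomogeneous n) (r : ℝ)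
    (x : E d) : polyFun p (r • x) = (r : ℂ) ^ n * polyFun p x := by
  unfold polyFun
  rw [MvPolynomial.eval_eq, MvPolynomial.eval_eq, Finset.mul_sum]
  refine Finset.sum_congr rfl fun m hm => ?_
  have := hp (MvPolynomial.mem_support_iff.1 hm)
  simp only [PiLp.smul_apply, smul_eq_mul, Complex.ofReal_mul, mul_pow, Finset.prod_mul_distrib,
    Finset.prod_pow_eq_pow_sum]
  have h2 : ∑ i ∈ m.support, m i = n := by
    rw [← this, Finsupp.weight_apply, Finsupp.sum]; simp
  rw [h2]; ring

/-- The bound is needed for every ε so that the induction closes: multiplying by a coordinate spends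
half of ε on the old polynomial and the other half on the new linear factor. -/
theorem exists_norm_polyFun_le (p : MvPolynomial (Fin d) ℂ) {ε : ℝ} (hε : 0 < ε) :
    ∃ C : ℝ, ∀ x, ‖polyFun p x‖ ≤ C * Real.exp (ε * ‖x‖ ^ 2) := by
  induction p using MvPolynomial.induction_on generalizing ε with
  | C a =>
    refine ⟨‖a‖, fun x => ?_⟩
    simp only [polyFun, MvPolynomial.eval_C]
    exact le_mul_of_one_le_right (norm_nonneg _) (Real.one_le_exp (by positivity))
  | add p q hp hq =>
    obtain ⟨A, hA⟩ := hp hε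
    obtain ⟨B, hB⟩ := hq hε
    refine ⟨A + B, fun x => ?_⟩
    have h := norm_add_le (polyFun p x) (polyFun q x)
    have h2 : polyFun (p + q) x = polyFun p x + polyFun q x := by simp [polyFun]
    rw [h2]
    linarith [hA x, hB x]
  | mul_X p i hp =>
    obtain ⟨A, hA⟩ := hp (half_pos hε)
    refine ⟨A * (1 + 1 / ε), fun x => ?_⟩
    have hA' := hA x
    have hA0 : 0 ≤ A := by
      have := (norm_nonneg _).trans (hA 0)
      simpa using this
    have h1 : ‖(x i : ℂ)‖ ≤ ‖x‖ := by
      simpa using PiLp.norm_apply_le x i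
    have h2 : ‖x‖ ≤ (1 + 1 / ε) * Real.exp (ε / 2 * ‖x‖ ^ 2) := by
      have h3 := Real.add_one_le_exp (ε / 2 * ‖x‖ ^ 2)
      have h4 : ‖x‖ ≤ (1 + 1 / ε) * (ε / 2 * ‖x‖ ^ 2 + 1) := by
        have h6 : (1 + 1 / ε) * (ε / 2 * ‖x‖ ^ 2 + 1) =
          1 / ε + 1 + ‖x‖ ^ 2 / 2 + ε / 2 * ‖x‖ ^ 2 := by field_simp; ring
        have h7 : 0 < 1 / ε := by positivity
        have h8 : 0 ≤ ε / 2 * ‖x‖ ^ 2 := by positivity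
        nlinarith [sq_nonneg (‖x‖ - 1)]
      exact h4.trans (by gcongr)
    have h5 : polyFun (p * MvPolynomial.X i) x = polyFun p x * (x i : ℂ) := by simp [polyFun]
    rw [h5, norm_mul]
    calc ‖polyFun p x‖ * ‖(x i : ℂ)‖
        ≤ (A * Real.exp (ε / 2 * ‖x‖ ^ 2)) * ((1 + 1 / ε) * Real.exp (ε / 2 * ‖x‖ ^ 2)) :=
          mul_le_mul hA' (h1.trans h2) (norm_nonneg _) (by positivity)
      _ = A * (1 + 1 / ε) * (Real.exp (ε / 2 * ‖x‖ ^ 2) * Real.exp (ε / 2 * ‖x‖ ^ 2)) := by ring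
      _ = _ := by rw [← Real.exp_add]; ring_nf

/-- The Gaussian weight `exp (-|x|²/2)`. -/
noncomputable def gauss (x : E d) : ℂ := (Real.exp (-(‖x‖ ^ 2 / 2)) : ℂ)

theorem continuous_gauss : Continuous (gauss (d := d)) := by unfold gauss; fun_prop

theorem integrable_exp_neg_mul_sq {b : ℝ} (hb : 0 < b) :
    Integrable (fun x : E d => Real.exp (-b * ‖x‖ ^ 2)) := by
  have := (GaussianFourier.integrable_cexp_neg_mul_sq_norm_add (V := E d) (b := (b : ℂ))
    (by simpa using hb) 0 0).norm
  refine this.congr (ae_of_all _ fun x => ?_)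
  simp only [Complex.norm_exp]
  congr 1
  simp [← Complex.ofReal_pow]

theorem integrable_polyFun_mul_gauss (p : MvPolynomial (Fin d) ℂ) :
    Integrable (fun x => polyFun p x * gauss x) := by
  obtain ⟨C, hC⟩ := exists_norm_polyFun_le p (ε := 1 / 4) (by norm_num)
  refine ((integrable_exp_neg_mul_sq (d := d) (b := 1 / 4) (by norm_num)).const_mul C).mono'
    ((continuous_polyFun p).mul continuous_gauss).aestronglyMeasurable (ae_of_all _ fun x => ?_)
  rw [norm_mul]
  have : ‖gauss x‖ = Real.exp (-(‖x‖ ^ 2 / 2)) := by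
    simp only [gauss, Complex.norm_real]; simp
  rw [this]
  calc _ ≤ C * Real.exp (1 / 4 * ‖x‖ ^ 2) * Real.exp (-(‖x‖ ^ 2 / 2)) := by
        gcongr; exact hC x
    _ = _ := by rw [mul_assoc, ← Real.exp_add]; ring_nf

/-- The integral of a polynomial against the Gaussian weight. -/
noncomputable def gaussInt (d : ℕ) : MvPolynomial (Fin d) ℂ →ₗ[ℂ] ℂ where
  toFun p := ∫ x : E d, polyFun p x * gauss x
  map_add' p q := by
    rw [← integral_add (integrable_polyFun_mul_gauss p) (integrable_polyFun_mul_gauss q)]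
    congr 1; funext x; simp [polyFun, add_mul]
  map_smul' c p := by
    rw [RingHom.id_apply, smul_eq_mul, ← integral_const_mul]
    congr 1; funext x; simp [polyFun, mul_assoc]

theorem gaussInt_apply (p : MvPolynomial (Fin d) ℂ) :
    gaussInt d p = ∫ x : E d, polyFun p x * gauss x := rfl

theorem hasLineDerivAt_polyFun (p : MvPolynomial (Fin d) ℂ) (i : Fin d) (x : E d) :
    HasLineDerivAt ℝ (polyFun p) (polyFun (MvPolynomial.pderiv i p) x) x
      (EuclideanSpace.single i 1) := by
  unfold HasLineDerivAt
  induction p using MvPolynomial.induction_on with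
  | C a => simpa [polyFun] using hasDerivAt_const (0 : ℝ) a
  | add p q hp hq => simpa [polyFun] using hp.fun_add hq
  | mul_X p j hp =>
    have h1 : HasDerivAt (fun t : ℝ => (((x + t • EuclideanSpace.single i (1 : ℝ) : E d) j : ℝ) : ℂ))
        (if i = j then 1 else 0) 0 := by
      by_cases h : i = j
      · subst h
        have : HasDerivAt (fun t : ℝ => ((x i + t : ℝ) : ℂ)) ((1 : ℝ) : ℂ) 0 :=
          HasDerivAt.ofReal_comp ((hasDerivAt_id _).const_add _)
        simpa using this
      · have hji : ¬ j = i := fun e => h e.symm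
        simpa [h, hji] using hasDerivAt_const (0 : ℝ) ((x j : ℝ) : ℂ)
    have := hp.mul h1
    simp only [polyFun, map_mul, MvPolynomial.eval_X, Derivation.leibniz, MvPolynomial.pderiv_X,
      smul_eq_mul, map_add] at this ⊢
    refine this.congr_deriv ?_
    by_cases h : i = j
    · subst h; simp; ring
    · simp [h, mul_comm]

theorem hasLineDerivAt_gauss (i : Fin d) (x : E d) :
    HasLineDerivAt ℝ gauss (-((x i : ℂ) * gauss x)) x (EuclideanSpace.single i 1) := by
  unfold HasLineDerivAt gauss
  have h1 : ∀ t : ℝ, ‖x + t • EuclideanSpace.single i (1 : ℝ)‖ ^ 2 =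
      ‖x‖ ^ 2 + 2 * (t * x i) + t ^ 2 := by
    intro t
    rw [norm_add_sq_real]
    simp [inner_smul_right, norm_smul, EuclideanSpace.inner_single_right]
  have h2 : HasDerivAt (fun t : ℝ => Real.exp (-((‖x‖ ^ 2 + 2 * (t * x i) + t ^ 2) / 2)))
      (Real.exp (-((‖x‖ ^ 2 + 2 * ((0:ℝ) * x i) + (0:ℝ) ^ 2) / 2)) *
        (-((2 * (1 * x i) + 2 * (0:ℝ) ^ (2-1) * 1) / 2))) 0 := by
    refine HasDerivAt.exp (HasDerivAt.neg (HasDerivAt.div_const ?_ 2))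
    have := (((hasDerivAt_id (0:ℝ)).mul_const (x i)).const_mul 2).const_add (‖x‖ ^ 2)
    have h3 := (hasDerivAt_id (0:ℝ)).pow 2
    exact (this.add h3).congr_deriv (by simp)
  simp only [h1]
  refine h2.ofReal_comp.congr_deriv ?_
  push_cast
  simp
  ring

/-- Gaussian integration by parts. -/
theorem gaussInt_X_mul (i : Fin d) (p : MvPolynomial (Fin d) ℂ) :
    gaussInt d (MvPolynomial.X i * p) = gaussInt d (MvPolynomial.pderiv i p) := by
  have e : ∀ x : E d, polyFun p x * -((x i : ℂ) * gauss x) =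
      -(polyFun (MvPolynomial.X i * p) x * gauss x) := by
    intro x; simp [polyFun]; ring
  have := integral_bilinear_hasLineDerivAt_right_eq_neg_left_of_integrable
    (μ := (volume : Measure (E d))) (B := ContinuousLinearMap.mul ℝ ℂ)
    (f := polyFun p) (f' := polyFun (MvPolynomial.pderiv i p)) (g := gauss)
    (g' := fun x => -((x i : ℂ) * gauss x)) (v := EuclideanSpace.single i 1)
    (by simpa using integrable_polyFun_mul_gauss _)
    (by simpa [e] using (integrable_polyFun_mul_gauss (MvPolynomial.X i * p)).neg)
    (by simpa using integrable_polyFun_mul_gauss p)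
    (fun x _ => hasLineDerivAt_polyFun p i x) (fun x _ => hasLineDerivAt_gauss i x)
  simp only [ContinuousLinearMap.mul_apply', e, integral_neg, neg_inj] at this
  exact this

end Gauss

/-! ### Gaussian integrals of harmonic polynomials -/

section Harmonic

variable {d : ℕ}

open MvPolynomial in
theorem mem_harmonicPoly {k : ℕ} {p : MvPolynomial (Fin d) ℂ} :
    p ∈ harmonicPoly d k ↔ p.IsHomogeneous k ∧ ∑ i, pderiv i (pderiv i p) = 0 := by
  simp [harmonicPoly, polyLaplacian, mem_homogeneousSubmodule]

open MvPolynomial in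
theorem pderiv_pderiv_comm (i j : Fin d) (p : MvPolynomial (Fin d) ℂ) :
    pderiv i (pderiv j p) = pderiv j (pderiv i p) := by
  have h : ⁅(pderiv i : Derivation ℂ (MvPolynomial (Fin d) ℂ) (MvPolynomial (Fin d) ℂ)),
      (pderiv j : Derivation ℂ (MvPolynomial (Fin d) ℂ) (MvPolynomial (Fin d) ℂ))⁆ = 0 := by
    refine MvPolynomial.derivation_ext fun l => ?_
    simp only [Derivation.commutator_apply, pderiv_X, Pi.single_apply]
    split_ifs <;> simp
  have := congrArg (fun D => D p) h
  simpa [Derivation.commutator_apply, sub_eq_zero] using this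

open MvPolynomial in
theorem pderiv_mem_harmonicPoly {k : ℕ} {p : MvPolynomial (Fin d) ℂ}
    (hp : p ∈ harmonicPoly d (k + 1)) (i : Fin d) : pderiv i p ∈ harmonicPoly d k := by
  rw [mem_harmonicPoly] at hp ⊢
  refine ⟨by simpa using hp.1.pderiv (i := i), ?_⟩
  have : ∀ j, pderiv j (pderiv j (pderiv i p)) = pderiv i (pderiv j (pderiv j p)) := fun j => by
    rw [pderiv_pderiv_comm j i p, pderiv_pderiv_comm j i]
  simp only [this, ← map_sum, hp.2, map_zero]

open MvPolynomial in
/-- Green's formula for the Gaussian weight. -/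
theorem natCast_mul_gaussInt_mul {k : ℕ} {p : MvPolynomial (Fin d) ℂ}
    (hp : p ∈ harmonicPoly d k) (q : MvPolynomial (Fin d) ℂ) :
    (k : ℂ) * gaussInt d (p * q) = ∑ i, gaussInt d (pderiv i p * pderiv i q) := by
  rw [mem_harmonicPoly] at hp
  have h1 : ∀ i, gaussInt d (X i * (pderiv i p * q)) =
      gaussInt d (pderiv i (pderiv i p) * q) + gaussInt d (pderiv i p * pderiv i q) := fun i => by
    rw [gaussInt_X_mul, ← map_add]
    congr 1
    simp only [Derivation.leibniz, smul_eq_mul]; ring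
  -- Euler's identity produces the factor k. Integrating each X i by parts leaves the gradient
  -- pairing plus a term with the Laplacian of p, which is zero.
  have h2 : ∑ i, X i * (pderiv i p * q) = (k : ℂ) • (p * q) := by
    simp only [← mul_assoc, ← Finset.sum_mul, hp.1.sum_X_mul_pderiv]
    simp [smul_eq_C_mul, mul_assoc]
  have h3 := congrArg (gaussInt d) h2
  simp only [map_sum, h1, Finset.sum_add_distrib, map_smul, smul_eq_mul] at h3
  rw [← h3, ← map_sum, ← Finset.sum_mul, hp.2]
  simp

open MvPolynomial in
-- Green's formula lowers both degrees by one and preserves j < k, so the induction ends at a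
-- constant q, whose derivatives vanish.
theorem gaussInt_mul_eq_zero {k j : ℕ} (hjk : j < k) {p q : MvPolynomial (Fin d) ℂ}
    (hp : p ∈ harmonicPoly d k) (hq : q.IsHomogeneous j) : gaussInt d (p * q) = 0 := by
  induction k generalizing j p q with
  | zero => omega
  | succ k ih =>
    have h := natCast_mul_gaussInt_mul hp q
    have hz : ∀ i, gaussInt d (pderiv i p * pderiv i q) = 0 := fun i => by
      rcases Nat.eq_zero_or_pos j with rfl | hj
      · rw [← totalDegree_zero_iff_isHomogeneous, totalDegree_eq_zero_iff_eq_C] at hq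
        rw [hq, pderiv_C, mul_zero, map_zero]
      · exact ih (j := j - 1) (by omega) (pderiv_mem_harmonicPoly hp i) hq.pderiv
    rw [Finset.sum_eq_zero fun i _ => hz i] at h
    exact (mul_eq_zero.1 h).resolve_left (by exact_mod_cast Nat.succ_ne_zero k)

/-- The linear form `x ↦ x · ξ` as a polynomial. -/
noncomputable def linForm (ξ : E d) : MvPolynomial (Fin d) ℂ :=
  ∑ i, MvPolynomial.C (ξ i : ℂ) * MvPolynomial.X i

theorem linForm_isHomogeneous (ξ : E d) : (linForm ξ).IsHomogeneous 1 :=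
  MvPolynomial.IsHomogeneous.sum _ _ _ fun i _ =>
    by simpa using (MvPolynomial.isHomogeneous_C _ _).mul (MvPolynomial.isHomogeneous_X ℂ i)

theorem polyFun_linForm (ξ x : E d) : polyFun (linForm ξ) x = (inner ℝ x ξ : ℝ) := by
  simp [polyFun, linForm, PiLp.inner_apply]

open MvPolynomial in
theorem pderiv_linForm (ξ : E d) (i : Fin d) : pderiv i (linForm ξ) = C (ξ i : ℂ) := by
  simp [linForm, map_sum, Derivation.leibniz, pderiv_X, Pi.single_apply]

open MvPolynomial in
-- This is the moment recursion of a one-dimensional centred Gaussian of variance ‖ξ‖².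
theorem gaussInt_linForm_pow_add_two (ξ : E d) (m : ℕ) :
    gaussInt d (linForm ξ ^ (m + 2)) =
      (m + 1) * (‖ξ‖ ^ 2 : ℝ) * gaussInt d (linForm ξ ^ m) := by
  have h1 : linForm ξ ^ (m + 2) = ∑ i, (ξ i : ℂ) • (X i * linForm ξ ^ (m + 1)) := by
    rw [pow_succ' _ (m + 1)]
    conv_lhs => rw [linForm, Finset.sum_mul]
    simp [smul_eq_C_mul, mul_assoc, linForm]
  rw [h1, map_sum]
  have h2 : ∀ i, gaussInt d ((ξ i : ℂ) • (X i * linForm ξ ^ (m + 1))) =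
      (ξ i : ℂ) ^ 2 * ((m + 1) * gaussInt d (linForm ξ ^ m)) := fun i => by
    rw [map_smul, gaussInt_X_mul, Derivation.leibniz_pow, pderiv_linForm]
    have : (m + 1) • linForm ξ ^ (m + 1 - 1) • C (ξ i : ℂ) =
        (((m : ℂ) + 1) * ξ i) • linForm ξ ^ m := by
      simp [smul_eq_C_mul]; ring
    rw [this, map_smul]
    simp; ring
  simp only [h2, ← Finset.sum_mul]
  rw [EuclideanSpace.norm_sq_eq]
  simp; ring

open MvPolynomial in
theorem gaussInt_linForm (ξ : E d) : gaussInt d (linForm ξ) = 0 := by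
  rw [linForm, map_sum]
  refine Finset.sum_eq_zero fun i _ => ?_
  have : C (ξ i : ℂ) * X i = (ξ i : ℂ) • (X i * 1 : MvPolynomial (Fin d) ℂ) := by
    simp [smul_eq_C_mul]
  rw [this, map_smul, gaussInt_X_mul]
  simp

open MvPolynomial in
-- This is Funk–Hecke at the Gaussian level. Each use of Green's formula differentiates p once and
-- takes a factor from the power of the linear form; Euler's identity at ξ reassembles p(ξ) and
-- cancels the degree. For n < k the descending factorial is zero, so the truncated n - k is
-- harmless.
theorem gaussInt_mul_linForm_pow {k : ℕ} {p : MvPolynomial (Fin d) ℂ}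
    (hp : p ∈ harmonicPoly d k) (ξ : E d) (n : ℕ) :
    gaussInt d (p * linForm ξ ^ n) =
      n.descFactorial k * polyFun p ξ * gaussInt d (linForm ξ ^ (n - k)) := by
  induction k generalizing p n with
  | zero =>
    have hq := (mem_harmonicPoly.1 hp).1
    rw [← totalDegree_zero_iff_isHomogeneous, totalDegree_eq_zero_iff_eq_C] at hq
    rw [hq, ← smul_eq_C_mul, map_smul]
    simp [polyFun]
  | succ k ih =>
    have h := natCast_mul_gaussInt_mul hp (linForm ξ ^ n)
    have hk : ((k + 1 : ℕ) : ℂ) ≠ 0 := by exact_mod_cast Nat.succ_ne_zero k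
    apply mul_left_cancel₀ hk
    rw [h]
    rcases n with _ | n
    · simp
    have h2 : ∀ i, gaussInt d (pderiv i p * pderiv i (linForm ξ ^ (n + 1))) =
        (n + 1) * n.descFactorial k * gaussInt d (linForm ξ ^ (n - k)) *
          ((ξ i : ℂ) * polyFun (pderiv i p) ξ) := fun i => by
      rw [Derivation.leibniz_pow, pderiv_linForm]
      have : pderiv i p * (n + 1) • linForm ξ ^ (n + 1 - 1) • C (ξ i : ℂ) =
          (((n : ℂ) + 1) * ξ i) • (pderiv i p * linForm ξ ^ n) := by
        simp [smul_eq_C_mul]; ring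
      rw [this, map_smul, ih (pderiv_mem_harmonicPoly hp i)]
      simp; ring
    have h3 : ∑ i, (ξ i : ℂ) * polyFun (pderiv i p) ξ = (k + 1 : ℕ) * polyFun p ξ := by
      have := congrArg (fun q => polyFun q ξ) (mem_harmonicPoly.1 hp).1.sum_X_mul_pderiv
      simpa [polyFun] using this
    simp only [h2, ← Finset.mul_sum, h3, Nat.succ_descFactorial_succ, Nat.add_sub_add_right]
    push_cast; ring

end Harmonic

/-! ### Radial moments and integrals over the sphere -/

section Radial

variable {d : ℕ}

/-- The moment `∫ r^(n+d-1) exp (-r²/2) dr` over `(0, ∞)`. -/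
noncomputable def radMoment (d n : ℕ) : ℝ :=
  2 ^ (((n + d : ℕ) : ℝ) / 2 - 1) * Real.Gamma (((n + d : ℕ) : ℝ) / 2)

theorem radMoment_pos (hd : 0 < d) (n : ℕ) : 0 < radMoment d n := by
  unfold radMoment
  have : (0 : ℝ) < ((n + d : ℕ) : ℝ) / 2 := by
    have : (0 : ℝ) < ((n + d : ℕ) : ℝ) := by exact_mod_cast (by omega : 0 < n + d)
    positivity
  have := Real.Gamma_pos_of_pos this
  positivity

theorem radMoment_add_two (hd : 0 < d) (n : ℕ) :
    radMoment d (n + 2) = (n + d) * radMoment d n := by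
  unfold radMoment
  have h0 : (0 : ℝ) < ((n + d : ℕ) : ℝ) := by exact_mod_cast (by omega : 0 < n + d)
  have h : (((n + 2 + d : ℕ) : ℝ)) / 2 = ((n + d : ℕ) : ℝ) / 2 + 1 := by push_cast; ring
  rw [h, Real.Gamma_add_one (by positivity), add_sub_cancel_right,
    Real.rpow_sub_one (by norm_num)]
  push_cast; field_simp

theorem integral_radMoment (hd : 0 < d) (n : ℕ) :
    ∫ r in Set.Ioi (0 : ℝ), r ^ (d - 1) * (r ^ n * Real.exp (-(r ^ 2 / 2))) = radMoment d n := by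
  have h := integral_rpow_mul_exp_neg_mul_rpow (p := 2) (q := ((n + d : ℕ) : ℝ) - 1) (b := 1 / 2)
    (by norm_num) (by
      have : (0 : ℝ) < ((n + d : ℕ) : ℝ) := by exact_mod_cast (by omega : 0 < n + d)
      linarith) (by norm_num)
  rw [radMoment]
  convert h using 1
  · refine setIntegral_congr_fun measurableSet_Ioi fun r hr => ?_
    have : ((n + d : ℕ) : ℝ) - 1 = ((n + (d - 1) : ℕ) : ℝ) := by
      rw [Nat.cast_add, Nat.cast_add, Nat.cast_sub hd]; push_cast; ring
    simp only [this, Real.rpow_natCast, Real.rpow_ofNat]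
    rw [pow_add, ← mul_assoc, mul_comm (r ^ n)]
    congr 2; ring
  · rw [sub_add_cancel, one_div, Real.inv_rpow (by norm_num), ← Real.rpow_neg (by norm_num),
      Real.rpow_sub_one (by norm_num)]
    ring_nf

/-- Homogeneity separates the integrand in polar coordinates. Since the radial moment is positive,
spherical integrals can be read off from Gaussian ones. -/
theorem gaussInt_eq_mul_integral [Nontrivial (E d)] (hd : 0 < d)
    {p : MvPolynomial (Fin d) ℂ} {n : ℕ}
    (hp : p.IsHomogeneous n) :
    gaussInt d p = radMoment d n * ∫ ω : S d, polyFun p ω ∂(surf d) := by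
  rw [gaussInt_apply, integral_polar_mul (f := fun r => ((r ^ n * Real.exp (-(r ^ 2 / 2)) : ℝ) : ℂ))
    (g := fun ω => polyFun p ω)]
  · rw [← integral_radMoment hd, ← integral_complex_ofReal]
    simp only [Complex.ofReal_mul]
  · intro r hr ω
    rw [polyFun_smul hp, gauss, norm_smul]
    simp
    ring

/-- Integrals against a harmonic polynomial of polynomials of lower degree vanish. -/
theorem integral_harmonic_mul_eq_zero [Nontrivial (E d)] (hd : 0 < d) {k j : ℕ} (hjk : j < k)
    {p q : MvPolynomial (Fin d) ℂ} (hp : p ∈ harmonicPoly d k) (hq : q.IsHomogeneous j) :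
    ∫ ω : S d, polyFun p ω * polyFun q ω ∂(surf d) = 0 := by
  have h := gaussInt_eq_mul_integral hd ((mem_harmonicPoly.1 hp).1.mul hq)
  rw [gaussInt_mul_eq_zero hjk hp hq] at h
  have h2 := (mul_eq_zero.1 h.symm).resolve_left
    (by exact_mod_cast (radMoment_pos hd _).ne')
  simpa [polyFun] using h2

end Radial

/-! ### Jacobi weights -/

section Jacobi

/-- The Jacobi weight `(1-u)^(a-1) (1+u)^(b-1)` on `(-1, 1)`. -/
noncomputable def jacobiW (a b u : ℝ) : ℝ := (1 - u) ^ (a - 1) * (1 + u) ^ (b - 1)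

theorem jacobiW_nonneg {a b u : ℝ} (hu : u ∈ Set.Ioo (-1 : ℝ) 1) : 0 ≤ jacobiW a b u :=
  mul_nonneg (Real.rpow_nonneg (by linarith [hu.2]) _) (Real.rpow_nonneg (by linarith [hu.1]) _)

theorem measurable_jacobiW (a b : ℝ) : Measurable (jacobiW a b) := by
  unfold jacobiW; fun_prop

theorem beta_real {a b : ℝ} (ha : 0 < a) (hb : 0 < b) :
    IntervalIntegrable (fun x : ℝ => x ^ (b - 1) * (1 - x) ^ (a - 1)) volume 0 1 ∧
      ∫ x in (0 : ℝ)..1, x ^ (b - 1) * (1 - x) ^ (a - 1) =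
        Real.Gamma a * Real.Gamma b / Real.Gamma (a + b) := by
  have hc := Complex.betaIntegral_convergent (u := (b : ℂ)) (v := (a : ℂ)) (by simpa) (by simpa)
  have e : ∀ x ∈ Set.Ioo (0 : ℝ) 1, (x : ℂ) ^ ((b : ℂ) - 1) * (1 - (x : ℂ)) ^ ((a : ℂ) - 1) =
      ((x ^ (b - 1) * (1 - x) ^ (a - 1) : ℝ) : ℂ) := fun x hx => by
    rw [Complex.ofReal_mul, Complex.ofReal_cpow hx.1.le, Complex.ofReal_cpow (by linarith [hx.2])]
    push_cast; rfl
  constructor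
  · rw [intervalIntegrable_iff_integrableOn_Ioo_of_le zero_le_one] at hc ⊢
    have := (hc.congr_fun e measurableSet_Ioo).re
    simpa [IntegrableOn] using! this
  · have h2 := Complex.betaIntegral_eq_Gamma_mul_div (b : ℂ) (a : ℂ) (by simpa) (by simpa)
    rw [Complex.betaIntegral, intervalIntegral.integral_of_le zero_le_one,
      integral_Ioc_eq_integral_Ioo, setIntegral_congr_fun measurableSet_Ioo e,
      integral_complex_ofReal, Complex.Gamma_ofReal, Complex.Gamma_ofReal, ← Complex.ofReal_add,
      Complex.Gamma_ofReal] at h2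
    rw [intervalIntegral.integral_of_le zero_le_one, integral_Ioc_eq_integral_Ioo]
    have h3 : ((∫ x in Set.Ioo (0 : ℝ) 1, x ^ (b - 1) * (1 - x) ^ (a - 1) : ℝ) : ℂ) =
      ((Real.Gamma a * Real.Gamma b / Real.Gamma (a + b) : ℝ) : ℂ) := by
      rw [h2]; push_cast; rw [mul_comm (Real.Gamma b : ℂ), add_comm b a]
    exact_mod_cast h3

/-- The substitution u = 2x - 1 reduces Jacobi weights to Euler's beta integrand. -/
theorem jacobiW_comp {a b x : ℝ} (hx : x ∈ Set.Ioo (0 : ℝ) 1) :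
    jacobiW a b (2 * x - 1) = 2 ^ (a + b - 2) * (x ^ (b - 1) * (1 - x) ^ (a - 1)) := by
  have h1 : 1 - (2 * x - 1) = 2 * (1 - x) := by ring
  have h2 : 1 + (2 * x - 1) = 2 * x := by ring
  rw [jacobiW, h1, h2, Real.mul_rpow (by norm_num) (by linarith [hx.2]),
    Real.mul_rpow (by norm_num) hx.1.le]
  have : a + b - 2 = (a - 1) + (b - 1) := by ring
  rw [this, Real.rpow_add (by norm_num)]
  ring

theorem integrableOn_jacobiW {a b : ℝ} (ha : 0 < a) (hb : 0 < b) :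
    IntegrableOn (jacobiW a b) (Set.Ioo (-1) 1) := by
  have h := (beta_real ha hb).1
  rw [intervalIntegrable_iff_integrableOn_Ioo_of_le zero_le_one] at h
  have h1 : IntegrableOn (fun x => jacobiW a b (2 * x - 1)) (Set.Ioo 0 1) :=
    (IntegrableOn.congr_fun (h.const_mul (2 ^ (a + b - 2)))
      (fun x hx => (jacobiW_comp hx).symm) measurableSet_Ioo)
  rw [← intervalIntegrable_iff_integrableOn_Ioo_of_le zero_le_one] at h1
  have h2 := h1.comp_mul_left (c := 2⁻¹)
  have h3 := h2.comp_add_right 1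
  norm_num at h3
  rw [← intervalIntegrable_iff_integrableOn_Ioo_of_le (by norm_num)]
  refine h3.congr fun x _ => ?_
  congr 1; ring

theorem integral_jacobiW {a b : ℝ} (ha : 0 < a) (hb : 0 < b) :
    ∫ u in Set.Ioo (-1 : ℝ) 1, jacobiW a b u =
      2 ^ (a + b - 1) * (Real.Gamma a * Real.Gamma b / Real.Gamma (a + b)) := by
  have h := intervalIntegral.integral_comp_mul_sub (a := 0) (b := 1) (jacobiW a b)
    (two_ne_zero (α := ℝ)) 1
  rw [show (2 : ℝ) * 0 - 1 = -1 by norm_num, show (2 : ℝ) * 1 - 1 = 1 by norm_num,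
    smul_eq_mul] at h
  rw [← integral_Ioc_eq_integral_Ioo, ← intervalIntegral.integral_of_le (by norm_num)]
  have h2 : ∫ x in (0 : ℝ)..1, jacobiW a b (2 * x - 1) =
      2 ^ (a + b - 2) * (Real.Gamma a * Real.Gamma b / Real.Gamma (a + b)) := by
    rw [← (beta_real ha hb).2, ← intervalIntegral.integral_const_mul,
      intervalIntegral.integral_of_le zero_le_one, intervalIntegral.integral_of_le zero_le_one,
      integral_Ioc_eq_integral_Ioo, integral_Ioc_eq_integral_Ioo]
    exact setIntegral_congr_fun measurableSet_Ioo fun x hx => jacobiW_comp hx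
  rw [h2] at h
  have h3 : (2 : ℝ) ^ (a + b - 1) = 2 * 2 ^ (a + b - 2) := by
    rw [show a + b - 1 = (a + b - 2) + 1 by ring, Real.rpow_add_one (by norm_num)]; ring
  rw [h3]; linarith

/-- Moments of the symmetric Jacobi weight. -/
noncomputable def jacobiMoment (a : ℝ) (m : ℕ) : ℝ :=
  ∫ u in Set.Ioo (-1 : ℝ) 1, u ^ m * jacobiW a a u

theorem integrableOn_pow_mul_jacobiW {a : ℝ} (ha : 0 < a) (m : ℕ) :
    IntegrableOn (fun u => u ^ m * jacobiW a a u) (Set.Ioo (-1) 1) := by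
  refine (integrableOn_jacobiW ha ha).mono'
    ((measurable_id.pow_const m).mul (measurable_jacobiW a a)).aestronglyMeasurable ?_
  filter_upwards [ae_restrict_mem measurableSet_Ioo] with u hu
  rw [norm_mul, norm_pow, Real.norm_of_nonneg (jacobiW_nonneg hu)]
  refine mul_le_of_le_one_left (jacobiW_nonneg hu) (pow_le_one₀ (norm_nonneg _) ?_)
  rw [Real.norm_eq_abs, abs_le]; exact ⟨hu.1.le, hu.2.le⟩

theorem jacobiMoment_zero {a : ℝ} (ha : 0 < a) :
    jacobiMoment a 0 = 2 ^ (2 * a - 1) * (Real.Gamma a ^ 2 / Real.Gamma (2 * a)) := by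
  simp only [jacobiMoment, pow_zero, one_mul]
  rw [integral_jacobiW ha ha]; ring_nf

theorem hasDerivAt_jacobi {a u : ℝ} (hu : u ∈ Set.Ioo (-1 : ℝ) 1) :
    HasDerivAt (fun u : ℝ => (1 - u) ^ a * (1 + u) ^ a) (-(2 * a * u) * jacobiW a a u) u := by
  have h1 : (0 : ℝ) < 1 - u := by linarith [hu.2]
  have h2 : (0 : ℝ) < 1 + u := by linarith [hu.1]
  have d1 := ((hasDerivAt_id u).const_sub 1).rpow_const (p := a) (Or.inl h1.ne')
  have d2 := ((hasDerivAt_id u).const_add 1).rpow_const (p := a) (Or.inl h2.ne')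
  refine (d1.mul d2).congr_deriv ?_
  simp only [id, jacobiW, Real.rpow_sub_one h1.ne', Real.rpow_sub_one h2.ne']
  field_simp
  ring

theorem jacobi_factor {a u : ℝ} (hu : u ∈ Set.Ioo (-1 : ℝ) 1) :
    (1 - u) ^ a * (1 + u) ^ a = (1 - u ^ 2) * jacobiW a a u := by
  have h1 : (0 : ℝ) < 1 - u := by linarith [hu.2]
  have h2 : (0 : ℝ) < 1 + u := by linarith [hu.1]
  simp only [jacobiW, Real.rpow_sub_one h1.ne', Real.rpow_sub_one h2.ne']
  field_simp
  ring

/-- The boundary terms vanish because a > 0. The derivative is required only on the open interval,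
since the Jacobi weight may be singular at ±1. -/
theorem integral_deriv_jacobi {a : ℝ} (ha : 0 < a) {g g' : ℝ → ℝ} (hg : Continuous g)
    (hd : ∀ u ∈ Set.Ioo (-1 : ℝ) 1,
      HasDerivAt (fun u => g u * ((1 - u) ^ a * (1 + u) ^ a)) (g' u) u)
    (hi : IntegrableOn g' (Set.Ioo (-1) 1)) : ∫ u in Set.Ioo (-1 : ℝ) 1, g' u = 0 := by
  rw [← integral_Ioc_eq_integral_Ioo, ← intervalIntegral.integral_of_le (by norm_num),
    intervalIntegral.integral_eq_sub_of_hasDerivAt_of_le (by norm_num) _ hd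
      ((intervalIntegrable_iff_integrableOn_Ioo_of_le (by norm_num)).2 hi)]
  · simp [Real.zero_rpow ha.ne']
  · refine (hg.mul ((Continuous.rpow_const (by fun_prop) fun _ => Or.inr ha.le).mul
      (Continuous.rpow_const (by fun_prop) fun _ => Or.inr ha.le))).continuousOn

theorem jacobiMoment_one {a : ℝ} (ha : 0 < a) : jacobiMoment a 1 = 0 := by
  have h := integral_deriv_jacobi ha (g := fun _ => 1)
    (g' := fun u => -(2 * a) * (u ^ 1 * jacobiW a a u)) continuous_const
    (fun u hu => by
      simp only [one_mul]
      exact (hasDerivAt_jacobi hu).congr_deriv (by ring))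
    ((integrableOn_pow_mul_jacobiW ha 1).const_mul _)
  rw [integral_const_mul] at h
  exact (mul_eq_zero.1 h).resolve_left (by linarith)

/-- Integrate the derivative of u^(m+1) (1-u²)^a, rewriting (1-u²)^a as (1-u²) times the weight. -/
theorem jacobiMoment_add_two {a : ℝ} (ha : 0 < a) (m : ℕ) :
    (m + 1 + 2 * a) * jacobiMoment a (m + 2) = (m + 1) * jacobiMoment a m := by
  have i1 := (integrableOn_pow_mul_jacobiW ha m).const_mul ((m : ℝ) + 1)
  have i2 := (integrableOn_pow_mul_jacobiW ha (m + 2)).const_mul ((m : ℝ) + 1 + 2 * a)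
  have h := integral_deriv_jacobi ha (g := fun u => u ^ (m + 1))
    (g' := fun u => ((m : ℝ) + 1) * (u ^ m * jacobiW a a u) -
      ((m : ℝ) + 1 + 2 * a) * (u ^ (m + 2) * jacobiW a a u)) (by fun_prop)
    (fun u hu => by
      refine ((hasDerivAt_pow (m + 1) u).mul (hasDerivAt_jacobi hu)).congr_deriv ?_
      rw [jacobi_factor hu]
      push_cast
      ring)
    (i1.sub i2)
  rw [integral_sub i1 i2, integral_const_mul, integral_const_mul, sub_eq_zero] at h
  exact h.symm

end Jacobi

/-! ### The Funk–Hecke formula for exponentials -/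

section FunkHecke

variable {d : ℕ}

/-- Because |t| ≤ 1, the exponential series is dominated by ‖f‖ ‖z‖^n / n!. It is applied both on
the sphere and on (-1, 1), so that Funk–Hecke reduces to comparing moments. -/
theorem hasSum_integral_exp {α : Type*} [MeasurableSpace α] {μ : Measure α} {f : α → ℂ}
    (hf : Integrable f μ) {t : α → ℝ} (ht : AEStronglyMeasurable t μ) (h1 : ∀ᵐ a ∂μ, |t a| ≤ 1)
    (z : ℂ) :
    HasSum (fun n : ℕ => z ^ n / (n.factorial : ℂ) * ∫ a, f a * ((t a : ℝ) : ℂ) ^ n ∂μ)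
      (∫ a, f a * Complex.exp (z * (t a : ℝ)) ∂μ) := by
  have ht' : AEStronglyMeasurable (fun a => ((t a : ℝ) : ℂ)) μ :=
    Complex.continuous_ofReal.comp_aestronglyMeasurable ht
  have h := hasSum_integral_of_dominated_convergence (μ := μ)
    (F := fun (n : ℕ) a => z ^ n / (n.factorial : ℂ) * (f a * ((t a : ℝ) : ℂ) ^ n))
    (f := fun a => f a * Complex.exp (z * (t a : ℝ)))
    (fun n a => ‖f a‖ * (‖z‖ ^ n / n.factorial))
    (fun n => (hf.aestronglyMeasurable.mul (ht'.pow n)).const_mul _) ?_ ?_ ?_ ?_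
  · simpa only [integral_const_mul] using h
  · intro n
    filter_upwards [h1] with a ha
    have : ‖((t a : ℝ) : ℂ)‖ ^ n ≤ 1 :=
      pow_le_one₀ (norm_nonneg _) (by simpa using ha)
    rw [norm_mul, norm_mul, norm_div, norm_pow, norm_pow, Complex.norm_natCast]
    calc _ ≤ ‖z‖ ^ n / n.factorial * (‖f a‖ * 1) := by gcongr
      _ = _ := by ring
  · exact ae_of_all _ fun a => (Real.summable_pow_div_factorial ‖z‖).mul_left _
  · simp only [tsum_mul_left]
    exact hf.norm.mul_const _
  · refine ae_of_all _ fun a => ?_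
    have := (NormedSpace.expSeries_div_hasSum_exp (z * (t a : ℝ))).mul_left (f a)
    rw [← Complex.exp_eq_exp_ℂ] at this
    refine this.congr_fun ?_
    intro n
    rw [mul_pow]; ring

/-- The exponent of the Jacobi weight belonging to harmonics of degree `k`. -/
noncomputable def jacobiIdx (d k : ℕ) : ℝ := k + ((d : ℝ) - 1) / 2

theorem jacobiIdx_pos (hd : 2 ≤ d) (k : ℕ) : 0 < jacobiIdx d k := by
  have : (2 : ℝ) ≤ d := by exact_mod_cast hd
  unfold jacobiIdx
  have : (0 : ℝ) ≤ k := by positivity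
  linarith

/-- The constant in front of the Funk–Hecke formula. -/
noncomputable def funkConst (d k : ℕ) : ℝ :=
  (2 * Real.pi) ^ ((d : ℝ) / 2) / (jacobiMoment (jacobiIdx d k) 0 * radMoment d (2 * k))

/-- The multiplier by which the kernel `exp (z ω · φ)` acts on spherical harmonics of
degree `k`. -/
noncomputable def funkCoef (d k : ℕ) (z : ℂ) : ℂ :=
  funkConst d k * z ^ k * ∫ u in Set.Ioo (-1 : ℝ) 1,
    (jacobiW (jacobiIdx d k) (jacobiIdx d k) u : ℂ) * Complex.exp (z * (u : ℝ))

theorem gaussInt_one : gaussInt d 1 = ((2 * Real.pi) ^ ((d : ℝ) / 2) : ℝ) := by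
  have h := GaussianFourier.integral_rexp_neg_mul_sq_norm (V := E d) (b := 1 / 2) (by norm_num)
  rw [finrank_euclideanSpace_fin] at h
  rw [gaussInt_apply]
  have e : ∀ x : E d, polyFun 1 x * gauss x = ((Real.exp (-(1 / 2) * ‖x‖ ^ 2) : ℝ) : ℂ) := by
    intro x
    simp only [polyFun, gauss, map_one, one_mul]
    congr 2; ring
  simp only [e]
  rw [integral_complex_ofReal, h]
  congr 2; ring

/-- Both sides obey the same two-step recursion in m. The Jacobi moment contributes (m+1)/(m+1+2a),
the radial moment contributes m+2k+d, and a = `jacobiIdx d k` is chosen so that 1+2a = 2k+d. -/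
theorem gaussInt_linForm_pow_mul (hd : 2 ≤ d) (k : ℕ) {ξ : E d} (hξ : ‖ξ‖ = 1) (m : ℕ) :
    gaussInt d (linForm ξ ^ m) * (jacobiMoment (jacobiIdx d k) 0 * radMoment d (2 * k) : ℝ) =
      gaussInt d 1 * (jacobiMoment (jacobiIdx d k) m * radMoment d (m + 2 * k) : ℝ) := by
  have ha := jacobiIdx_pos hd k
  induction m using Nat.twoStepInduction with
  | zero => simp
  | one => simp [gaussInt_linForm, jacobiMoment_one ha]
  | more m ih _ =>
    rw [gaussInt_linForm_pow_add_two, hξ, show m + 2 + 2 * k = (m + 2 * k) + 2 by ring,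
      radMoment_add_two (by omega)]
    have h := jacobiMoment_add_two ha m
    have h2 : (m : ℝ) + 1 + 2 * jacobiIdx d k = ((m + 2 * k : ℕ) : ℝ) + d := by
      unfold jacobiIdx; push_cast; ring
    rw [h2] at h
    have h3 : jacobiMoment (jacobiIdx d k) (m + 2) *
        ((((m + 2 * k : ℕ) : ℝ) + d) * radMoment d (m + 2 * k)) =
        (m + 1) * (jacobiMoment (jacobiIdx d k) m * radMoment d (m + 2 * k)) := by
      rw [← mul_assoc, mul_comm (jacobiMoment _ (m + 2)), h]; ring
    rw [h3, Complex.ofReal_mul (_ + 1), mul_left_comm, ← ih]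
    push_cast; ring

theorem jacobiMoment_zero_pos {a : ℝ} (ha : 0 < a) : 0 < jacobiMoment a 0 := by
  rw [jacobiMoment_zero ha]
  have := Real.Gamma_pos_of_pos ha
  have := Real.Gamma_pos_of_pos (mul_pos two_pos ha)
  positivity

theorem funkConst_pos (hd : 2 ≤ d) (k : ℕ) : 0 < funkConst d k := by
  have := jacobiMoment_zero_pos (jacobiIdx_pos hd k)
  have := radMoment_pos (d := d) (by omega) (2 * k)
  unfold funkConst
  positivity

/-- Divide the Gaussian identity by the radial moment of degree k + n. The moments of the linear
form then become Jacobi moments, up to the ratio `funkConst`, which does not depend on n. -/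
theorem integral_harmonic_mul_inner_pow (hd : 2 ≤ d) {k : ℕ} {p : MvPolynomial (Fin d) ℂ}
    (hp : p ∈ harmonicPoly d k) {ξ : E d} (hξ : ‖ξ‖ = 1) (n : ℕ) :
    ∫ ω : S d, polyFun p ω * ((inner ℝ (ω : E d) ξ : ℝ) : ℂ) ^ n ∂(surf d) =
      n.descFactorial k * polyFun p ξ *
        (funkConst d k * jacobiMoment (jacobiIdx d k) (n - k) : ℝ) := by
  have := nontrivial_E hd
  have h := gaussInt_eq_mul_integral (d := d) (by omega) ((mem_harmonicPoly.1 hp).1.mul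
    ((linForm_isHomogeneous ξ).pow n))
  rw [gaussInt_mul_linForm_pow hp] at h
  have e : ∀ ω : S d, polyFun (p * linForm ξ ^ n) ω =
      polyFun p ω * ((inner ℝ (ω : E d) ξ : ℝ) : ℂ) ^ n := fun ω => by
    rw [← polyFun_linForm]; simp [polyFun]
  simp only [e, one_mul] at h
  rcases lt_or_ge n k with hn | hn
  · rw [Nat.descFactorial_of_lt hn] at h ⊢
    have := (radMoment_pos (d := d) (by omega) (k + n)).ne'
    simp only [Nat.cast_zero, zero_mul] at h ⊢
    exact (mul_eq_zero.1 h.symm).resolve_left (by exact_mod_cast this)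
  · have hR := (radMoment_pos (d := d) (by omega) (k + n)).ne'
    have hR' := (radMoment_pos (d := d) (by omega) (2 * k)).ne'
    have hJ := (jacobiMoment_zero_pos (jacobiIdx_pos hd k)).ne'
    have h2 := gaussInt_linForm_pow_mul hd k hξ (n - k)
    rw [show n - k + 2 * k = k + n by omega, gaussInt_one] at h2
    have h3 : gaussInt d (linForm ξ ^ (n - k)) =
        (funkConst d k * jacobiMoment (jacobiIdx d k) (n - k) * radMoment d (k + n) : ℝ) := by
      have hne : ((jacobiMoment (jacobiIdx d k) 0 * radMoment d (2 * k) : ℝ) : ℂ) ≠ 0 := by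
        exact_mod_cast mul_ne_zero hJ hR'
      apply mul_right_cancel₀ hne
      rw [h2, ← Complex.ofReal_mul, ← Complex.ofReal_mul]
      congr 1
      unfold funkConst
      field_simp
    rw [h3] at h
    have hRc : (radMoment d (k + n) : ℂ) ≠ 0 := by exact_mod_cast hR
    apply mul_left_cancel₀ hRc
    rw [← h]
    push_cast; ring

theorem norm_coe_sphere (ω : S d) : ‖(ω : E d)‖ = 1 := by simp

theorem abs_inner_sphere_le (ω φ : S d) : |inner ℝ (ω : E d) (φ : E d)| ≤ 1 := by
  simpa using abs_real_inner_le_norm (ω : E d) (φ : E d)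

theorem integrable_continuousMap (Y : C(S d, ℂ)) : Integrable Y (surf d) :=
  Y.continuous.integrable_of_hasCompactSupport (HasCompactSupport.of_compactSpace _)

/-- **Funk–Hecke formula** for the kernel `exp (z ω · φ)`. -/
theorem funk_hecke (hd : 2 ≤ d) {k : ℕ} {Y : C(S d, ℂ)} (hY : Y ∈ harmC d k) (z : ℂ) (φ : S d) :
    ∫ ω : S d, Y ω * Complex.exp (z * (inner ℝ (ω : E d) (φ : E d) : ℝ)) ∂(surf d) =
      funkCoef d k z * Y φ := by
  obtain ⟨p, hp, rfl⟩ := hY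
  have ha := jacobiIdx_pos hd k
  have h1 := hasSum_integral_exp (integrable_continuousMap (restrictPoly d p))
    (t := fun ω : S d => inner ℝ (ω : E d) (φ : E d))
    (by fun_prop) (ae_of_all _ fun ω => abs_inner_sphere_le ω φ) z
  have hJ : Integrable (fun u => (jacobiW (jacobiIdx d k) (jacobiIdx d k) u : ℂ))
      (volume.restrict (Set.Ioo (-1) 1)) := (integrableOn_jacobiW ha ha).ofReal
  have h2 := hasSum_integral_exp hJ (t := fun u => u) (by fun_prop) (by
      filter_upwards [ae_restrict_mem measurableSet_Ioo] with u hu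
      rw [abs_le]; exact ⟨hu.1.le, hu.2.le⟩) z
  refine h1.unique ?_
  simp only [restrictPoly_apply, integral_harmonic_mul_inner_pow hd hp (norm_coe_sphere φ)]
  have h3 := h2.mul_left (funkConst d k * z ^ k * polyFun p φ)
  have e : funkCoef d k z * polyFun p φ = funkConst d k * z ^ k * polyFun p φ *
      ∫ u in Set.Ioo (-1 : ℝ) 1,
        (jacobiW (jacobiIdx d k) (jacobiIdx d k) u : ℂ) * Complex.exp (z * (u : ℝ)) := by
    unfold funkCoef; ring
  rw [e]
  -- The first k terms vanish with the descending factorial. Shifting the index by k extracts z^k,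
  -- and (m+k)! = m! · (m+k)(m+k-1)⋯(m+1) matches the coefficients.
  have h4 := (hasSum_nat_add_iff (f := fun n : ℕ => z ^ n / (n.factorial : ℂ) *
    (n.descFactorial k * polyFun p φ *
        (funkConst d k * jacobiMoment (jacobiIdx d k) (n - k) : ℝ))) k).1 (h3.congr_fun ?_)
  · rwa [Finset.sum_eq_zero, add_zero] at h4
    intro n hn
    rw [Nat.descFactorial_of_lt (Finset.mem_range.1 hn)]; simp
  · intro m
    have h5 : ∫ u in Set.Ioo (-1 : ℝ) 1,
        (jacobiW (jacobiIdx d k) (jacobiIdx d k) u : ℂ) * (u : ℂ) ^ m =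
        (jacobiMoment (jacobiIdx d k) m : ℂ) := by
      rw [jacobiMoment, ← integral_complex_ofReal]
      congr 1; funext u; push_cast; ring
    rw [h5, Nat.add_sub_cancel]
    have h6 := Nat.factorial_mul_descFactorial (Nat.le_add_left k m)
    rw [Nat.add_sub_cancel] at h6
    rw [← h6]
    have h7 : ((m + k).descFactorial k : ℂ) ≠ 0 := by
      exact_mod_cast (Nat.descFactorial_pos.2 (Nat.le_add_left k m)).ne'
    have h8 : (m.factorial : ℂ) ≠ 0 := by exact_mod_cast m.factorial_ne_zero
    push_cast
    field_simp
    ring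

theorem measurable_funkCoef (d k : ℕ) : Measurable (funkCoef d k) := by
  unfold funkCoef
  refine Measurable.mul (by fun_prop) ?_
  have h : StronglyMeasurable (Function.uncurry fun (z : ℂ) (u : ℝ) =>
      (jacobiW (jacobiIdx d k) (jacobiIdx d k) u : ℂ) * Complex.exp (z * (u : ℝ))) := by
    refine Measurable.stronglyMeasurable ?_
    have := measurable_jacobiW (jacobiIdx d k) (jacobiIdx d k)
    unfold Function.uncurry
    fun_prop
  exact (h.integral_prod_right (ν := volume.restrict (Set.Ioo (-1 : ℝ) 1))).measurable

theorem conj_funkCoef (k : ℕ) (z : ℂ) : conj (funkCoef d k z) = funkCoef d k (conj z) := by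
  unfold funkCoef
  rw [map_mul, map_mul, map_pow, Complex.conj_ofReal, ← integral_conj]
  simp only [map_mul, Complex.conj_ofReal, ← Complex.exp_conj]

theorem funkCoef_ofReal (k : ℕ) (τ : ℝ) : funkCoef d k τ =
    (funkConst d k * τ ^ k * ∫ u in Set.Ioo (-1 : ℝ) 1,
      jacobiW (jacobiIdx d k) (jacobiIdx d k) u * Real.exp (τ * u) : ℝ) := by
  unfold funkCoef
  push_cast
  rw [← integral_complex_ofReal]
  push_cast
  rfl

end FunkHecke

/-! ### Orthogonality and completeness of spherical harmonics -/

section Complete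

variable {d : ℕ}

/-- The polynomial with complex conjugate coefficients. -/
noncomputable def conjPoly (p : MvPolynomial (Fin d) ℂ) : MvPolynomial (Fin d) ℂ :=
  MvPolynomial.map (starRingEnd ℂ) p

theorem polyFun_conjPoly (p : MvPolynomial (Fin d) ℂ) (x : E d) :
    polyFun (conjPoly p) x = conj (polyFun p x) := by
  simp only [polyFun, conjPoly]
  induction p using MvPolynomial.induction_on with
  | C a => simp
  | add p q hp hq => simp [hp, hq]
  | mul_X p i hp => simp [hp]

theorem conjPoly_mem_harmonicPoly {k : ℕ} {p : MvPolynomial (Fin d) ℂ}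
    (hp : p ∈ harmonicPoly d k) : conjPoly p ∈ harmonicPoly d k := by
  rw [mem_harmonicPoly] at hp ⊢
  refine ⟨hp.1.map _, ?_⟩
  simp only [conjPoly, MvPolynomial.pderiv_map]
  rw [← map_sum, hp.2, map_zero]

/-- The factor of higher degree annihilates the other one; conjugating coefficients preserves
harmonicity, so either factor may play that role. -/
theorem integral_conj_mul_eq_zero (hd : 2 ≤ d) {j k : ℕ} (hjk : j ≠ k) {Y Z : C(S d, ℂ)}
    (hY : Y ∈ harmC d j) (hZ : Z ∈ harmC d k) : ∫ ω, conj (Y ω) * Z ω ∂(surf d) = 0 := by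
  have := nontrivial_E hd
  obtain ⟨p, hp, rfl⟩ := hY
  obtain ⟨q, hq, rfl⟩ := hZ
  simp only [restrictPoly_apply, ← polyFun_conjPoly]
  rcases lt_or_gt_of_ne hjk with h | h
  · simp only [mul_comm (polyFun (conjPoly p) _)]
    exact integral_harmonic_mul_eq_zero (by omega) h hq
      (mem_harmonicPoly.1 (conjPoly_mem_harmonicPoly hp)).1
  · exact integral_harmonic_mul_eq_zero (by omega) h (conjPoly_mem_harmonicPoly hp)
      (mem_harmonicPoly.1 hq).1

theorem inner_toLp_toLp (Y Z : C(S d, ℂ)) :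
    inner ℂ (ContinuousMap.toLp (E := ℂ) 2 (surf d) ℂ Y)
      (ContinuousMap.toLp (E := ℂ) 2 (surf d) ℂ Z) = ∫ ω, conj (Y ω) * Z ω ∂(surf d) := by
  rw [ContinuousMap.inner_toLp]
  congr 1; funext ω; rw [mul_comm]

theorem orthogonalFamily_harm (hd : 2 ≤ d) :
    OrthogonalFamily ℂ (fun k => harm d k) fun k => (harm d k).subtypeₗᵢ := by
  rintro j k hjk ⟨u, hu⟩ ⟨v, hv⟩
  obtain ⟨Y, hY, rfl⟩ := hu
  obtain ⟨Z, hZ, rfl⟩ := hv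
  exact (inner_toLp_toLp Y Z).trans (integral_conj_mul_eq_zero hd hjk hY hZ)

/-- The polynomial `|x|²`. -/
noncomputable def normSqPoly (d : ℕ) : MvPolynomial (Fin d) ℂ := ∑ i, MvPolynomial.X i ^ 2

theorem normSqPoly_isHomogeneous (d : ℕ) : (normSqPoly d).IsHomogeneous 2 :=
  MvPolynomial.IsHomogeneous.sum _ _ _ fun i _ => MvPolynomial.isHomogeneous_X_pow i 2

theorem polyFun_normSqPoly_sphere (ω : S d) : polyFun (normSqPoly d) ω = 1 := by
  have h : ‖(ω : E d)‖ ^ 2 = 1 := by simp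
  rw [EuclideanSpace.norm_sq_eq] at h
  simp only [polyFun, normSqPoly, map_sum, map_pow, MvPolynomial.eval_X]
  have h' := congrArg ((↑) : ℝ → ℂ) h
  simpa using h'

/-- Homogeneity and continuity extend the vanishing to all of ℝ^d. The real points form a product of
infinite sets, which determines a complex polynomial. -/
theorem eq_zero_of_polyFun_sphere [Nontrivial (E d)] {q : MvPolynomial (Fin d) ℂ} {n : ℕ}
    (hq : q.IsHomogeneous n) (h : ∀ ω : S d, polyFun q ω = 0) : q = 0 := by
  have hall : ∀ x : E d, x ≠ 0 → polyFun q x = 0 := fun x hx => by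
    have : x = ‖x‖ • ((dir x hx : S d) : E d) := by
      simp [dir, smul_smul, hx]
    rw [this, polyFun_smul hq, h, mul_zero]
  have hall' : ∀ x : E d, polyFun q x = 0 := by
    have hd : Dense ({0}ᶜ : Set (E d)) := dense_compl_singleton 0
    have := (continuous_polyFun q).ext_on hd (g := fun _ => 0) continuous_const
      (fun x hx => hall x hx)
    exact fun x => congrFun this x
  refine MvPolynomial.funext_set (fun _ => Set.range ((↑) : ℝ → ℂ))
    (fun _ => Set.infinite_range_of_injective Complex.ofReal_injective) fun x hx => ?_
  choose y hy using fun i => hx i trivial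
  have := hall' (WithLp.toLp 2 y)
  have e : x = fun i => (y i : ℂ) := funext fun i => (hy i).symm
  rw [e, map_zero]
  exact this

/-- If |x|² q is harmonic of degree n + 2, it is orthogonal on the sphere to q, which has lower
degree. There |x|² = 1, so the integral of |q|² vanishes. -/
theorem eq_zero_of_polyLaplacian_normSqPoly_mul (hd : 2 ≤ d) {q : MvPolynomial (Fin d) ℂ} {n : ℕ}
    (hq : q.IsHomogeneous n) (h : polyLaplacian d (normSqPoly d * q) = 0) : q = 0 := by
  have := nontrivial_E hd
  refine eq_zero_of_polyFun_sphere hq ?_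
  have hh : normSqPoly d * q ∈ harmonicPoly d (n + 2) := by
    refine ⟨?_, h⟩
    have := (normSqPoly_isHomogeneous d).mul hq
    rwa [add_comm] at this
  have hi := integral_harmonic_mul_eq_zero (by omega) (by omega : n < n + 2) hh
    (hq.map (starRingEnd ℂ))
  have e : ∀ ω : S d, polyFun (normSqPoly d * q) ω *
      polyFun (MvPolynomial.map (starRingEnd ℂ) q) ω = ((‖polyFun q ω‖ ^ 2 : ℝ) : ℂ) := fun ω => by
    have h1 : polyFun (normSqPoly d * q) ω = polyFun (normSqPoly d) ω * polyFun q ω := by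
      simp [polyFun]
    have h2 := polyFun_conjPoly q ω
    rw [conjPoly] at h2
    rw [h1, polyFun_normSqPoly_sphere, one_mul, h2, Complex.mul_conj, Complex.normSq_eq_norm_sq]
  simp only [e] at hi
  rw [integral_complex_ofReal, Complex.ofReal_eq_zero] at hi
  have hc : Continuous fun ω : S d => ‖polyFun q ω‖ ^ 2 :=
    ((continuous_polyFun q).comp continuous_subtype_val).norm.pow 2
  rw [integral_eq_zero_iff_of_nonneg (fun ω => by positivity)
    (hc.integrable_of_hasCompactSupport (HasCompactSupport.of_compactSpace _))] at hi
  have := (Continuous.ae_eq_iff_eq (surf d) hc (g := fun _ => (0 : ℝ)) continuous_const).1 hi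
  intro ω
  simpa using congrFun this ω

theorem polyLaplacian_apply (p : MvPolynomial (Fin d) ℂ) :
    polyLaplacian d p = ∑ i, MvPolynomial.pderiv i (MvPolynomial.pderiv i p) := by
  simp [polyLaplacian]

theorem polyLaplacian_isHomogeneous {p : MvPolynomial (Fin d) ℂ} {n : ℕ}
    (hp : p.IsHomogeneous (n + 2)) : (polyLaplacian d p).IsHomogeneous n := by
  rw [polyLaplacian_apply]
  exact MvPolynomial.IsHomogeneous.sum _ _ _ fun i _ => hp.pderiv.pderiv

theorem polyLaplacian_eq_zero {p : MvPolynomial (Fin d) ℂ} {n : ℕ} (hn : n < 2)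
    (hp : p.IsHomogeneous n) : polyLaplacian d p = 0 := by
  rw [polyLaplacian_apply]
  refine Finset.sum_eq_zero fun i _ => ?_
  have h : (MvPolynomial.pderiv i p).IsHomogeneous 0 := by
    have := hp.pderiv (i := i)
    rwa [show n - 1 = 0 by omega] at this
  rw [← MvPolynomial.totalDegree_zero_iff_isHomogeneous,
    MvPolynomial.totalDegree_eq_zero_iff_eq_C] at h
  rw [h, MvPolynomial.pderiv_C]

/-- Every homogeneous polynomial is harmonic up to a multiple of `|x|²`. -/
theorem exists_sub_normSqPoly_mul_mem (hd : 2 ≤ d) {n : ℕ} {p : MvPolynomial (Fin d) ℂ}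
    (hp : p.IsHomogeneous (n + 2)) :
    ∃ q : MvPolynomial (Fin d) ℂ, q.IsHomogeneous n ∧
      p - normSqPoly d * q ∈ harmonicPoly d (n + 2) := by
  have hle : MvPolynomial.homogeneousSubmodule (Fin d) ℂ n ≤
      MvPolynomial.restrictTotalDegree (Fin d) ℂ n := fun p hp => by
    rw [MvPolynomial.mem_restrictTotalDegree]
    exact MvPolynomial.IsHomogeneous.totalDegree_le hp
  have : FiniteDimensional ℂ (MvPolynomial.homogeneousSubmodule (Fin d) ℂ n) :=
    Submodule.finiteDimensional_of_le hle
  have hmul : ∀ q : MvPolynomial (Fin d) ℂ, q.IsHomogeneous n →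
      (normSqPoly d * q).IsHomogeneous (n + 2) := fun q hq => by
    have := (normSqPoly_isHomogeneous d).mul hq
    rwa [add_comm] at this
  -- The map q ↦ Δ(|x|² q) is an injective endomorphism of a finite-dimensional space, hence onto. A
  -- preimage of Δp is the required q.
  let T := (polyLaplacian d ∘ₗ LinearMap.mulLeft ℂ (normSqPoly d)).restrict
    (p := MvPolynomial.homogeneousSubmodule (Fin d) ℂ n)
    (q := MvPolynomial.homogeneousSubmodule (Fin d) ℂ n)
    (fun q hq => polyLaplacian_isHomogeneous (hmul q hq))
  have hinj : Function.Injective T := by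
    rw [← LinearMap.ker_eq_bot, LinearMap.ker_eq_bot']
    rintro ⟨q, hq⟩ h
    exact Subtype.ext (eq_zero_of_polyLaplacian_normSqPoly_mul hd hq (congrArg Subtype.val h))
  obtain ⟨⟨q, hq⟩, h⟩ := (LinearMap.injective_iff_surjective.1 hinj)
    ⟨polyLaplacian d p, polyLaplacian_isHomogeneous hp⟩
  refine ⟨q, hq, Submodule.sub_mem _ hp (hmul q hq), ?_⟩
  have h' : polyLaplacian d (normSqPoly d * q) = polyLaplacian d p := congrArg Subtype.val h
  change polyLaplacian d _ = 0
  rw [map_sub, h', sub_self]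

/-- On the sphere |x|² q equals q, so the decomposition of p lowers the degree by two, and strong
induction applies. -/
theorem restrictPoly_mem_iSup (hd : 2 ≤ d) (p : MvPolynomial (Fin d) ℂ) :
    restrictPoly d p ∈ ⨆ k, harmC d k := by
  have hhom : ∀ n (p : MvPolynomial (Fin d) ℂ), p.IsHomogeneous n →
      restrictPoly d p ∈ ⨆ k, harmC d k := by
    intro n
    induction n using Nat.strong_induction_on with
    | _ n ih =>
      intro p hp
      rcases lt_or_ge n 2 with hn | hn
      · exact Submodule.mem_iSup_of_mem n ⟨p, ⟨hp, polyLaplacian_eq_zero hn hp⟩, rfl⟩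
      · obtain ⟨m, rfl⟩ := Nat.exists_eq_add_of_le' hn
        obtain ⟨q, hq, h⟩ := exists_sub_normSqPoly_mul_mem hd hp
        have e : restrictPoly d p = restrictPoly d (p - normSqPoly d * q) + restrictPoly d q := by
          ext ω
          have h1 := polyFun_normSqPoly_sphere ω
          simp only [ContinuousMap.add_apply, restrictPoly_apply]
          simp only [polyFun, map_sub, map_mul] at h1 ⊢
          rw [h1]; ring
        rw [e]
        exact Submodule.add_mem _ (Submodule.mem_iSup_of_mem (m + 2) ⟨_, h, rfl⟩)
          (ih m (by omega) q hq)
  rw [← MvPolynomial.sum_homogeneousComponent p, map_sum]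
  exact Submodule.sum_mem _ fun i _ => hhom i _ (MvPolynomial.homogeneousComponent_isHomogeneous i p)

/-- The star algebra of polynomial functions on the sphere. -/
noncomputable def polyStarSubalgebra (d : ℕ) : StarSubalgebra ℂ C(S d, ℂ) where
  toSubalgebra := (MvPolynomial.aeval
    (fun i : Fin d => (⟨fun ω => ((ω : E d) i : ℂ), by fun_prop⟩ : C(S d, ℂ)))).range
  star_mem' := by
    rintro _ ⟨p, rfl⟩
    refine ⟨conjPoly p, ?_⟩
    ext ω
    have h1 := restrictPoly_apply p ω
    have h2 := restrictPoly_apply (conjPoly p) ω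
    simp only [restrictPoly, AlgHom.toLinearMap_apply] at h1 h2
    exact h2.trans ((polyFun_conjPoly p ω).trans (congrArg conj h1.symm))

theorem polyStarSubalgebra_topologicalClosure (d : ℕ) :
    (polyStarSubalgebra d).topologicalClosure = ⊤ := by
  refine ContinuousMap.starSubalgebra_topologicalClosure_eq_top_of_separatesPoints _ ?_
  intro ω φ h
  have : ∃ i, (ω : E d) i ≠ (φ : E d) i := by
    by_contra! hc
    exact h (Subtype.ext (PiLp.ext hc))
  obtain ⟨i, hi⟩ := this
  refine ⟨_, ⟨_, ⟨MvPolynomial.X i, rfl⟩, rfl⟩, ?_⟩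
  simpa using hi

/-- Stone–Weierstrass makes polynomials uniformly dense, continuous functions are dense in L², and
every polynomial restricts to a finite sum of harmonics. -/
theorem iSup_harm_topologicalClosure (hd : 2 ≤ d) :
    (⨆ k, harm d k).topologicalClosure = ⊤ := by
  have h1 : Dense (Set.range (restrictPoly d)) := by
    have := congrArg (fun A : StarSubalgebra ℂ C(S d, ℂ) => (A : Set C(S d, ℂ)))
      (polyStarSubalgebra_topologicalClosure d)
    rw [dense_iff_closure_eq]
    exact this
  have h2 : DenseRange (ContinuousMap.toLp (E := ℂ) 2 (surf d) ℂ) :=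
    ContinuousMap.toLp_denseRange ℂ (surf d) ℂ (by norm_num)
  have h3 : Dense ((ContinuousMap.toLp (E := ℂ) 2 (surf d) ℂ) '' Set.range (restrictPoly d)) :=
    h2.dense_image (ContinuousLinearMap.continuous _) h1
  rw [← Submodule.dense_iff_topologicalClosure_eq_top]
  refine h3.mono ?_
  rintro _ ⟨_, ⟨p, rfl⟩, rfl⟩
  have h4 : (⨆ k, harm d k) = (⨆ k, harmC d k).map
      (ContinuousMap.toLp (E := ℂ) 2 (surf d) ℂ : C(S d, ℂ) →ₗ[ℂ] L2S d) := by
    rw [Submodule.map_iSup]; rfl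
  rw [h4]
  exact ⟨_, restrictPoly_mem_iSup hd p, rfl⟩

/-- The witness is (x_0 + i x_1)^k: its linear form has coefficient vector (1, i, 0, …) with squares
summing to zero, and it takes the value 1 at the first basis vector. Nonzero harmonics in every
degree are what make the constants optimal. -/
theorem exists_mem_harmC_ne_zero (hd : 2 ≤ d) (k : ℕ) : ∃ Y ∈ harmC d k, Y ≠ 0 := by
  let i0 : Fin d := ⟨0, by omega⟩
  let i1 : Fin d := ⟨1, by omega⟩
  have h01 : i0 ≠ i1 := by simp [i0, i1]
  let l : MvPolynomial (Fin d) ℂ := MvPolynomial.X i0 + MvPolynomial.C Complex.I * MvPolynomial.X i1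
  have hl : l.IsHomogeneous 1 := (MvPolynomial.isHomogeneous_X ℂ i0).add
    (by simpa using (MvPolynomial.isHomogeneous_C _ Complex.I).mul (MvPolynomial.isHomogeneous_X ℂ i1))
  let c : Fin d → ℂ := fun i => (if i = i0 then 1 else 0) + Complex.I * (if i = i1 then 1 else 0)
  have hdl : ∀ i, MvPolynomial.pderiv i l = MvPolynomial.C (c i) := fun i => by
    simp only [l, c, map_add, Derivation.leibniz, MvPolynomial.pderiv_X, MvPolynomial.pderiv_C,
      smul_eq_mul, Pi.single_apply, mul_zero, add_zero, map_mul]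
    simp only [eq_comm (a := i0), eq_comm (a := i1)]
    split_ifs <;> simp
  have hc : ∑ i, c i * c i = 0 := by
    have : ∀ i, c i * c i = (if i = i0 then 1 else 0) - (if i = i1 then 1 else 0) := fun i => by
      simp only [c]
      split_ifs with h1 h2 h2
      · exact absurd (h1.symm.trans h2) h01
      all_goals simp
    simp [this]
  have hp : l ^ k ∈ harmonicPoly d k := by
    rw [mem_harmonicPoly]
    refine ⟨by simpa using hl.pow k, ?_⟩
    have : ∀ i, MvPolynomial.pderiv i (MvPolynomial.pderiv i (l ^ k)) =
        MvPolynomial.C (c i * c i) * ((k * (k - 1 : ℕ) : MvPolynomial (Fin d) ℂ) *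
          l ^ (k - 1 - 1)) := fun i => by
      simp only [Derivation.leibniz_pow, hdl, smul_eq_mul, nsmul_eq_mul,
        Derivation.leibniz, MvPolynomial.pderiv_C, map_mul, Derivation.map_natCast]
      ring
    simp only [this, ← Finset.sum_mul, ← map_sum, hc]
    simp
  refine ⟨_, ⟨l ^ k, hp, rfl⟩, fun h => ?_⟩
  let ω : S d := ⟨EuclideanSpace.single i0 1, by simp⟩
  have h1 := congrArg (fun f : C(S d, ℂ) => f ω) h
  simp only [restrictPoly_apply] at h1
  simp [polyFun, l, ω, h01.symm] at h1

end Complete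

/-! ### The extension operator and the projections onto spherical harmonics -/

section Extension

variable {d : ℕ}

theorem integrable_L2S (G : L2S d) : Integrable G (surf d) :=
  (Lp.memLp G).integrable (by norm_num)

theorem norm_exp_neg_I_mul (t : ℝ) : ‖Complex.exp (-(Complex.I * (t : ℂ)))‖ = 1 := by
  rw [Complex.norm_exp]; simp

theorem norm_exp_I_mul (t : ℝ) : ‖Complex.exp (Complex.I * (t : ℂ))‖ = 1 := by
  rw [Complex.norm_exp]; simp

theorem continuous_extension (G : L2S d) : Continuous (extension G) := by
  unfold extension
  refine continuous_of_dominated (bound := fun ω => ‖G ω‖)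
    (fun ξ => ?_) (fun ξ => ae_of_all _ fun ω => ?_) (integrable_L2S G).norm
    (ae_of_all _ fun ω => by fun_prop)
  · exact (Lp.aestronglyMeasurable G).mul (by fun_prop : Continuous fun ω : S d =>
      Complex.exp (-(Complex.I * (inner ℝ (ω : E d) ξ : ℝ)))).aestronglyMeasurable
  · rw [norm_mul, norm_exp_neg_I_mul, mul_one]

theorem norm_extension_le (G : L2S d) (ξ : E d) :
    ‖extension G ξ‖ ≤ ∫ ω, ‖G ω‖ ∂(surf d) := by
  refine norm_integral_le_of_norm_le (integrable_L2S G).norm (ae_of_all _ fun ω => ?_)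
  rw [norm_mul, norm_exp_neg_I_mul, mul_one]

theorem extension_toLp (Y : C(S d, ℂ)) (ξ : E d) :
    extension (ContinuousMap.toLp (E := ℂ) 2 (surf d) ℂ Y) ξ =
      ∫ ω : S d, Y ω * Complex.exp (-(Complex.I * (inner ℝ (ω : E d) ξ : ℝ))) ∂(surf d) := by
  refine integral_congr_ae ?_
  filter_upwards [ContinuousMap.coeFn_toLp (p := 2) (𝕜 := ℂ) (surf d) Y] with ω hω
  rw [hω]

theorem extension_harmC (hd : 2 ≤ d) {k : ℕ} {Y : C(S d, ℂ)} (hY : Y ∈ harmC d k) (r : ℝ)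
    (φ : S d) : extension (ContinuousMap.toLp (E := ℂ) 2 (surf d) ℂ Y) (r • (φ : E d)) =
      funkCoef d k (-(Complex.I * r)) * Y φ := by
  rw [extension_toLp, ← funk_hecke hd hY]
  congr 1; funext ω
  rw [inner_smul_right]
  congr 2; push_cast; ring

theorem inner_toLp_left (Z : C(S d, ℂ)) (G : L2S d) :
    inner ℂ (ContinuousMap.toLp (E := ℂ) 2 (surf d) ℂ Z) G =
      ∫ ω, conj (Z ω) * G ω ∂(surf d) := by
  rw [L2.inner_def]
  refine integral_congr_ae ?_
  filter_upwards [ContinuousMap.coeFn_toLp (p := 2) (𝕜 := ℂ) (surf d) Z] with ω hω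
  rw [hω, RCLike.inner_apply, mul_comm]

open Classical in
theorem projSphere_spec (k : ℕ) {u : S d → ℂ} (hu : MemLp u 2 (surf d)) :
    projSphere d k u ∈ harmC d k ∧
      ContinuousMap.toLp (E := ℂ) 2 (surf d) ℂ (projSphere d k u) =
        (harm d k).starProjection (hu.toLp u) := by
  rw [projSphere, dif_pos hu]
  exact (exists_harmC d k (hu.toLp u)).choose_spec

theorem toLp_mem_harm {k : ℕ} {Y : C(S d, ℂ)} (hY : Y ∈ harmC d k) :
    ContinuousMap.toLp (E := ℂ) 2 (surf d) ℂ Y ∈ harm d k := ⟨Y, hY, rfl⟩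

theorem starProjection_eq_toLp {k : ℕ} {u : L2S d} {Y : C(S d, ℂ)} (hY : Y ∈ harmC d k)
    (h : ∀ Z ∈ harmC d k, ∫ ω, conj (Z ω) * u ω ∂(surf d) = ∫ ω, conj (Z ω) * Y ω ∂(surf d)) :
    (harm d k).starProjection u = ContinuousMap.toLp (E := ℂ) 2 (surf d) ℂ Y := by
  refine (Submodule.eq_starProjection_of_mem_orthogonal (toLp_mem_harm hY) ?_)
  rw [Submodule.mem_orthogonal]
  rintro _ ⟨Z, hZ, rfl⟩
  rw [inner_sub_right, sub_eq_zero]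
  exact (inner_toLp_left Z u).trans ((h Z hZ).trans (inner_toLp_toLp Z Y).symm)

theorem projSphere_eq {k : ℕ} {u : S d → ℂ} (hu : MemLp u 2 (surf d)) {Y : C(S d, ℂ)}
    (hY : Y ∈ harmC d k)
    (h : ∀ Z ∈ harmC d k, ∫ ω, conj (Z ω) * u ω ∂(surf d) = ∫ ω, conj (Z ω) * Y ω ∂(surf d)) :
    projSphere d k u = Y := by
  apply ContinuousMap.toLp_injective (𝕜 := ℂ) (p := 2) (surf d)
  rw [(projSphere_spec k hu).2]
  refine starProjection_eq_toLp hY fun Z hZ => ?_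
  rw [← h Z hZ]
  refine integral_congr_ae ?_
  filter_upwards [hu.coeFn_toLp] with ω hω
  rw [hω]

theorem memLp_of_continuous {u : S d → ℂ} (hu : Continuous u) : MemLp u 2 (surf d) :=
  hu.memLp_of_hasCompactSupport (HasCompactSupport.of_compactSpace _)

/-- Fubini transfers the kernel to Z, where Funk–Hecke applies; G itself is arbitrary. This is why
H_k commutes with extension. -/
theorem integral_conj_mul_extension (hd : 2 ≤ d) {k : ℕ} {Z : C(S d, ℂ)} (hZ : Z ∈ harmC d k)
    (G : L2S d) (r : ℝ) :
    ∫ φ : S d, conj (Z φ) * extension G (r • (φ : E d)) ∂(surf d) =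
      funkCoef d k (-(Complex.I * r)) * ∫ ω, conj (Z ω) * G ω ∂(surf d) := by
  have hint : Integrable (Function.uncurry fun (φ ω : S d) => conj (Z φ) * (G ω *
      Complex.exp (-(Complex.I * (inner ℝ (ω : E d) (r • (φ : E d)) : ℝ)))))
      ((surf d).prod (surf d)) := by
    have h1 := ((integrable_continuousMap (star Z)).mul_prod (integrable_L2S G)).mul_bdd
      (c := 1) (g := fun p : S d × S d =>
        Complex.exp (-(Complex.I * (inner ℝ (p.2 : E d) (r • (p.1 : E d)) : ℝ))))
      (Continuous.aestronglyMeasurable (by fun_prop))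
      (ae_of_all _ fun p => (norm_exp_neg_I_mul _).le)
    refine h1.congr (ae_of_all _ fun p => ?_)
    simp [Function.uncurry, mul_assoc]
  simp only [extension, ← integral_const_mul]
  rw [integral_integral_swap hint]
  refine integral_congr_ae (ae_of_all _ fun ω => ?_)
  beta_reduce
  have h2 := congrArg conj (funk_hecke hd hZ (Complex.I * r) ω)
  rw [map_mul, conj_funkCoef, ← integral_conj] at h2
  simp only [map_mul, ← Complex.exp_conj, Complex.conj_I, Complex.conj_ofReal, neg_mul] at h2
  calc _ = G ω * ∫ φ : S d, conj (Z φ) *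
        Complex.exp (-(Complex.I * r * (inner ℝ (φ : E d) (ω : E d) : ℝ))) ∂(surf d) := by
        rw [← integral_const_mul]
        congr 1; funext φ
        rw [inner_smul_right, real_inner_comm]
        push_cast
        ring_nf
    _ = _ := by rw [h2]; ring

/-- `H_k` commutes with the extension operator. -/
theorem projSpace_extension (hd : 2 ≤ d) (k : ℕ) (G : L2S d) {x : E d} (hx : x ≠ 0) :
    projSpace d k (extension G) x = extension ((harm d k).starProjection G) x := by
  obtain ⟨Y, hY, hYG⟩ := exists_harmC d k G
  rw [projSpace, dif_neg hx, ← hYG]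
  have hxd : x = ‖x‖ • ((dir x hx : S d) : E d) := by simp [dir, smul_smul, hx]
  conv_rhs => rw [hxd, extension_harmC hd hY]
  have hu : Continuous fun φ : S d => extension G (‖x‖ • (φ : E d)) :=
    (continuous_extension G).comp (by fun_prop)
  rw [projSphere_eq (memLp_of_continuous hu)
    (Submodule.smul_mem _ (funkCoef d k (-(Complex.I * ‖x‖))) hY)]
  · simp
  · intro Z hZ
    rw [integral_conj_mul_extension hd hZ]
    have h3 : ∫ ω, conj (Z ω) * G ω ∂(surf d) = ∫ ω, conj (Z ω) * Y ω ∂(surf d) := by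
      rw [← inner_toLp_left, ← inner_toLp_toLp, hYG,
        ← Submodule.inner_starProjection_left_eq_right,
        Submodule.starProjection_eq_self_iff.2 (toLp_mem_harm hZ)]
    rw [h3, ← integral_const_mul]
    congr 1; funext ω
    simp; ring

end Extension

/-! ### A Gaussian average of the multiplier -/

section GaussAverage

variable {d : ℕ}

/-- Besides its sign, this shows that the Bochner integrals below are nonzero, which certifies their
convergence in `lintegral_ofReal_eq_of_integral_eq`. -/
theorem funkCoef_ofReal_pos (hd : 2 ≤ d) (k : ℕ) {τ : ℝ} (hτ : 0 < τ) :
    0 < funkConst d k * τ ^ k * ∫ u in Set.Ioo (-1 : ℝ) 1,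
      jacobiW (jacobiIdx d k) (jacobiIdx d k) u * Real.exp (τ * u) := by
  have ha := jacobiIdx_pos hd k
  have hc := funkConst_pos hd k
  have hi := integrableOn_jacobiW ha ha
  have hi2 : IntegrableOn (fun u => jacobiW (jacobiIdx d k) (jacobiIdx d k) u * Real.exp (τ * u))
      (Set.Ioo (-1) 1) := by
    refine hi.mul_bdd (c := Real.exp τ)
      (by fun_prop : Continuous fun u : ℝ => Real.exp (τ * u)).aestronglyMeasurable ?_
    filter_upwards [ae_restrict_mem measurableSet_Ioo] with u hu
    rw [Real.norm_of_nonneg (Real.exp_pos _).le]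
    exact Real.exp_le_exp.2 (by nlinarith [hu.2])
  have h1 : jacobiMoment (jacobiIdx d k) 0 * Real.exp (-τ) ≤ ∫ u in Set.Ioo (-1 : ℝ) 1,
      jacobiW (jacobiIdx d k) (jacobiIdx d k) u * Real.exp (τ * u) := by
    simp only [jacobiMoment, pow_zero, one_mul]
    rw [← integral_mul_const]
    refine setIntegral_mono_on (hi.mul_const _) hi2 measurableSet_Ioo fun u hu => ?_
    exact mul_le_mul_of_nonneg_left (Real.exp_le_exp.2 (by nlinarith [hu.1])) (jacobiW_nonneg hu)
  have h2 := mul_pos (jacobiMoment_zero_pos ha) (Real.exp_pos (-τ))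
  have h3 := h2.trans_le h1
  positivity

theorem integral_gauss_mul_exp {τ : ℝ} (hτ : 0 < τ) (w : E d) :
    ∫ x : E d, ((Real.exp (-(‖x‖ ^ 2 / (2 * τ))) : ℝ) : ℂ) *
        Complex.exp (Complex.I * (inner ℝ w x : ℝ)) =
      (((2 * Real.pi * τ) ^ ((d : ℝ) / 2) * Real.exp (-(τ * ‖w‖ ^ 2 / 2)) : ℝ) : ℂ) := by
  have hb : 0 < ((1 / (2 * τ) : ℝ) : ℂ).re := by
    rw [Complex.ofReal_re]; positivity
  have h := GaussianFourier.integral_cexp_neg_mul_sq_norm_add hb Complex.I w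
  rw [finrank_euclideanSpace_fin] at h
  have hτ' : (τ : ℂ) ≠ 0 := by exact_mod_cast hτ.ne'
  calc _ = ∫ v : E d, Complex.exp (-((1 / (2 * τ) : ℝ) : ℂ) * ‖v‖ ^ 2 +
        Complex.I * (inner ℝ w v : ℝ)) := by
        congr 1; funext x
        rw [Complex.exp_add, Complex.ofReal_exp]
        congr 2; push_cast; field_simp
    _ = _ := by
        rw [h]
        push_cast
        congr 1
        · rw [show (Real.pi : ℂ) / (1 / (2 * τ)) = ((2 * Real.pi * τ : ℝ) : ℂ) by
            push_cast; field_simp, Complex.ofReal_cpow (by positivity)]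
          push_cast; rfl
        · congr 1
          rw [Complex.I_sq]; field_simp; ring

theorem funkCoef_conj_mul (k : ℕ) (r : ℝ) :
    funkCoef d k (-(Complex.I * r)) * funkCoef d k (Complex.I * r) =
      ((‖funkCoef d k (-(Complex.I * r))‖ ^ 2 : ℝ) : ℂ) := by
  have : funkCoef d k (Complex.I * r) = conj (funkCoef d k (-(Complex.I * r))) := by
    rw [conj_funkCoef]; simp
  rw [this, Complex.mul_conj, Complex.normSq_eq_norm_sq]

/-- Evaluate ∫ exp(-|x|²/(2τ)) (Y dσ)^(x) exp(i φ·x) dx twice. Polar coordinates and two uses of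
Funk–Hecke give the left side times Y(φ). Integrating in x first gives the Fourier transform of a
Gaussian, and Funk–Hecke at the real argument τ gives the right side times Y(φ). -/
theorem integral_gauss_funkCoef (hd : 2 ≤ d) (k : ℕ) {τ : ℝ} (hτ : 0 < τ) :
    ∫ r in Set.Ioi (0 : ℝ), r ^ (d - 1) * (Real.exp (-(r ^ 2 / (2 * τ))) *
        ‖funkCoef d k (-(Complex.I * r))‖ ^ 2) =
      (2 * Real.pi * τ) ^ ((d : ℝ) / 2) * Real.exp (-τ) *
        (funkConst d k * τ ^ k * ∫ u in Set.Ioo (-1 : ℝ) 1,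
          jacobiW (jacobiIdx d k) (jacobiIdx d k) u * Real.exp (τ * u)) := by
  have := nontrivial_E hd
  -- A harmonic and a point with Y(φ) ≠ 0, so that this common factor can be cancelled at the end.
  obtain ⟨Y, hY, hY0⟩ := exists_mem_harmC_ne_zero hd k
  obtain ⟨φ, hφ⟩ : ∃ φ, Y φ ≠ 0 := by
    by_contra! h
    exact hY0 (ContinuousMap.ext h)
  set X : L2S d := ContinuousMap.toLp (E := ℂ) 2 (surf d) ℂ Y with hX
  let g : E d → ℝ := fun x => Real.exp (-(‖x‖ ^ 2 / (2 * τ)))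
  have hgint : Integrable g := by
    have := integrable_exp_neg_mul_sq (d := d) (b := 1 / (2 * τ)) (by positivity)
    refine this.congr (ae_of_all _ fun x => ?_)
    simp only [g]; congr 1; field_simp
  have hgc : Continuous g := by simp only [g]; fun_prop
  let F : E d → ℂ := fun x => (g x : ℂ) * (extension X x *
    Complex.exp (Complex.I * (inner ℝ (φ : E d) x : ℝ)))
  have hF : Integrable F := by
    refine hgint.ofReal.mul_bdd (c := ∫ ω, ‖X ω‖ ∂(surf d))
      ((continuous_extension X).mul (by fun_prop)).aestronglyMeasurable
      (ae_of_all _ fun x => ?_)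
    rw [norm_mul, norm_exp_I_mul, mul_one]
    exact norm_extension_le X x
  have hpol : ∫ x, F x = ((∫ r in Set.Ioi (0 : ℝ), r ^ (d - 1) * (Real.exp (-(r ^ 2 / (2 * τ))) *
        ‖funkCoef d k (-(Complex.I * r))‖ ^ 2) : ℝ) : ℂ) * Y φ := by
    rw [integral_polar hF, ← integral_complex_ofReal, ← integral_mul_const]
    refine setIntegral_congr_fun measurableSet_Ioi fun r hr => ?_
    have hin : ∫ ω : S d, F (r • (ω : E d)) ∂(surf d) =
        ((Real.exp (-(r ^ 2 / (2 * τ))) : ℝ) : ℂ) * (funkCoef d k (-(Complex.I * r)) *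
          ∫ ω : S d, Y ω * Complex.exp (Complex.I * r * (inner ℝ (ω : E d) (φ : E d) : ℝ))
            ∂(surf d)) := by
      rw [← integral_const_mul, ← integral_const_mul]
      congr 1; funext ω
      simp only [F, g]
      rw [hX, extension_harmC hd hY, norm_smul, inner_smul_right, real_inner_comm]
      simp only [norm_coe_sphere, mul_one, Real.norm_eq_abs, sq_abs]
      push_cast; ring_nf
    beta_reduce
    rw [hin, funk_hecke hd hY, ← mul_assoc (funkCoef d k (-(Complex.I * r))), funkCoef_conj_mul]
    push_cast; ring
  have hfub : ∫ x, F x = (((2 * Real.pi * τ) ^ ((d : ℝ) / 2) * Real.exp (-τ) : ℝ) : ℂ) *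
      (funkCoef d k τ * Y φ) := by
    have hint : Integrable (Function.uncurry fun (x : E d) (ω : S d) =>
        (g x : ℂ) * Y ω * (Complex.exp (Complex.I * (inner ℝ (φ - ω : E d) x : ℝ))))
        (volume.prod (surf d)) := by
      refine ((hgint.ofReal (𝕜 := ℂ)).mul_prod (integrable_continuousMap Y)).mul_bdd (c := 1)
        (g := fun p : E d × S d => Complex.exp (Complex.I * (inner ℝ (φ - p.2 : E d) p.1 : ℝ)))
        (Continuous.aestronglyMeasurable (by fun_prop))
        (ae_of_all _ fun p => (norm_exp_I_mul _).le)
    have h1 : ∀ x, F x = ∫ ω : S d,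
        (g x : ℂ) * Y ω * (Complex.exp (Complex.I * (inner ℝ (φ - ω : E d) x : ℝ))) ∂(surf d) := by
      intro x
      simp only [F]
      rw [hX, extension_toLp, ← integral_mul_const, ← integral_const_mul]
      congr 1; funext ω
      rw [inner_sub_left, mul_assoc, mul_assoc, ← Complex.exp_add]
      congr 3; push_cast; ring
    simp only [h1]
    rw [integral_integral_swap hint, ← funk_hecke hd hY, ← integral_const_mul]
    congr 1; funext ω
    have h2 := integral_gauss_mul_exp hτ (φ - ω : E d)
    -- For unit vectors the Gaussian in φ - ω splits into exp(-τ) times the Funk–Hecke kernel exp(τ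
    -- ω·φ).
    have h3 : ‖(φ - ω : E d)‖ ^ 2 = 2 - 2 * inner ℝ (ω : E d) (φ : E d) := by
      rw [norm_sub_sq_real, norm_coe_sphere, norm_coe_sphere, real_inner_comm]; ring
    calc _ = Y ω * ∫ x : E d, ((Real.exp (-(‖x‖ ^ 2 / (2 * τ))) : ℝ) : ℂ) *
          Complex.exp (Complex.I * (inner ℝ (φ - ω : E d) x : ℝ)) := by
          rw [← integral_const_mul]
          congr 1; funext x
          simp only [g]; ring
      _ = _ := by
          rw [h2, h3, show -(τ * (2 - 2 * inner ℝ (ω : E d) (φ : E d)) / 2) =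
            -τ + τ * inner ℝ (ω : E d) (φ : E d) by ring, Real.exp_add]
          push_cast; ring
  rw [hpol, funkCoef_ofReal, ← mul_assoc] at hfub
  have := mul_right_cancel₀ hφ hfub
  exact_mod_cast this

end GaussAverage

/-! ### The radial integral of the multiplier -/

section RadialIntegral

/-- A non-integrable function has Bochner integral 0 by convention, so a nonzero value proves
integrability. -/
theorem lintegral_ofReal_eq_of_integral_eq {α : Type*} [MeasurableSpace α] {μ : Measure α}
    {s : Set α} (hs : MeasurableSet s) {f : α → ℝ} (hf : ∀ x ∈ s, 0 ≤ f x) {v : ℝ} (hv : v ≠ 0)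
    (h : ∫ x in s, f x ∂μ = v) : ∫⁻ x in s, ENNReal.ofReal (f x) ∂μ = ENNReal.ofReal v := by
  rw [← h]
  refine (ofReal_integral_eq_lintegral_ofReal ?_ ?_).symm
  · by_contra hc
    rw [integral_undef hc] at h
    exact hv h.symm
  · filter_upwards [ae_restrict_mem hs] with x hx using hf x hx

theorem lintegral_rpow_mul_exp {p c : ℝ} (hp : 0 < p) (hc : 0 < c) :
    ∫⁻ t in Set.Ioi (0 : ℝ), ENNReal.ofReal (t ^ (p - 1) * Real.exp (-(c * t))) =
      ENNReal.ofReal (c ^ (-p) * Real.Gamma p) := by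
  have hG := Real.Gamma_pos_of_pos hp
  refine lintegral_ofReal_eq_of_integral_eq measurableSet_Ioi
    (fun t ht => mul_nonneg (Real.rpow_nonneg (le_of_lt ht) _) (Real.exp_pos _).le)
    (by positivity) ?_
  rw [Real.integral_rpow_mul_exp_neg_mul_Ioi hp hc, one_div, Real.inv_rpow hc.le,
    Real.rpow_neg hc.le]

/-- The Gamma integral under t ↦ 1/t. With c = r²/2 it writes r^(-2s) as a superposition of
Gaussians. -/
theorem lintegral_rpow_mul_exp_inv {p c : ℝ} (hp : 0 < p) (hc : 0 < c) :
    ∫⁻ t in Set.Ioi (0 : ℝ), ENNReal.ofReal (t ^ (-p - 1) * Real.exp (-(c / t))) =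
      ENNReal.ofReal (c ^ (-p) * Real.Gamma p) := by
  have hG := Real.Gamma_pos_of_pos hp
  refine lintegral_ofReal_eq_of_integral_eq measurableSet_Ioi
    (fun t ht => mul_nonneg (Real.rpow_nonneg (le_of_lt ht) _) (Real.exp_pos _).le)
    (by positivity) ?_
  have h := integral_comp_rpow_Ioi (fun t : ℝ => t ^ (p - 1) * Real.exp (-(c * t)))
    (p := -1) (by norm_num)
  rw [Real.integral_rpow_mul_exp_neg_mul_Ioi hp hc, one_div, Real.inv_rpow hc.le,
    ← Real.rpow_neg hc.le] at h
  rw [← h]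
  refine setIntegral_congr_fun measurableSet_Ioi fun t ht => ?_
  have ht0 : (0 : ℝ) < t := ht
  rw [abs_neg, abs_one, one_mul, smul_eq_mul, ← Real.rpow_mul ht0.le, ← mul_assoc,
    ← Real.rpow_add ht0, Real.rpow_neg_one, div_eq_mul_inv]
  congr 2; ring

/-- The value of the radial integral without its normalisation. -/
noncomputable def radValue (d k : ℕ) (s : ℝ) : ℝ :=
  (2 * Real.pi) ^ ((d : ℝ) / 2) * funkConst d k * Real.Gamma (k + d / 2 - s) *
    (2 ^ (s - 1 / 2 + jacobiIdx d k - 1) * (Real.Gamma (s - 1 / 2) * Real.Gamma (jacobiIdx d k) /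
      Real.Gamma (s - 1 / 2 + jacobiIdx d k)))

variable {d : ℕ}

/-- By Tonelli, integrate τ first. The Gamma integral converges since s < d/2 ≤ k + d/2, and leaves
a power of 1 - u that changes the first Jacobi parameter from `jacobiIdx d k` to s - 1/2. The
remaining beta integral converges since s > 1/2. -/
theorem lintegral_heat (hd : 2 ≤ d) (k : ℕ) {s : ℝ} (hs : 1 / 2 < s) (hsd : s < d / 2) :
    ∫⁻ τ in Set.Ioi (0 : ℝ), ENNReal.ofReal (τ ^ (-s - 1) *
      ((2 * Real.pi * τ) ^ ((d : ℝ) / 2) * Real.exp (-τ) *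
        (funkConst d k * τ ^ k * ∫ u in Set.Ioo (-1 : ℝ) 1,
          jacobiW (jacobiIdx d k) (jacobiIdx d k) u * Real.exp (τ * u)))) =
      ENNReal.ofReal (radValue d k s) := by
  have ha := jacobiIdx_pos hd k
  have hc := funkConst_pos hd k
  have hp : 0 < k + d / 2 - s := by
    have : (0 : ℝ) ≤ k := by positivity
    linarith
  have hG := Real.Gamma_pos_of_pos hp
  have hA : 0 ≤ (2 * Real.pi) ^ ((d : ℝ) / 2) * funkConst d k := by positivity
  have hmW := measurable_jacobiW (jacobiIdx d k) (jacobiIdx d k)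
  have h1 : ∀ τ ∈ Set.Ioi (0 : ℝ), ENNReal.ofReal (τ ^ (-s - 1) *
      ((2 * Real.pi * τ) ^ ((d : ℝ) / 2) * Real.exp (-τ) *
        (funkConst d k * τ ^ k * ∫ u in Set.Ioo (-1 : ℝ) 1,
          jacobiW (jacobiIdx d k) (jacobiIdx d k) u * Real.exp (τ * u)))) =
      ENNReal.ofReal ((2 * Real.pi) ^ ((d : ℝ) / 2) * funkConst d k) *
        ∫⁻ u in Set.Ioo (-1 : ℝ) 1, ENNReal.ofReal (jacobiW (jacobiIdx d k) (jacobiIdx d k) u) *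
          ENNReal.ofReal (τ ^ (k + d / 2 - s - 1) * Real.exp (-((1 - u) * τ))) := by
    intro τ hτ
    have hτ0 : (0 : ℝ) < τ := hτ
    have hJ : ENNReal.ofReal (∫ u in Set.Ioo (-1 : ℝ) 1,
        jacobiW (jacobiIdx d k) (jacobiIdx d k) u * Real.exp (τ * u)) =
        ∫⁻ u in Set.Ioo (-1 : ℝ) 1, ENNReal.ofReal
          (jacobiW (jacobiIdx d k) (jacobiIdx d k) u * Real.exp (τ * u)) := by
      refine (lintegral_ofReal_eq_of_integral_eq measurableSet_Ioo
        (fun u hu => mul_nonneg (jacobiW_nonneg hu) (Real.exp_pos _).le) ?_ rfl).symm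
      have := funkCoef_ofReal_pos hd k hτ0
      intro h0
      rw [h0, mul_zero] at this
      exact lt_irrefl _ this
    have e1 : τ ^ (-s - 1) * ((2 * Real.pi * τ) ^ ((d : ℝ) / 2) * Real.exp (-τ) *
        (funkConst d k * τ ^ k * ∫ u in Set.Ioo (-1 : ℝ) 1,
          jacobiW (jacobiIdx d k) (jacobiIdx d k) u * Real.exp (τ * u))) =
        ((2 * Real.pi) ^ ((d : ℝ) / 2) * funkConst d k) *
          ((τ ^ (k + d / 2 - s - 1) * Real.exp (-τ)) * ∫ u in Set.Ioo (-1 : ℝ) 1,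
          jacobiW (jacobiIdx d k) (jacobiIdx d k) u * Real.exp (τ * u)) := by
      have e2 : τ ^ (k + d / 2 - s - 1 : ℝ) = τ ^ (-s - 1) * τ ^ ((d : ℝ) / 2) * τ ^ k := by
        rw [← Real.rpow_natCast τ k, ← Real.rpow_add hτ0, ← Real.rpow_add hτ0]
        congr 1; ring
      rw [e2, Real.mul_rpow (by positivity) hτ0.le]; ring
    have hpos : 0 ≤ τ ^ (k + d / 2 - s - 1) * Real.exp (-τ) := by positivity
    rw [e1, ENNReal.ofReal_mul hA, ENNReal.ofReal_mul hpos, hJ,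
      ← lintegral_const_mul' _ _ ENNReal.ofReal_ne_top]
    congr 1
    refine setLIntegral_congr_fun measurableSet_Ioo fun u hu => ?_
    rw [← ENNReal.ofReal_mul hpos, ← ENNReal.ofReal_mul (jacobiW_nonneg hu),
      show -((1 - u) * τ) = -τ + τ * u by ring, Real.exp_add]
    congr 1; ring
  rw [setLIntegral_congr_fun measurableSet_Ioi h1, lintegral_const_mul' _ _ ENNReal.ofReal_ne_top,
    lintegral_lintegral_swap (Measurable.aemeasurable (by unfold Function.uncurry; fun_prop))]
  have h2 : ∀ u ∈ Set.Ioo (-1 : ℝ) 1, ∫⁻ τ in Set.Ioi (0 : ℝ),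
      ENNReal.ofReal (jacobiW (jacobiIdx d k) (jacobiIdx d k) u) *
        ENNReal.ofReal (τ ^ (k + d / 2 - s - 1) * Real.exp (-((1 - u) * τ))) =
      ENNReal.ofReal (Real.Gamma (k + d / 2 - s)) *
        ENNReal.ofReal (jacobiW (s - 1 / 2) (jacobiIdx d k) u) := by
    intro u hu
    have hu1 : 0 < 1 - u := by linarith [hu.2]
    rw [lintegral_const_mul' _ _ ENNReal.ofReal_ne_top, lintegral_rpow_mul_exp hp hu1,
      ← ENNReal.ofReal_mul (jacobiW_nonneg hu), ← ENNReal.ofReal_mul hG.le]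
    congr 1
    have : (1 - u) ^ (s - 1 / 2 - 1) =
        (1 - u) ^ (jacobiIdx d k - 1) * (1 - u) ^ (-(k + d / 2 - s)) := by
      rw [← Real.rpow_add hu1]
      congr 1
      unfold jacobiIdx; ring
    rw [jacobiW, jacobiW, this]; ring
  rw [setLIntegral_congr_fun measurableSet_Ioo h2, lintegral_const_mul' _ _ ENNReal.ofReal_ne_top]
  have hs' : 0 < s - 1 / 2 := by linarith
  have hG1 := Real.Gamma_pos_of_pos hs'
  have hG2 := Real.Gamma_pos_of_pos ha
  have hG3 := Real.Gamma_pos_of_pos (add_pos hs' ha)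
  rw [lintegral_ofReal_eq_of_integral_eq measurableSet_Ioo (fun u hu => jacobiW_nonneg hu)
    (by positivity) (integral_jacobiW hs' ha), ← mul_assoc, ← ENNReal.ofReal_mul hA,
    ← ENNReal.ofReal_mul (by positivity)]
  rfl

/-- The eigenvalue `λ_k` for `θ = 1`. -/
noncomputable def lamOne (d : ℕ) (s : ℝ) (k : ℕ) : ℝ :=
  2 ^ (1 - 2 * s) * (Real.Gamma (2 * s - 1) * Real.Gamma (k + d / 2 - s)) /
    (Real.Gamma s ^ 2 * Real.Gamma (k + d / 2 - 1 + s))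

theorem lam_eq (d : ℕ) (s : ℝ) (θ : ℝ≥0 → ℂ) (k : ℕ) :
    lam d s θ k = lamOne d s k * ‖thetaAt d θ k‖ ^ 2 := rfl

theorem lamOne_pos (hd : 2 ≤ d) (k : ℕ) {s : ℝ} (hs : 1 / 2 < s) (hsd : s < d / 2) :
    0 < lamOne d s k := by
  have hk : (0 : ℝ) ≤ k := by positivity
  have hd' : (2 : ℝ) ≤ d := by exact_mod_cast hd
  have h1 := Real.Gamma_pos_of_pos (show 0 < 2 * s - 1 by linarith)
  have h2 := Real.Gamma_pos_of_pos (show 0 < k + d / 2 - s by linarith)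
  have h3 := Real.Gamma_pos_of_pos (show 0 < s by linarith)
  have h4 := Real.Gamma_pos_of_pos (show 0 < k + d / 2 - 1 + s by linarith)
  unfold lamOne
  positivity

/-- Legendre duplication is used twice: at `jacobiIdx d k` it simplifies the denominator of
`funkConst`, and at s - 1/2 it trades Γ(s-1/2) for Γ(2s-1)/Γ(s). -/
theorem radValue_eq (hd : 2 ≤ d) (k : ℕ) {s : ℝ} (hs : 1 / 2 < s) :
    radValue d k s = Real.Gamma s * 2 ^ s * ((2 * Real.pi) ^ d * lamOne d s k) := by
  have hd' : (2 : ℝ) ≤ d := by exact_mod_cast hd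
  have ha := jacobiIdx_pos hd k
  have hk : (0 : ℝ) ≤ k := by positivity
  have g1 := (Real.Gamma_pos_of_pos ha).ne'
  have g2 := (Real.Gamma_pos_of_pos (show 0 < s by linarith)).ne'
  have g3 := (Real.Gamma_pos_of_pos (show 0 < k + d / 2 - 1 + s by linarith)).ne'
  have g4 := (Real.Gamma_pos_of_pos (mul_pos two_pos ha)).ne'
  have g5 := (Real.Gamma_pos_of_pos (show 0 < jacobiIdx d k + 1 / 2 by linarith)).ne'
  have hpi : 0 < √Real.pi := Real.sqrt_pos.2 Real.pi_pos
  have dup1 := Real.Gamma_mul_Gamma_add_half (jacobiIdx d k)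
  have dup2 := Real.Gamma_mul_Gamma_add_half (s - 1 / 2)
  rw [sub_add_cancel, show 2 * (s - 1 / 2) = 2 * s - 1 by ring] at dup2
  have hden : jacobiMoment (jacobiIdx d k) 0 * radMoment d (2 * k) =
      2 ^ (jacobiIdx d k - 1 / 2) * √Real.pi * Real.Gamma (jacobiIdx d k) := by
    rw [jacobiMoment_zero ha, radMoment,
      show ((2 * k + d : ℕ) : ℝ) / 2 = jacobiIdx d k + 1 / 2 by
        unfold jacobiIdx; push_cast; ring,
      show jacobiIdx d k + 1 / 2 - 1 = jacobiIdx d k - 1 / 2 by ring]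
    have h1 : (2 : ℝ) ^ (2 * jacobiIdx d k - 1) * 2 ^ (1 - 2 * jacobiIdx d k) = 1 := by
      rw [← Real.rpow_add (by norm_num)]; norm_num
    calc _ = 2 ^ (jacobiIdx d k - 1 / 2) * 2 ^ (2 * jacobiIdx d k - 1) *
          Real.Gamma (jacobiIdx d k) / Real.Gamma (2 * jacobiIdx d k) *
          (Real.Gamma (jacobiIdx d k) * Real.Gamma (jacobiIdx d k + 1 / 2)) := by ring
      _ = 2 ^ (jacobiIdx d k - 1 / 2) * √Real.pi * Real.Gamma (jacobiIdx d k) *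
          (2 ^ (2 * jacobiIdx d k - 1) * 2 ^ (1 - 2 * jacobiIdx d k)) := by
          rw [dup1]; field_simp
      _ = _ := by rw [h1, mul_one]
  have hpw : (2 * Real.pi) ^ d = (2 * Real.pi) ^ ((d : ℝ) / 2) * (2 * Real.pi) ^ ((d : ℝ) / 2) := by
    rw [← Real.rpow_natCast, ← Real.rpow_add (by positivity)]
    congr 1; ring
  have hp2 : (2 : ℝ) ^ (s - 1 / 2 + jacobiIdx d k - 1) =
      2 ^ s * 2 ^ (jacobiIdx d k - 1 / 2) / 2 := by
    rw [← Real.rpow_add (by norm_num), show s - 1 / 2 + jacobiIdx d k - 1 =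
      s + (jacobiIdx d k - 1 / 2) - 1 by ring, Real.rpow_sub_one (by norm_num)]
  have hp3 : (2 : ℝ) ^ (1 - (2 * s - 1)) = 2 * 2 ^ (1 - 2 * s) := by
    rw [show 1 - (2 * s - 1) = (1 - 2 * s) + 1 by ring, Real.rpow_add_one (by norm_num)]; ring
  rw [hp3] at dup2
  have hG : Real.Gamma (s - 1 / 2) =
      Real.Gamma (2 * s - 1) * (2 * 2 ^ (1 - 2 * s)) * √Real.pi / Real.Gamma s := by
    rw [← dup2]; field_simp
  have hidx : s - 1 / 2 + jacobiIdx d k = k + d / 2 - 1 + s := by unfold jacobiIdx; ring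
  have hq : (0 : ℝ) < 2 ^ (jacobiIdx d k - 1 / 2) := by positivity
  rw [radValue, funkConst, hden, hp2, hG, hidx, lamOne, hpw]
  field_simp

theorem measurable_funkCoef_neg_I (d k : ℕ) :
    Measurable fun r : ℝ => funkCoef d k (-(Complex.I * r)) :=
  (measurable_funkCoef d k).comp (by fun_prop)

/-- Integrate the Gaussian averages against τ^(-s-1) dτ in both orders. One order gives `radValue`;
the other gives Γ(s) 2^s times the desired integral. -/
theorem lintegral_funkCoef (hd : 2 ≤ d) (k : ℕ) {s : ℝ} (hs : 1 / 2 < s) (hsd : s < d / 2) :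
    ∫⁻ r in Set.Ioi (0 : ℝ), ENNReal.ofReal (r ^ (d - 1)) *
      ENNReal.ofReal (r ^ (-(2 * s)) * ‖funkCoef d k (-(Complex.I * r))‖ ^ 2) =
      ENNReal.ofReal ((2 * Real.pi) ^ d * lamOne d s k) := by
  have hs0 : 0 < s := by linarith
  have hG := Real.Gamma_pos_of_pos hs0
  have hm := measurable_funkCoef_neg_I d k
  have hswap := lintegral_lintegral_swap (μ := volume.restrict (Set.Ioi (0 : ℝ)))
    (ν := volume.restrict (Set.Ioi (0 : ℝ)))
    (f := fun τ r : ℝ => ENNReal.ofReal (τ ^ (-s - 1)) * ENNReal.ofReal (r ^ (d - 1) *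
      (Real.exp (-(r ^ 2 / (2 * τ))) * ‖funkCoef d k (-(Complex.I * r))‖ ^ 2)))
    (Measurable.aemeasurable (Measurable.mul (by fun_prop) (Measurable.ennreal_ofReal
      (Measurable.mul (by fun_prop) (Measurable.mul (by fun_prop)
        ((hm.comp measurable_snd).norm.pow_const 2))))))
  have hl : ∀ τ ∈ Set.Ioi (0 : ℝ), ∫⁻ r in Set.Ioi (0 : ℝ),
      ENNReal.ofReal (τ ^ (-s - 1)) * ENNReal.ofReal (r ^ (d - 1) *
        (Real.exp (-(r ^ 2 / (2 * τ))) * ‖funkCoef d k (-(Complex.I * r))‖ ^ 2)) =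
      ENNReal.ofReal (τ ^ (-s - 1) *
      ((2 * Real.pi * τ) ^ ((d : ℝ) / 2) * Real.exp (-τ) *
        (funkConst d k * τ ^ k * ∫ u in Set.Ioo (-1 : ℝ) 1,
          jacobiW (jacobiIdx d k) (jacobiIdx d k) u * Real.exp (τ * u)))) := by
    intro τ hτ
    have hτ0 : (0 : ℝ) < τ := hτ
    have hp := funkCoef_ofReal_pos hd k hτ0
    rw [lintegral_const_mul' _ _ ENNReal.ofReal_ne_top, ENNReal.ofReal_mul (by positivity),
      lintegral_ofReal_eq_of_integral_eq measurableSet_Ioi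
        (fun r hr => mul_nonneg (pow_nonneg (le_of_lt hr) _) (by positivity))
        (by positivity) (integral_gauss_funkCoef hd k hτ0),
      ← ENNReal.ofReal_mul (by positivity)]
  have hr : ∀ r ∈ Set.Ioi (0 : ℝ), ∫⁻ τ in Set.Ioi (0 : ℝ),
      ENNReal.ofReal (τ ^ (-s - 1)) * ENNReal.ofReal (r ^ (d - 1) *
        (Real.exp (-(r ^ 2 / (2 * τ))) * ‖funkCoef d k (-(Complex.I * r))‖ ^ 2)) =
      ENNReal.ofReal (Real.Gamma s * 2 ^ s) * (ENNReal.ofReal (r ^ (d - 1)) *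
        ENNReal.ofReal (r ^ (-(2 * s)) * ‖funkCoef d k (-(Complex.I * r))‖ ^ 2)) := by
    intro r hr
    have hr0 : (0 : ℝ) < r := hr
    have h1 : ∀ τ ∈ Set.Ioi (0 : ℝ), ENNReal.ofReal (τ ^ (-s - 1)) *
        ENNReal.ofReal (r ^ (d - 1) *
        (Real.exp (-(r ^ 2 / (2 * τ))) * ‖funkCoef d k (-(Complex.I * r))‖ ^ 2)) =
        ENNReal.ofReal (r ^ (d - 1) * ‖funkCoef d k (-(Complex.I * r))‖ ^ 2) *
          ENNReal.ofReal (τ ^ (-s - 1) * Real.exp (-(r ^ 2 / 2 / τ))) := by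
      intro τ hτ
      have hτ0 : (0 : ℝ) < τ := hτ
      rw [← ENNReal.ofReal_mul (by positivity), ← ENNReal.ofReal_mul (by positivity), div_div]
      congr 1; ring
    rw [setLIntegral_congr_fun measurableSet_Ioi h1,
      lintegral_const_mul' _ _ ENNReal.ofReal_ne_top,
      lintegral_rpow_mul_exp_inv hs0 (by positivity), ← ENNReal.ofReal_mul (by positivity),
      ← ENNReal.ofReal_mul (by positivity), ← ENNReal.ofReal_mul (by positivity)]
    congr 1
    have : (r ^ 2 / 2) ^ (-s) = 2 ^ s * r ^ (-(2 * s)) := by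
      rw [Real.div_rpow (by positivity) (by norm_num), ← Real.rpow_natCast, ← Real.rpow_mul hr0.le,
        Real.rpow_neg (by norm_num : (0 : ℝ) ≤ 2), div_inv_eq_mul, mul_comm]
      congr 2; push_cast; ring
    rw [this]; ring
  rw [setLIntegral_congr_fun measurableSet_Ioi hl, lintegral_heat hd k hs hsd,
    setLIntegral_congr_fun measurableSet_Ioi hr, lintegral_const_mul' _ _ ENNReal.ofReal_ne_top,
    radValue_eq hd k hs, ENNReal.ofReal_mul (by positivity)] at hswap
  exact ((ENNReal.mul_right_inj (by simp only [ne_eq, ENNReal.ofReal_eq_zero, not_le]; positivity)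
    ENNReal.ofReal_ne_top).1 hswap).symm

end RadialIntegral

/-! ### Unitary normalisation of the Fourier transform -/

section Dilation

variable {d : ℕ}

theorem quasiMeasurePreserving_smul {a : ℝ} (ha : 0 < a) :
    Measure.QuasiMeasurePreserving (fun ξ : E d => a • ξ) volume volume := by
  refine ⟨measurable_const_smul _, ?_⟩
  rw [Measure.map_addHaar_smul _ ha.ne']
  exact Measure.smul_absolutelyContinuous

theorem memLp_comp_smul {a : ℝ} (ha : 0 < a) (W : L2E d) :
    MemLp (fun ξ : E d => W (a • ξ)) 2 volume := by
  have h : MemLp W 2 (Measure.map (fun ξ : E d => a • ξ) volume) := by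
    rw [Measure.map_addHaar_smul _ ha.ne']
    exact (Lp.memLp W).smul_measure ENNReal.ofReal_ne_top
  exact h.comp_of_map (measurable_const_smul a).aemeasurable

theorem norm_sq_eq_integral {α : Type*} [MeasurableSpace α] {μ : Measure α} (f : Lp ℂ 2 μ) :
    ‖f‖ ^ 2 = ∫ x, ‖f x‖ ^ 2 ∂μ := by
  rw [@norm_sq_eq_re_inner ℂ, L2.inner_def]
  have : ∀ x, inner ℂ (f x) (f x) = ((‖f x‖ ^ 2 : ℝ) : ℂ) := fun x => by
    rw [inner_self_eq_norm_sq_to_K]; simp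
  simp only [this]
  rw [integral_complex_ofReal]
  simp

/-- The unitary dilation `W ↦ a^(d/2) W (a ·)`. -/
noncomputable def dilation (d : ℕ) (a : ℝ) (ha : 0 < a) : L2E d →ₗᵢ[ℂ] L2E d where
  toFun W := ((a ^ ((d : ℝ) / 2) : ℝ) : ℂ) • (memLp_comp_smul ha W).toLp
  map_add' W W' := by
    rw [← smul_add, ← MemLp.toLp_add]
    congr 1
    refine MemLp.toLp_congr _ _ ?_
    exact (quasiMeasurePreserving_smul ha).ae_eq_comp (Lp.coeFn_add W W')
  map_smul' c W := by
    have h : (memLp_comp_smul ha (c • W)).toLp _ = c • (memLp_comp_smul ha W).toLp _ :=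
      (MemLp.toLp_congr _ ((memLp_comp_smul ha W).const_smul c)
        ((quasiMeasurePreserving_smul ha).ae_eq_comp (Lp.coeFn_smul c W))).trans
        (MemLp.toLp_const_smul _ _)
    rw [RingHom.id_apply, h, smul_comm]
  norm_map' W := by
    change ‖((a ^ ((d : ℝ) / 2) : ℝ) : ℂ) • (memLp_comp_smul ha W).toLp‖ = ‖W‖
    rw [← sq_eq_sq₀ (norm_nonneg _) (norm_nonneg _), norm_smul, mul_pow, norm_sq_eq_integral,
      norm_sq_eq_integral]
    have h : ∫ x, ‖(memLp_comp_smul ha W).toLp _ x‖ ^ 2 = ∫ x : E d, ‖W (a • x)‖ ^ 2 := by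
      refine integral_congr_ae ?_
      filter_upwards [(memLp_comp_smul ha W).coeFn_toLp] with x hx
      rw [hx]
    rw [h, Measure.integral_comp_smul volume (fun x => ‖W x‖ ^ 2), finrank_euclideanSpace_fin,
      Complex.norm_real, Real.norm_of_nonneg (by positivity), ← Real.rpow_natCast _ 2,
      ← Real.rpow_mul ha.le, abs_of_pos (by positivity), smul_eq_mul, ← mul_assoc]
    have : a ^ ((d : ℝ) / 2 * (2 : ℕ)) = a ^ d := by
      rw [← Real.rpow_natCast]; congr 1; push_cast; ring
    rw [this, mul_inv_cancel₀ (by positivity), one_mul]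

theorem coeFn_dilation {a : ℝ} (ha : 0 < a) (W : L2E d) :
    dilation d a ha W =ᵐ[volume] fun ξ => ((a ^ ((d : ℝ) / 2) : ℝ) : ℂ) * W (a • ξ) := by
  change ((((a ^ ((d : ℝ) / 2) : ℝ) : ℂ) • (memLp_comp_smul ha W).toLp : L2E d) : E d → ℂ)
    =ᵐ[volume] _
  filter_upwards [(memLp_comp_smul ha W).coeFn_toLp, Lp.coeFn_smul ((a ^ ((d : ℝ) / 2) : ℝ) : ℂ)
    (memLp_comp_smul ha W).toLp] with x h1 h2
  rw [h2, Pi.smul_apply, h1, smul_eq_mul]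

theorem dilation_surjective {a : ℝ} (ha : 0 < a) : Function.Surjective (dilation d a ha) := by
  intro W
  have hb : 0 < a⁻¹ := inv_pos.2 ha
  refine ⟨dilation d a⁻¹ hb W, Lp.ext ?_⟩
  filter_upwards [coeFn_dilation ha (dilation d a⁻¹ hb W),
    (quasiMeasurePreserving_smul ha).ae_eq_comp (coeFn_dilation hb W)] with x h1 h2
  simp only [Function.comp] at h2
  rw [h1, h2, inv_smul_smul₀ ha.ne', ← mul_assoc, ← Complex.ofReal_mul,
    ← Real.mul_rpow ha.le hb.le, mul_inv_cancel₀ ha.ne', Real.one_rpow]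
  simp

theorem inv_two_pi_pos : 0 < (2 * Real.pi)⁻¹ := by positivity

/-- The constant `(2π)^(-d/2)`. -/
noncomputable def fourierConst (d : ℕ) : ℝ := (2 * Real.pi)⁻¹ ^ ((d : ℝ) / 2)

theorem fourierConst_pos (d : ℕ) : 0 < fourierConst d := by unfold fourierConst; positivity

theorem fourierConst_sq (d : ℕ) : fourierConst d ^ 2 = ((2 * Real.pi) ^ d)⁻¹ := by
  rw [fourierConst, ← Real.rpow_natCast _ 2, ← Real.rpow_mul inv_two_pi_pos.le,
    ← inv_pow, ← Real.rpow_natCast _ d]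
  congr 1; push_cast; ring

/-- The unitary Fourier transform `(2π)^(-d/2) ĝ`. -/
noncomputable def fourierIso (d : ℕ) : L2E d ≃ₗᵢ[ℂ] L2E d :=
  (Lp.fourierTransformₗᵢ (E d) ℂ).trans
    (LinearIsometryEquiv.ofSurjective (dilation d _ inv_two_pi_pos) (dilation_surjective _))

theorem coeFn_fourierIso (g : L2E d) :
    fourierIso d g =ᵐ[volume] fun ξ => (fourierConst d : ℂ) * fourierL2 g ξ :=
  coeFn_dilation inv_two_pi_pos (Lp.fourierTransformₗᵢ (E d) ℂ g)

end Dilation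

/-! ### The building blocks of the adjoint operator -/

section Wave

variable {d : ℕ}

theorem extension_add (G G' : L2S d) (ξ : E d) :
    extension (G + G') ξ = extension G ξ + extension G' ξ := by
  unfold extension
  rw [← integral_add]
  · refine integral_congr_ae ?_
    filter_upwards [Lp.coeFn_add G G'] with ω hω
    rw [hω, Pi.add_apply, add_mul]
  all_goals
    exact (integrable_L2S _).mul_bdd (c := 1) (Continuous.aestronglyMeasurable (by fun_prop))
      (ae_of_all _ fun ω => (norm_exp_neg_I_mul _).le)

theorem extension_smul (c : ℂ) (G : L2S d) (ξ : E d) :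
    extension (c • G) ξ = c * extension G ξ := by
  unfold extension
  rw [← integral_const_mul]
  refine integral_congr_ae ?_
  filter_upwards [Lp.coeFn_smul c G] with ω hω
  rw [hω, Pi.smul_apply, smul_eq_mul, mul_assoc]

/-- The function `|ξ|^(-s) (G dσ)^(ξ)`. -/
noncomputable def wave (s : ℝ) (G : L2S d) (ξ : E d) : ℂ :=
  ((‖ξ‖ ^ (-s) : ℝ) : ℂ) * extension G ξ

theorem measurable_wave (s : ℝ) (G : L2S d) : Measurable (wave s G) := by
  have := (continuous_extension G).measurable
  unfold wave
  fun_prop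

theorem wave_polar (hd : 2 ≤ d) {k : ℕ} {Y : C(S d, ℂ)} (hY : Y ∈ harmC d k) (s : ℝ) {r : ℝ}
    (hr : 0 < r) (ω : S d) :
    wave s (ContinuousMap.toLp (E := ℂ) 2 (surf d) ℂ Y) (r • (ω : E d)) =
      ((r ^ (-s) : ℝ) : ℂ) * funkCoef d k (-(Complex.I * r)) * Y ω := by
  rw [wave, extension_harmC hd hY, norm_smul, norm_coe_sphere, mul_one, Real.norm_of_nonneg hr.le,
    mul_assoc]

/-- On a single degree the function separates in polar coordinates, so its squared norm is the
finite radial integral times the squared norm of Y. -/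
theorem memLp_wave (hd : 2 ≤ d) {k : ℕ} {s : ℝ} (hs : 1 / 2 < s) (hsd : s < d / 2) {G : L2S d}
    (hG : G ∈ harm d k) : MemLp (wave s G) 2 volume := by
  have := nontrivial_E hd
  obtain ⟨Y, hY, rfl⟩ := hG
  refine ⟨(measurable_wave s _).aestronglyMeasurable, ?_⟩
  rw [eLpNorm_lt_top_iff_lintegral_rpow_enorm_lt_top (by norm_num) (by norm_num)]
  have hm := measurable_funkCoef_neg_I d k
  have h := lintegral_polar_mul
    (F := fun ξ => ‖wave s (ContinuousMap.toLp (E := ℂ) 2 (surf d) ℂ Y) ξ‖ₑ ^ (2 : ℝ≥0∞).toReal)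
    (f := fun r => ENNReal.ofReal (r ^ (-(2 * s)) * ‖funkCoef d k (-(Complex.I * r))‖ ^ 2))
    (g := fun ω => ENNReal.ofReal (‖Y ω‖ ^ 2)) (by fun_prop) (by fun_prop) (fun r hr ω => by
      rw [wave_polar hd hY s hr, ← ofReal_norm,
        ENNReal.ofReal_rpow_of_nonneg (norm_nonneg _) (by norm_num),
        ← ENNReal.ofReal_mul (by positivity)]
      congr 1
      rw [ENNReal.toReal_ofNat, Real.rpow_two, norm_mul, norm_mul, Complex.norm_real,
        Real.norm_of_nonneg (by positivity), mul_pow, mul_pow, ← Real.rpow_natCast (r ^ (-s)) 2,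
        ← Real.rpow_mul hr.le]
      congr 3; push_cast; ring)
  refine (h.trans_lt ?_)
  rw [lintegral_funkCoef hd k hs hsd]
  refine ENNReal.mul_lt_top ENNReal.ofReal_lt_top ?_
  have hi : Integrable (fun ω => ‖Y ω‖ ^ 2) (surf d) :=
    Continuous.integrable_of_hasCompactSupport (by fun_prop) (HasCompactSupport.of_compactSpace _)
  rw [← ofReal_integral_eq_lintegral_ofReal hi (ae_of_all _ fun ω => by positivity)]
  exact ENNReal.ofReal_lt_top

/-- The function `|ξ|^(-s) (Y dσ)^(ξ)` for a spherical harmonic `Y`, in `L²`. -/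
noncomputable def waveMap (hd : 2 ≤ d) (k : ℕ) {s : ℝ} (hs : 1 / 2 < s) (hsd : s < d / 2) :
    harm d k →ₗ[ℂ] L2E d where
  toFun Y := (memLp_wave hd hs hsd Y.2).toLp
  map_add' Y Z := by
    rw [← MemLp.toLp_add]
    refine MemLp.toLp_congr _ _ (ae_of_all _ fun ξ => ?_)
    simp only [wave, Submodule.coe_add, extension_add, Pi.add_apply]
    ring
  map_smul' c Y := by
    rw [RingHom.id_apply, ← MemLp.toLp_const_smul]
    refine MemLp.toLp_congr _ _ (ae_of_all _ fun ξ => ?_)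
    simp only [wave, Submodule.coe_smul, extension_smul, Pi.smul_apply, smul_eq_mul]
    ring

theorem coeFn_waveMap (hd : 2 ≤ d) (k : ℕ) {s : ℝ} (hs : 1 / 2 < s) (hsd : s < d / 2)
    (Y : harm d k) : waveMap hd k hs hsd Y =ᵐ[volume] wave s Y :=
  (memLp_wave hd hs hsd Y.2).coeFn_toLp

/-- Separation puts the whole dependence on Y and Z into the angular factor. For j ≠ k that factor
vanishes, so the mixed radial integral never has to be evaluated. -/
theorem inner_waveMap_eq (hd : 2 ≤ d) {j k : ℕ} {s : ℝ} (hs : 1 / 2 < s) (hsd : s < d / 2)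
    {Y Z : C(S d, ℂ)} (hY : Y ∈ harmC d j) (hZ : Z ∈ harmC d k) :
    inner ℂ (waveMap hd j hs hsd ⟨_, toLp_mem_harm hY⟩) (waveMap hd k hs hsd ⟨_, toLp_mem_harm hZ⟩) =
      (∫ r in Set.Ioi (0 : ℝ), ((r ^ (d - 1) : ℝ) : ℂ) * (((r ^ (-(2 * s)) : ℝ) : ℂ) *
        (conj (funkCoef d j (-(Complex.I * r))) * funkCoef d k (-(Complex.I * r))))) *
        ∫ ω, conj (Y ω) * Z ω ∂(surf d) := by
  have := nontrivial_E hd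
  rw [L2.inner_def, ← integral_polar_mul
    (F := fun ξ => conj (wave s (ContinuousMap.toLp (E := ℂ) 2 (surf d) ℂ Y) ξ) *
      wave s (ContinuousMap.toLp (E := ℂ) 2 (surf d) ℂ Z) ξ)]
  · refine integral_congr_ae ?_
    filter_upwards [coeFn_waveMap hd j hs hsd ⟨_, toLp_mem_harm hY⟩,
      coeFn_waveMap hd k hs hsd ⟨_, toLp_mem_harm hZ⟩] with ξ h1 h2
    rw [h1, h2, RCLike.inner_apply, mul_comm]
  · intro r hr ω
    rw [wave_polar hd hY s hr, wave_polar hd hZ s hr]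
    have : r ^ (-(2 * s)) = r ^ (-s) * r ^ (-s) := by
      rw [← Real.rpow_add hr]; congr 1; ring
    rw [this]
    simp only [map_mul, Complex.conj_ofReal]
    push_cast; ring

theorem inner_waveMap_of_ne (hd : 2 ≤ d) {j k : ℕ} (hjk : j ≠ k) {s : ℝ} (hs : 1 / 2 < s)
    (hsd : s < d / 2) (Y : harm d j) (Z : harm d k) :
    inner ℂ (waveMap hd j hs hsd Y) (waveMap hd k hs hsd Z) = 0 := by
  obtain ⟨_, Y, hY, rfl⟩ := Y
  obtain ⟨_, Z, hZ, rfl⟩ := Z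
  refine (inner_waveMap_eq hd hs hsd hY hZ).trans ?_
  rw [integral_conj_mul_eq_zero hd hjk hY hZ, mul_zero]

theorem inner_waveMap_self (hd : 2 ≤ d) {k : ℕ} {s : ℝ} (hs : 1 / 2 < s)
    (hsd : s < d / 2) (Y Z : harm d k) :
    inner ℂ (waveMap hd k hs hsd Y) (waveMap hd k hs hsd Z) =
      (((2 * Real.pi) ^ d * lamOne d s k : ℝ) : ℂ) * inner ℂ (Y : L2S d) (Z : L2S d) := by
  obtain ⟨_, Y, hY, rfl⟩ := Y
  obtain ⟨_, Z, hZ, rfl⟩ := Z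
  refine (inner_waveMap_eq hd hs hsd hY hZ).trans ?_
  refine Eq.trans ?_ (congrArg _ (inner_toLp_toLp Y Z).symm)
  congr 1
  have hm := measurable_funkCoef_neg_I d k
  have e : ∀ r : ℝ, ((r ^ (d - 1) : ℝ) : ℂ) * (((r ^ (-(2 * s)) : ℝ) : ℂ) *
        (conj (funkCoef d k (-(Complex.I * r))) * funkCoef d k (-(Complex.I * r)))) =
      ((r ^ (d - 1) * (r ^ (-(2 * s)) * ‖funkCoef d k (-(Complex.I * r))‖ ^ 2) : ℝ) : ℂ) := by
    intro r
    rw [mul_comm (conj _), Complex.mul_conj, Complex.normSq_eq_norm_sq]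
    push_cast; ring
  simp only [e]
  rw [integral_complex_ofReal, integral_eq_lintegral_of_nonneg_ae]
  · congr 1
    rw [← ENNReal.toReal_ofReal (r := (2 * Real.pi) ^ d * lamOne d s k)
      (mul_nonneg (by positivity) (lamOne_pos hd k hs hsd).le), ← lintegral_funkCoef hd k hs hsd]
    congr 1
    refine setLIntegral_congr_fun measurableSet_Ioi fun r hr => ?_
    exact ENNReal.ofReal_mul (pow_nonneg (le_of_lt hr) _)
  · filter_upwards [ae_restrict_mem measurableSet_Ioi] with r hr
    have hr0 : (0 : ℝ) < r := hr
    simp only [Pi.zero_apply]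
    positivity
  · exact Measurable.aestronglyMeasurable (by fun_prop)

/-- The adjoint of the `k`-th trace operator `g ↦ ℛ H_k D^(-s) g`. -/
noncomputable def adjTrace (hd : 2 ≤ d) (k : ℕ) {s : ℝ} (hs : 1 / 2 < s) (hsd : s < d / 2) :
    L2S d →L[ℂ] L2E d :=
  ((fourierIso d).symm : L2E d →L[ℂ] L2E d) ∘L ((fourierConst d : ℂ) •
    LinearMap.toContinuousLinearMap (waveMap hd k hs hsd)) ∘L (harm d k).orthogonalProjectionOnto

theorem fourierIso_adjTrace (hd : 2 ≤ d) (k : ℕ) {s : ℝ} (hs : 1 / 2 < s) (hsd : s < d / 2)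
    (G : L2S d) : fourierIso d (adjTrace hd k hs hsd G) =
      (fourierConst d : ℂ) • waveMap hd k hs hsd ((harm d k).orthogonalProjectionOnto G) :=
  (fourierIso d).apply_symm_apply _

theorem inner_adjTrace_of_ne (hd : 2 ≤ d) {j k : ℕ} (hjk : j ≠ k) {s : ℝ} (hs : 1 / 2 < s)
    (hsd : s < d / 2) (G G' : L2S d) :
    inner ℂ (adjTrace hd j hs hsd G) (adjTrace hd k hs hsd G') = 0 := by
  rw [← (fourierIso d).inner_map_map, fourierIso_adjTrace, fourierIso_adjTrace, inner_smul_left,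
    inner_smul_right, inner_waveMap_of_ne hd hjk, mul_zero, mul_zero]

/-- The weak form of T_k^* T_k = λ_k(1) H_k: the Plancherel constant (2π)^(-d) cancels the (2π)^d of
the radial integral. -/
theorem inner_adjTrace_self (hd : 2 ≤ d) (k : ℕ) {s : ℝ} (hs : 1 / 2 < s)
    (hsd : s < d / 2) (G G' : L2S d) :
    inner ℂ (adjTrace hd k hs hsd G) (adjTrace hd k hs hsd G') =
      (lamOne d s k : ℂ) * inner ℂ ((harm d k).starProjection G) ((harm d k).starProjection G') := by
  rw [← (fourierIso d).inner_map_map, fourierIso_adjTrace, fourierIso_adjTrace, inner_smul_left,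
    inner_smul_right, inner_waveMap_self, Complex.conj_ofReal, ← mul_assoc, ← mul_assoc,
    ← Complex.ofReal_mul, ← Complex.ofReal_mul, ← mul_assoc, ← pow_two, fourierConst_sq,
    inv_mul_cancel₀ (by positivity), one_mul]
  rfl

theorem adjTrace_starProjection (hd : 2 ≤ d) (k : ℕ) {s : ℝ} (hs : 1 / 2 < s) (hsd : s < d / 2)
    (G : L2S d) :
    adjTrace hd k hs hsd ((harm d k).starProjection G) = adjTrace hd k hs hsd G := by
  apply (fourierIso d).injective
  rw [fourierIso_adjTrace, fourierIso_adjTrace]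
  congr 2
  exact Subtype.ext ((harm d k).starProjection_eq_self_iff.2 (Submodule.starProjection_apply_mem _ _))

/-- Passes from the concrete graph to a series of bounded operators. H_k commutes with extension
away from the origin, a null set, and the unitary Fourier transform carries convergence in both
directions. -/
theorem isSthetaStar_iff (hd : 2 ≤ d) {s : ℝ} (hs : 1 / 2 < s) (hsd : s < d / 2) (θ : ℝ≥0 → ℂ)
    (G : L2S d) (h : L2E d) :
    IsSthetaStar s θ G h ↔ HasSum (fun k => thetaAt d θ k • adjTrace hd k hs hsd G) h := by
  have := nontrivial_E hd
  have hc : (fourierConst d : ℂ) ≠ 0 := by exact_mod_cast (fourierConst_pos d).ne'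
  have hne : ∀ᵐ ξ : E d, ξ ≠ 0 := by
    simp [ae_iff, measure_singleton]
  have hproj : ∀ k, (fun ξ : E d => ((‖ξ‖ ^ (-s) : ℝ) : ℂ) * projSpace d k (extension G) ξ)
      =ᵐ[volume] waveMap hd k hs hsd ((harm d k).orthogonalProjectionOnto G) := fun k => by
    filter_upwards [hne, coeFn_waveMap hd k hs hsd ((harm d k).orthogonalProjectionOnto G)]
      with ξ h1 h2
    rw [h2, projSpace_extension hd k G h1]
    rfl
  have hsum : ∀ W : L2E d, HasSum (fun k => thetaAt d θ k •
      waveMap hd k hs hsd ((harm d k).orthogonalProjectionOnto G)) W ↔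
      HasSum (fun k => thetaAt d θ k • adjTrace hd k hs hsd G)
        ((fourierIso d).symm ((fourierConst d : ℂ) • W)) := by
    intro W
    rw [← (fourierIso d).toContinuousLinearEquiv.hasSum'
      (f := fun k => thetaAt d θ k • adjTrace hd k hs hsd G)]
    have e : ∀ k, (fourierIso d).toContinuousLinearEquiv
        (thetaAt d θ k • adjTrace hd k hs hsd G) = (fourierConst d : ℂ) • (thetaAt d θ k •
      waveMap hd k hs hsd ((harm d k).orthogonalProjectionOnto G)) := fun k => by
      rw [map_smul, smul_comm, ← fourierIso_adjTrace]; rfl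
    simp only [e]
    rw [show (fourierIso d).toContinuousLinearEquiv ((fourierIso d).symm ((fourierConst d : ℂ) • W))
      = (fourierConst d : ℂ) • W from (fourierIso d).apply_symm_apply _]
    constructor
    · exact fun h => h.const_smul _
    · intro h
      have := h.const_smul (fourierConst d : ℂ)⁻¹
      simpa only [smul_smul, inv_mul_cancel_left₀ hc, inv_mul_cancel₀ hc, one_smul] using this
  constructor
  · rintro ⟨Ψ, W, h1, h2, h3⟩
    have hΨ : Ψ = fun k => waveMap hd k hs hsd ((harm d k).orthogonalProjectionOnto G) :=
      funext fun k => Lp.ext ((h1 k).trans (hproj k))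
    subst hΨ
    have hW : fourierIso d h = (fourierConst d : ℂ) • W := by
      apply Lp.ext
      filter_upwards [coeFn_fourierIso h, h3, Lp.coeFn_smul (fourierConst d : ℂ) W] with ξ e1 e2 e3
      rw [e1, e2, e3, Pi.smul_apply, smul_eq_mul]
    have := (hsum W).1 h2
    rwa [← hW, LinearIsometryEquiv.symm_apply_apply] at this
  · intro hh
    refine ⟨fun k => waveMap hd k hs hsd ((harm d k).orthogonalProjectionOnto G),
      (fourierConst d : ℂ)⁻¹ • fourierIso d h, fun k => (hproj k).symm, ?_, ?_⟩
    · rw [hsum, smul_smul, mul_inv_cancel₀ hc, one_smul, LinearIsometryEquiv.symm_apply_apply]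
      exact hh
    · filter_upwards [coeFn_fourierIso h,
        Lp.coeFn_smul (fourierConst d : ℂ)⁻¹ (fourierIso d h)] with ξ e1 e2
      rw [e2, Pi.smul_apply, e1, smul_eq_mul, inv_mul_cancel_left₀ hc]

end Wave

/-! ### The trace components -/

section Trace

variable {d : ℕ}

theorem coeFn_fourierL2 (g : L2E d) :
    fourierL2 g =ᵐ[volume] fun ξ => (fourierConst d : ℂ)⁻¹ * fourierIso d g ξ := by
  have hc : (fourierConst d : ℂ) ≠ 0 := by exact_mod_cast (fourierConst_pos d).ne'
  filter_upwards [coeFn_fourierIso g] with ξ h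
  rw [h, inv_mul_cancel_left₀ hc]

theorem memLp_fourierL2 (g : L2E d) : MemLp (fourierL2 g) 2 volume :=
  ((Lp.memLp (fourierIso d g)).const_mul _).ae_eq (coeFn_fourierL2 g).symm

/-- |ξ|^(-2s) is integrable near the origin because 2s < d. By Cauchy–Schwarz the
frequency-truncated D^(-s) g is then an absolutely convergent integral, hence continuous. -/
theorem memLp_norm_rpow (hd : 2 ≤ d) {s : ℝ} (hsd : s < d / 2) (N : ℕ) :
    MemLp (fun ξ : E d => ‖ξ‖ ^ (-s)) 2 (volume.restrict (Metric.closedBall (0 : E d) N)) := by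
  have := nontrivial_E hd
  have hm : Measurable fun ξ : E d => ‖ξ‖ ^ (-s) := by fun_prop
  rw [memLp_two_iff_integrable_sq hm.aestronglyMeasurable]
  have h : IntegrableOn (fun ξ : E d => ‖ξ‖ ^ (-(2 * s))) (Metric.ball (0 : E d) (N + 1)) := by
    rw [integrableOn_fun_norm_addHaar volume (f := fun r => r ^ (-(2 * s))),
      finrank_euclideanSpace_fin, ← intervalIntegrable_iff_integrableOn_Ioo_of_le (by positivity)]
    have h1 : IntervalIntegrable (fun r : ℝ => r ^ ((d : ℝ) - 1 - 2 * s)) volume 0 (N + 1) :=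
      intervalIntegral.intervalIntegrable_rpow' (by linarith)
    rw [intervalIntegrable_iff_integrableOn_Ioo_of_le (by positivity)] at h1 ⊢
    refine h1.congr_fun (fun r hr => ?_) measurableSet_Ioo
    beta_reduce
    rw [smul_eq_mul, ← Real.rpow_natCast, ← Real.rpow_add hr.1, Nat.cast_sub (by omega)]
    congr 1; push_cast; ring
  refine (h.mono_set (Metric.closedBall_subset_ball (by linarith))).congr (ae_of_all _ fun ξ => ?_)
  beta_reduce
  rw [← Real.rpow_natCast, ← Real.rpow_mul (norm_nonneg _)]
  congr 1; push_cast; ring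

theorem integrable_norm_rpow_mul_fourierL2 (hd : 2 ≤ d) {s : ℝ} (hsd : s < d / 2) (N : ℕ)
    (g : L2E d) :
    Integrable (fun ξ : E d => ((‖ξ‖ ^ (-s) : ℝ) : ℂ) * fourierL2 g ξ)
      (volume.restrict (Metric.closedBall (0 : E d) N)) :=
  (memLp_norm_rpow hd hsd N).ofReal.integrable_mul ((memLp_fourierL2 g).restrict _)

theorem continuous_negPowD (hd : 2 ≤ d) {s : ℝ} (hsd : s < d / 2) (N : ℕ) (g : L2E d) :
    Continuous (negPowD s N g) := by
  have hi := integrable_norm_rpow_mul_fourierL2 hd hsd N g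
  unfold negPowD
  refine continuous_const.mul (continuous_of_dominated
    (bound := fun ξ => ‖((‖ξ‖ ^ (-s) : ℝ) : ℂ) * fourierL2 g ξ‖) (fun x => ?_)
    (fun x => ae_of_all _ fun ξ => ?_) hi.norm (ae_of_all _ fun ξ => by fun_prop))
  · exact hi.aestronglyMeasurable.mul (by fun_prop : Continuous fun ξ : E d =>
      Complex.exp (Complex.I * (inner ℝ x ξ : ℝ))).aestronglyMeasurable
  · rw [norm_mul _ (Complex.exp _), norm_exp_I_mul, mul_one]

/-- The part of `g` with frequencies at most `N`. -/
noncomputable def lowFreq (N : ℕ) (g : L2E d) : L2E d :=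
  (fourierIso d).symm (((Lp.memLp (fourierIso d g)).indicator
    (Metric.isClosed_closedBall (x := (0 : E d)) (ε := N)).measurableSet).toLp)

theorem coeFn_fourierIso_lowFreq (N : ℕ) (g : L2E d) :
    fourierIso d (lowFreq N g) =ᵐ[volume]
      (Metric.closedBall (0 : E d) N).indicator (fourierIso d g) := by
  rw [lowFreq, LinearIsometryEquiv.apply_symm_apply]
  exact MemLp.coeFn_toLp _

theorem tendsto_lowFreq (g : L2E d) : Tendsto (fun N : ℕ => lowFreq N g) atTop (𝓝 g) := by
  rw [tendsto_iff_norm_sub_tendsto_zero]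
  have h0 : Tendsto (fun N : ℕ => ‖lowFreq N g - g‖ ^ 2) atTop (𝓝 0) := by
    have h1 : ∀ N : ℕ, ‖lowFreq N g - g‖ ^ 2 =
        ∫ ξ, ‖(Metric.closedBall (0 : E d) N).indicator (fourierIso d g) ξ -
          fourierIso d g ξ‖ ^ 2 := fun N => by
      rw [← (fourierIso d).norm_map, map_sub, norm_sq_eq_integral]
      refine integral_congr_ae ?_
      filter_upwards [coeFn_fourierIso_lowFreq N g,
        Lp.coeFn_sub (fourierIso d (lowFreq N g)) (fourierIso d g)] with ξ e1 e2
      rw [e2, Pi.sub_apply, e1]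
    simp only [h1]
    have h2 := tendsto_integral_of_dominated_convergence (μ := (volume : Measure (E d)))
      (F := fun (N : ℕ) ξ => ‖(Metric.closedBall (0 : E d) N).indicator (fourierIso d g) ξ -
          fourierIso d g ξ‖ ^ 2) (f := fun _ => 0) (fun ξ => ‖fourierIso d g ξ‖ ^ 2)
      (fun N => (((Lp.aestronglyMeasurable _).indicator
        Metric.isClosed_closedBall.measurableSet).sub (Lp.aestronglyMeasurable _)).norm.pow 2)
      ((memLp_two_iff_integrable_sq_norm (Lp.aestronglyMeasurable _)).1 (Lp.memLp _))
      (fun N => ae_of_all _ fun ξ => ?_) (ae_of_all _ fun ξ => ?_)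
    · simpa using h2
    · by_cases h : ξ ∈ Metric.closedBall (0 : E d) N
      · simp [Set.indicator_of_mem h]
      · simp [Set.indicator_of_notMem h]
    · refine tendsto_const_nhds.congr' ?_
      filter_upwards [eventually_ge_atTop ⌈‖ξ‖⌉₊] with N hN
      have h : ξ ∈ Metric.closedBall (0 : E d) N := by
        rw [mem_closedBall_zero_iff]
        exact (Nat.le_ceil _).trans (by exact_mod_cast hN)
      simp [Set.indicator_of_mem h]
  have := h0.sqrt
  simpa using this

/-- Restriction and extension are dual: Fubini turns pairing on the sphere with Z into pairing in
frequency with the wave of Z. -/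
theorem integral_conj_mul_negPowD (hd : 2 ≤ d) {s : ℝ} (hsd : s < d / 2)
    (N : ℕ) (g : L2E d) (Z : C(S d, ℂ)) :
    ∫ φ : S d, conj (Z φ) * negPowD s N g φ ∂(surf d) =
      ((fourierConst d : ℂ)) ^ 2 * ∫ ξ in Metric.closedBall (0 : E d) N,
        conj (wave s (ContinuousMap.toLp (E := ℂ) 2 (surf d) ℂ Z) ξ) * fourierL2 g ξ := by
  have hi := integrable_norm_rpow_mul_fourierL2 hd hsd N g
  have hc : (((2 * Real.pi) ^ d : ℝ) : ℂ)⁻¹ = (fourierConst d : ℂ) ^ 2 := by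
    rw [← Complex.ofReal_pow, fourierConst_sq, Complex.ofReal_inv]
  have hint : Integrable (Function.uncurry fun (φ : S d) (ξ : E d) =>
      conj (Z φ) * (((‖ξ‖ ^ (-s) : ℝ) : ℂ) * fourierL2 g ξ *
        Complex.exp (Complex.I * (inner ℝ (φ : E d) ξ : ℝ))))
      ((surf d).prod (volume.restrict (Metric.closedBall (0 : E d) N))) := by
    have h1 := ((integrable_continuousMap (star Z)).mul_prod hi).mul_bdd
      (c := 1) (g := fun p : S d × E d =>
        Complex.exp (Complex.I * (inner ℝ (p.1 : E d) p.2 : ℝ)))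
      (Continuous.aestronglyMeasurable (by fun_prop))
      (ae_of_all _ fun p => (norm_exp_I_mul _).le)
    refine h1.congr (ae_of_all _ fun p => ?_)
    simp [Function.uncurry, mul_assoc]
  have e1 : ∀ φ : S d, conj (Z φ) * negPowD s N g φ = (fourierConst d : ℂ) ^ 2 *
      ∫ ξ in Metric.closedBall (0 : E d) N, conj (Z φ) * (((‖ξ‖ ^ (-s) : ℝ) : ℂ) * fourierL2 g ξ *
        Complex.exp (Complex.I * (inner ℝ (φ : E d) ξ : ℝ))) := fun φ => by
    rw [integral_const_mul, negPowD, ← hc, ← Complex.ofReal_inv]; ring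
  simp only [e1]
  rw [integral_const_mul, integral_integral_swap hint]
  congr 1
  refine integral_congr_ae (ae_of_all _ fun ξ => ?_)
  beta_reduce
  rw [wave, extension_toLp, map_mul, ← integral_conj, Complex.conj_ofReal]
  calc _ = ((‖ξ‖ ^ (-s) : ℝ) : ℂ) * fourierL2 g ξ * ∫ φ : S d, conj (Z φ) *
        Complex.exp (Complex.I * (inner ℝ (φ : E d) ξ : ℝ)) ∂(surf d) := by
        rw [← integral_const_mul]
        congr 1; funext φ; ring
    _ = _ := by
        simp only [map_mul, map_neg, ← Complex.exp_conj, Complex.conj_I, Complex.conj_ofReal,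
          neg_mul, neg_neg]
        ring

theorem adjoint_adjTrace_mem (hd : 2 ≤ d) (k : ℕ) {s : ℝ} (hs : 1 / 2 < s) (hsd : s < d / 2)
    (g : L2E d) : (adjTrace hd k hs hsd).adjoint g ∈ harm d k := by
  rw [← Submodule.starProjection_eq_self_iff]
  refine ext_inner_left ℂ fun G => ?_
  rw [← Submodule.inner_starProjection_left_eq_right, ContinuousLinearMap.adjoint_inner_right,
    ContinuousLinearMap.adjoint_inner_right, adjTrace_starProjection]

/-- Test against harmonics of degree k: the frequency cutoff in the integral becomes the cutoff of
g, and duality identifies the result with T_k^*. -/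
theorem starProjection_negPowD (hd : 2 ≤ d) (k : ℕ) {s : ℝ} (hs : 1 / 2 < s) (hsd : s < d / 2)
    (N : ℕ) (g : L2E d) (hu : MemLp (fun φ : S d => negPowD s N g φ) 2 (surf d)) :
    (harm d k).starProjection (hu.toLp) = (adjTrace hd k hs hsd).adjoint (lowFreq N g) := by
  refine Submodule.eq_starProjection_of_mem_orthogonal (adjoint_adjTrace_mem hd k hs hsd _) ?_
  rw [Submodule.mem_orthogonal]
  rintro _ ⟨Z, hZ, rfl⟩
  rw [inner_sub_right, sub_eq_zero, ContinuousLinearMap.adjoint_inner_right]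
  refine (inner_toLp_left Z _).trans ?_
  have e1 : ∫ ω, conj (Z ω) * hu.toLp _ ω ∂(surf d) =
      ∫ φ : S d, conj (Z φ) * negPowD s N g φ ∂(surf d) := by
    refine integral_congr_ae ?_
    filter_upwards [hu.coeFn_toLp] with ω hω
    rw [hω]
  rw [e1, integral_conj_mul_negPowD hd hsd, ← (fourierIso d).inner_map_map, fourierIso_adjTrace,
    inner_smul_left, L2.inner_def, ← integral_indicator Metric.isClosed_closedBall.measurableSet,
    pow_two, mul_assoc, Complex.conj_ofReal]
  congr 1
  rw [← integral_const_mul]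
  refine integral_congr_ae ?_
  have hp : (harm d k).orthogonalProjectionOnto (ContinuousMap.toLp (E := ℂ) 2 (surf d) ℂ Z) =
      ⟨_, toLp_mem_harm hZ⟩ :=
    Subtype.ext (Submodule.starProjection_eq_self_iff.2 (toLp_mem_harm hZ))
  have hwave := coeFn_waveMap hd k hs hsd ⟨_, toLp_mem_harm hZ⟩
  rw [← hp] at hwave
  filter_upwards [hwave, coeFn_fourierIso_lowFreq N g, coeFn_fourierIso g] with ξ h1 h2 h3
  refine Eq.trans ?_ (congrArg₂ (inner ℂ) h1 h2).symm
  by_cases h : ξ ∈ Metric.closedBall (0 : E d) N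
  · rw [Set.indicator_of_mem h, Set.indicator_of_mem h, h3, RCLike.inner_apply, hp]
    ring
  · rw [Set.indicator_of_notMem h, Set.indicator_of_notMem h, inner_zero_right, mul_zero]

/-- At each cutoff the trace equals T_k^* applied to the low frequencies of g. These converge to g,
and T_k^* is bounded. -/
theorem isTraceComponent_adjoint (hd : 2 ≤ d) (k : ℕ) {s : ℝ} (hs : 1 / 2 < s) (hsd : s < d / 2)
    (g : L2E d) : IsTraceComponent s k g ((adjTrace hd k hs hsd).adjoint g) := by
  unfold IsTraceComponent
  have h1 : ∀ N : ℕ, eLpNorm (fun ω : S d => projSpace d k (negPowD s N g) (ω : E d) -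
      (adjTrace hd k hs hsd).adjoint g ω) 2 (surf d) =
      ‖(adjTrace hd k hs hsd).adjoint (lowFreq N g) - (adjTrace hd k hs hsd).adjoint g‖ₑ := by
    intro N
    have hu : MemLp (fun φ : S d => negPowD s N g φ) 2 (surf d) :=
      memLp_of_continuous ((continuous_negPowD hd hsd N g).comp continuous_subtype_val)
    rw [← starProjection_negPowD hd k hs hsd N g hu, ← (projSphere_spec k hu).2, Lp.enorm_def]
    refine eLpNorm_congr_ae ?_
    filter_upwards [Lp.coeFn_sub (ContinuousMap.toLp (E := ℂ) 2 (surf d) ℂ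
        (projSphere d k fun φ : S d => negPowD s N g φ)) ((adjTrace hd k hs hsd).adjoint g),
      ContinuousMap.coeFn_toLp (p := 2) (𝕜 := ℂ) (surf d)
        (projSphere d k fun φ : S d => negPowD s N g φ)] with ω e1 e2
    rw [e1, Pi.sub_apply, e2, projSpace_coe]
  simp only [h1]
  have h2 := ((((adjTrace hd k hs hsd).adjoint.continuous.tendsto g).comp
    (tendsto_lowFreq g)).sub_const ((adjTrace hd k hs hsd).adjoint g)).enorm
  simpa using h2

theorem isStheta_iff (hd : 2 ≤ d) {s : ℝ} (hs : 1 / 2 < s) (hsd : s < d / 2) (θ : ℝ≥0 → ℂ)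
    (g : L2E d) (F : L2S d) :
    IsStheta s θ g F ↔
      HasSum (fun k => conj (thetaAt d θ k) • (adjTrace hd k hs hsd).adjoint g) F := by
  constructor
  · rintro ⟨Φ, h1, h2⟩
    have : Φ = fun k => (adjTrace hd k hs hsd).adjoint g :=
      funext fun k => (h1 k).unique (isTraceComponent_adjoint hd k hs hsd g)
    rwa [this] at h2
  · exact fun h => ⟨_, fun k => isTraceComponent_adjoint hd k hs hsd g, h⟩

end Trace

/-! ### Orthogonal series in Hilbert spaces -/

section Orthogonal

variable {H : Type*} [NormedAddCommGroup H] [InnerProductSpace ℂ H]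

theorem hasSum_inner_right {v : ℕ → H} {x : H} (h : HasSum v x) (y : H) :
    HasSum (fun k => inner ℂ y (v k)) (inner ℂ y x) :=
  (innerSL ℂ y).hasSum h

theorem hasSum_inner_left {v : ℕ → H} {x : H} (h : HasSum v x) (y : H) :
    HasSum (fun k => inner ℂ (v k) y) (inner ℂ x y) := by
  have := (hasSum_inner_right h y).star
  simpa only [RCLike.star_def, inner_conj_symm] using this

theorem norm_sum_sq_of_orthogonal {v : ℕ → H} (hv : ∀ j k, j ≠ k → inner ℂ (v j) (v k) = 0)
    (t : Finset ℕ) : ‖∑ k ∈ t, v k‖ ^ 2 = ∑ k ∈ t, ‖v k‖ ^ 2 := by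
  have h : (inner ℂ (∑ k ∈ t, v k) (∑ k ∈ t, v k) : ℂ) = ∑ k ∈ t, inner ℂ (v k) (v k) := by
    rw [sum_inner]
    refine Finset.sum_congr rfl fun k hk => ?_
    rw [inner_sum]
    exact Finset.sum_eq_single_of_mem k hk fun j _ hjk => hv k j hjk.symm
  simp only [inner_self_eq_norm_sq_to_K] at h
  exact_mod_cast h

theorem hasSum_norm_sq_of_orthogonal {v : ℕ → H}
    (hv : ∀ j k, j ≠ k → inner ℂ (v j) (v k) = 0) {h : H} (hs : HasSum v h) :
    HasSum (fun k => ‖v k‖ ^ 2) (‖h‖ ^ 2) := by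
  have := (hs.norm.pow 2 : Tendsto _ _ _)
  simp only [norm_sum_sq_of_orthogonal hv] at this
  exact this

theorem summable_of_orthogonal [CompleteSpace H] {v : ℕ → H}
    (hv : ∀ j k, j ≠ k → inner ℂ (v j) (v k) = 0) (hs : Summable fun k => ‖v k‖ ^ 2) :
    Summable v := by
  rw [summable_iff_vanishing_norm] at hs ⊢
  intro ε hε
  obtain ⟨t, ht⟩ := hs (ε ^ 2) (by positivity)
  refine ⟨t, fun u hu => ?_⟩
  have h := ht u hu
  rw [Real.norm_of_nonneg (Finset.sum_nonneg fun _ _ => by positivity),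
    ← norm_sum_sq_of_orthogonal hv] at h
  exact lt_of_pow_lt_pow_left₀ 2 hε.le h

/-- An orthogonal sequence of components of a vector is summable. -/
theorem summable_of_inner_eq [CompleteSpace H] {v : ℕ → H}
    (hv : ∀ j k, j ≠ k → inner ℂ (v j) (v k) = 0) {h : H}
    (hh : ∀ k, inner ℂ (v k) h = inner ℂ (v k) (v k)) : Summable v := by
  refine summable_of_orthogonal hv
    (summable_of_sum_le (c := ‖h‖ ^ 2) (fun k => by positivity) fun t => ?_)
  -- Bessel's inequality: a partial sum has squared norm equal to its pairing with h, so by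
  -- Cauchy–Schwarz its norm is at most ‖h‖.
  have h1 : (inner ℂ (∑ k ∈ t, v k) h : ℂ) = ((∑ k ∈ t, ‖v k‖ ^ 2 : ℝ) : ℂ) := by
    rw [sum_inner]
    simp only [hh, inner_self_eq_norm_sq_to_K]
    push_cast; rfl
  have h2 := norm_inner_le_norm (𝕜 := ℂ) (∑ k ∈ t, v k) h
  rw [h1, Complex.norm_real, Real.norm_of_nonneg (Finset.sum_nonneg fun _ _ => by positivity),
    ← norm_sum_sq_of_orthogonal hv] at h2
  rw [← norm_sum_sq_of_orthogonal hv]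
  have h3 : ‖∑ k ∈ t, v k‖ ≤ ‖h‖ := by
    by_contra! hlt
    have : 0 < ‖∑ k ∈ t, v k‖ := (norm_nonneg _).trans_lt hlt
    nlinarith
  gcongr

/-- One strict term makes the sums strictly ordered, provided the smaller sum is finite. -/
theorem tsum_eq_iff_of_le {f g : ℕ → ℝ≥0∞} (hf : ∑' k, f k ≠ ⊤) (h : ∀ k, f k ≤ g k) :
    ∑' k, f k = ∑' k, g k ↔ ∀ k, f k = g k := by
  refine ⟨fun he k => ?_, fun hk => tsum_congr hk⟩
  by_contra hne
  exact (ENNReal.tsum_lt_tsum hf h (lt_of_le_of_ne (h k) hne)).ne he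

end Orthogonal

/-! ### Expansion in spherical harmonics -/

section Harmonics

variable {d : ℕ}

theorem starProjection_of_ne (hd : 2 ≤ d) {j k : ℕ} (hjk : j ≠ k) {P : L2S d}
    (hP : P ∈ harm d k) : (harm d j).starProjection P = 0 := by
  refine Submodule.eq_starProjection_of_mem_orthogonal (zero_mem _) ?_
  rw [sub_zero, Submodule.mem_orthogonal]
  exact fun Z hZ => orthogonalFamily_harm hd hjk ⟨Z, hZ⟩ ⟨P, hP⟩

theorem inner_starProjection_of_ne (hd : 2 ≤ d) {j k : ℕ} (hjk : j ≠ k) (G G' : L2S d) :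
    inner ℂ ((harm d j).starProjection G) ((harm d k).starProjection G') = 0 :=
  orthogonalFamily_harm hd hjk ⟨_, Submodule.starProjection_apply_mem _ G⟩
    ⟨_, Submodule.starProjection_apply_mem _ G'⟩

theorem inner_starProjection_starProjection (k : ℕ) (G G' : L2S d) :
    inner ℂ ((harm d k).starProjection G) ((harm d k).starProjection G') =
      inner ℂ ((harm d k).starProjection G) G' := by
  rw [← Submodule.inner_starProjection_left_eq_right,
    Submodule.starProjection_eq_self_iff.2 (Submodule.starProjection_apply_mem _ _)]

/-- The expansion of a function on the sphere in spherical harmonics. -/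
theorem hasSum_starProjection (hd : 2 ≤ d) (G : L2S d) :
    HasSum (fun k => (harm d k).starProjection G) G := by
  have horth : ∀ j k, j ≠ k →
      inner ℂ ((harm d j).starProjection G) ((harm d k).starProjection G) = 0 :=
    fun j k hjk => inner_starProjection_of_ne hd hjk G G
  obtain ⟨G0, h0⟩ := summable_of_inner_eq horth (h := G)
    fun k => (inner_starProjection_starProjection k G G).symm
  have hbot := (Submodule.topologicalClosure_eq_top_iff).1 (iSup_harm_topologicalClosure hd)
  -- The difference between G and the sum of its projections is orthogonal to every degree, so
  -- completeness makes it zero.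
  have hmem : G - G0 ∈ (⨆ k, harm d k)ᗮ := by
    rw [← Submodule.iInf_orthogonal, Submodule.mem_iInf]
    intro k
    rw [Submodule.mem_orthogonal]
    intro Z hZ
    have hZ' := Submodule.starProjection_eq_self_iff.2 hZ
    have h1 := hasSum_inner_right h0 Z
    have h2 : HasSum (fun j => inner ℂ Z ((harm d j).starProjection G))
        (inner ℂ Z ((harm d k).starProjection G)) := by
      refine hasSum_single k fun j hj => ?_
      rw [← hZ']
      exact inner_starProjection_of_ne hd hj.symm Z G
    rw [inner_sub_right, h1.unique h2, ← Submodule.inner_starProjection_left_eq_right, hZ',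
      sub_self]
  rw [hbot, Submodule.mem_bot, sub_eq_zero] at hmem
  rwa [← hmem] at h0

theorem enorm_sq_eq_tsum (hd : 2 ≤ d) (G : L2S d) :
    ‖G‖ₑ ^ 2 = ∑' k, ‖(harm d k).starProjection G‖ₑ ^ 2 := by
  have h := hasSum_norm_sq_of_orthogonal (fun j k hjk => inner_starProjection_of_ne hd hjk G G)
    (hasSum_starProjection hd G)
  have e : ∀ x : L2S d, ‖x‖ₑ ^ 2 = ENNReal.ofReal (‖x‖ ^ 2) := fun x => by
    rw [ENNReal.ofReal_pow (norm_nonneg _), ofReal_norm]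
  simp only [e]
  rw [← h.tsum_eq, ENNReal.ofReal_tsum_of_nonneg (fun _ => by positivity) h.summable]

/-- Degrees outside A give closed orthogonality conditions; conversely, G is the limit of partial
sums of its projections, all of which have degree in A. -/
theorem mem_harmSum_iff (hd : 2 ≤ d) (A : Set ℕ) (G : L2S d) :
    G ∈ harmSum d A ↔ ∀ k, (harm d k).starProjection G ≠ 0 → k ∈ A := by
  constructor
  · intro hG k hk
    by_contra hkA
    refine hk ?_
    have hle : harmSum d A ≤ (harm d k)ᗮ := by
      refine Submodule.topologicalClosure_minimal _ (iSup₂_le fun j hj Z hZ => ?_)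
        (Submodule.isClosed_orthogonal _)
      rw [Submodule.mem_orthogonal]
      have hkj : k ≠ j := fun e => hkA (e ▸ hj)
      exact fun Y hY => orthogonalFamily_harm hd hkj ⟨Y, hY⟩ ⟨Z, hZ⟩
    exact (Submodule.starProjection_apply_eq_zero_iff _).2 (hle hG)
  · intro h
    refine mem_closure_of_tendsto (hasSum_starProjection hd G) (Eventually.of_forall fun t => ?_)
    refine Submodule.sum_mem _ fun k _ => ?_
    by_cases hk : (harm d k).starProjection G = 0
    · rw [hk]; exact zero_mem _
    · exact Submodule.mem_iSup_of_mem k (Submodule.mem_iSup_of_mem (h k hk)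
        (Submodule.starProjection_apply_mem _ _))

theorem exists_mem_harm_ne_zero (hd : 2 ≤ d) (k : ℕ) : ∃ P ∈ harm d k, P ≠ 0 := by
  obtain ⟨Y, hY, hY0⟩ := exists_mem_harmC_ne_zero hd k
  refine ⟨_, toLp_mem_harm hY, fun h => hY0 ?_⟩
  exact ContinuousMap.toLp_injective (𝕜 := ℂ) (p := 2) (surf d) (h.trans (map_zero _).symm)

end Harmonics

/-! ### The operators -/

section Operators

variable {d : ℕ}

theorem adjoint_adjTrace_adjTrace_of_ne (hd : 2 ≤ d) {s : ℝ} (hs : 1 / 2 < s) (hsd : s < d / 2)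
    {j k : ℕ} (hjk : j ≠ k) (G : L2S d) :
    (adjTrace hd j hs hsd).adjoint (adjTrace hd k hs hsd G) = 0 := by
  refine ext_inner_left ℂ fun G' => ?_
  rw [ContinuousLinearMap.adjoint_inner_right, inner_adjTrace_of_ne hd hjk, inner_zero_right]

theorem adjoint_adjTrace_adjTrace (hd : 2 ≤ d) {s : ℝ} (hs : 1 / 2 < s) (hsd : s < d / 2)
    (k : ℕ) (G : L2S d) :
    (adjTrace hd k hs hsd).adjoint (adjTrace hd k hs hsd G) =
      (lamOne d s k : ℂ) • (harm d k).starProjection G := by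
  refine ext_inner_left ℂ fun G' => ?_
  rw [ContinuousLinearMap.adjoint_inner_right, inner_adjTrace_self, inner_smul_right,
    Submodule.inner_starProjection_left_eq_right,
    Submodule.starProjection_eq_self_iff.2 (Submodule.starProjection_apply_mem _ _)]

theorem inner_smul_adjTrace_of_ne (hd : 2 ≤ d) {s : ℝ} (hs : 1 / 2 < s) (hsd : s < d / 2)
    (θ : ℝ≥0 → ℂ) (G : L2S d) (j k : ℕ) (hjk : j ≠ k) :
    inner ℂ (thetaAt d θ j • adjTrace hd j hs hsd G) (thetaAt d θ k • adjTrace hd k hs hsd G) =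
      0 := by
  rw [inner_smul_left, inner_smul_right, inner_adjTrace_of_ne hd hjk, mul_zero, mul_zero]

theorem norm_smul_adjTrace_sq (hd : 2 ≤ d) {s : ℝ} (hs : 1 / 2 < s) (hsd : s < d / 2)
    (θ : ℝ≥0 → ℂ) (G : L2S d) (k : ℕ) :
    ‖thetaAt d θ k • adjTrace hd k hs hsd G‖ ^ 2 =
      lam d s θ k * ‖(harm d k).starProjection G‖ ^ 2 := by
  have h := inner_adjTrace_self hd k hs hsd G G
  rw [inner_self_eq_norm_sq_to_K, inner_self_eq_norm_sq_to_K] at h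
  have h' : ‖adjTrace hd k hs hsd G‖ ^ 2 = lamOne d s k * ‖(harm d k).starProjection G‖ ^ 2 := by
    have h2 : ((‖adjTrace hd k hs hsd G‖ ^ 2 : ℝ) : ℂ) =
        ((lamOne d s k * ‖(harm d k).starProjection G‖ ^ 2 : ℝ) : ℂ) := by
      push_cast; exact h
    exact Complex.ofReal_injective h2
  rw [norm_smul, mul_pow, h', lam_eq]; ring

theorem lam_nonneg (hd : 2 ≤ d) {s : ℝ} (hs : 1 / 2 < s) (hsd : s < d / 2)
    (θ : ℝ≥0 → ℂ) (k : ℕ) : 0 ≤ lam d s θ k := by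
  rw [lam_eq]
  exact mul_nonneg (lamOne_pos hd k hs hsd).le (by positivity)

/-- Inside the domain this is Pythagoras for the orthogonal terms. Outside it the infimum is over
the empty set, and the right side is also infinite, because a finite sum of squares would make the
orthogonal series converge. -/
theorem normSqSthetaStar_eq_tsum (hd : 2 ≤ d) {s : ℝ} (hs : 1 / 2 < s) (hsd : s < d / 2)
    (θ : ℝ≥0 → ℂ) (G : L2S d) :
    normSqSthetaStar s θ G =
      ∑' k, ENNReal.ofReal (lam d s θ k) * ‖(harm d k).starProjection G‖ₑ ^ 2 := by
  have horth := inner_smul_adjTrace_of_ne hd hs hsd θ G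
  have e : ∀ k, ENNReal.ofReal (lam d s θ k) * ‖(harm d k).starProjection G‖ₑ ^ 2 =
      ENNReal.ofReal (‖thetaAt d θ k • adjTrace hd k hs hsd G‖ ^ 2) := fun k => by
    rw [norm_smul_adjTrace_sq, ENNReal.ofReal_mul (lam_nonneg hd hs hsd θ k),
      ENNReal.ofReal_pow (norm_nonneg _), ofReal_norm]
  simp only [e]
  by_cases hsum : Summable fun k => thetaAt d θ k • adjTrace hd k hs hsd G
  · obtain ⟨h, hh⟩ := hsum
    have h1 := hasSum_norm_sq_of_orthogonal horth hh
    rw [← ENNReal.ofReal_tsum_of_nonneg (fun _ => by positivity) h1.summable, h1.tsum_eq,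
      ENNReal.ofReal_pow (norm_nonneg _), ofReal_norm]
    have hdom := (isSthetaStar_iff hd hs hsd θ G h).2 hh
    refine le_antisymm (iInf₂_le h hdom) (le_iInf₂ fun h' hdom' => ?_)
    rw [hdom.unique hdom']
  · have h1 : normSqSthetaStar s θ G = ⊤ := by
      refine iInf₂_eq_top.2 fun h hdom => ?_
      exact absurd ((isSthetaStar_iff hd hs hsd θ G h).1 hdom).summable hsum
    rw [h1]
    by_contra hne
    have := ENNReal.summable_toReal (Ne.symm hne)
    refine hsum (summable_of_orthogonal horth (this.congr fun k => ?_))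
    rw [ENNReal.toReal_ofReal (by positivity)]

theorem normSqSthetaStar_of_mem_harm (hd : 2 ≤ d) {s : ℝ} (hs : 1 / 2 < s) (hsd : s < d / 2)
    (θ : ℝ≥0 → ℂ) {k : ℕ} {P : L2S d} (hP : P ∈ harm d k) :
    normSqSthetaStar s θ P = ENNReal.ofReal (lam d s θ k) * ‖P‖ₑ ^ 2 := by
  rw [normSqSthetaStar_eq_tsum hd hs hsd, tsum_eq_single k fun j hj => ?_]
  · rw [Submodule.starProjection_eq_self_iff.2 hP]
  · rw [starProjection_of_ne hd hj hP]; simp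

/-- `S_θ^*` is the adjoint of `S_θ`. -/
theorem isSthetaStar_iff_adjoint (hd : 2 ≤ d) {s : ℝ} (hs : 1 / 2 < s) (hsd : s < d / 2)
    (θ : ℝ≥0 → ℂ) (G : L2S d) (h : L2E d) :
    IsSthetaStar s θ G h ↔ ∀ (g : L2E d) (F : L2S d),
      IsStheta s θ g F → inner ℂ F G = inner ℂ g h := by
  simp only [isSthetaStar_iff hd hs hsd, isStheta_iff hd hs hsd]
  constructor
  · intro hh g F hF
    refine (hasSum_inner_left hF G).unique ((hasSum_inner_right hh g).congr_fun fun k => ?_)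
    rw [inner_smul_left, inner_smul_right, ContinuousLinearMap.adjoint_inner_left,
      Complex.conj_conj]
  · intro hh
    -- Testing with g = T_k x, which only the k-th term of S_θ sees, shows that h and θ_k T_k G have
    -- the same pairing with the range of T_k.
    have key : ∀ k (x : L2S d), inner ℂ (adjTrace hd k hs hsd x) h =
        inner ℂ (adjTrace hd k hs hsd x) (thetaAt d θ k • adjTrace hd k hs hsd G) := by
      intro k x
      have h1 := hh (adjTrace hd k hs hsd x)
        (conj (thetaAt d θ k) • (lamOne d s k : ℂ) • (harm d k).starProjection x) (by
          rw [← adjoint_adjTrace_adjTrace hd hs hsd]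
          refine hasSum_single k fun j hj => ?_
          rw [adjoint_adjTrace_adjTrace_of_ne hd hs hsd hj, smul_zero])
      rw [← h1, inner_smul_right, inner_adjTrace_self, inner_smul_left, inner_smul_left,
        Complex.conj_conj, Complex.conj_ofReal, inner_starProjection_starProjection]
    have horth := inner_smul_adjTrace_of_ne hd hs hsd θ G
    obtain ⟨h0, hh0⟩ := summable_of_inner_eq horth (h := h) fun k => by
      rw [inner_smul_left, key, ← inner_smul_left]
    have hw : ∀ k, (adjTrace hd k hs hsd).adjoint (h - h0) = 0 := by
      intro k
      refine ext_inner_left ℂ fun x => ?_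
      rw [ContinuousLinearMap.adjoint_inner_right, inner_sub_right, inner_zero_right, key,
        sub_eq_zero]
      refine HasSum.unique ?_ (hasSum_inner_right hh0 _)
      refine hasSum_single k fun j hj => ?_
      rw [inner_smul_right, inner_adjTrace_of_ne hd hj.symm, mul_zero]
    -- Every T_k^* annihilates the remainder, so S_θ maps it to 0 and it is an admissible test
    -- vector.
    have h1 : inner ℂ (h - h0) h = 0 := by
      have h2 := hh (h - h0) 0 (by simp only [hw, smul_zero]; exact hasSum_zero)
      rw [← h2, inner_zero_left]
    have h2 : inner ℂ (h - h0) h0 = 0 := by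
      refine (hasSum_inner_right hh0 (h - h0)).unique ?_
      have : ∀ k, inner ℂ (h - h0) (thetaAt d θ k • adjTrace hd k hs hsd G) = 0 := fun k => by
        rw [inner_smul_right, ← ContinuousLinearMap.adjoint_inner_left, hw, inner_zero_left,
          mul_zero]
      simp only [this]
      exact hasSum_zero
    have h3 : h - h0 = 0 := by
      rw [← inner_self_eq_zero (𝕜 := ℂ), inner_sub_right, h1, h2, sub_zero]
    rwa [sub_eq_zero.1 h3]

theorem exists_isSthetaStar_isStheta (hd : 2 ≤ d) {s : ℝ} (hs : 1 / 2 < s) (hsd : s < d / 2)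
    (θ : ℝ≥0 → ℂ) (k : ℕ) {P : L2S d} (hP : P ∈ harm d k) :
    ∃ h : L2E d, IsSthetaStar s θ P h ∧ IsStheta s θ h ((lam d s θ k : ℂ) • P) := by
  refine ⟨thetaAt d θ k • adjTrace hd k hs hsd P, ?_, ?_⟩
  · rw [isSthetaStar_iff hd hs hsd]
    refine hasSum_single k fun j hj => ?_
    rw [← adjTrace_starProjection, starProjection_of_ne hd hj hP, map_zero, smul_zero]
  · rw [isStheta_iff hd hs hsd]
    have e : (lam d s θ k : ℂ) • P = conj (thetaAt d θ k) •
        (adjTrace hd k hs hsd).adjoint (thetaAt d θ k • adjTrace hd k hs hsd P) := by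
      rw [map_smul, adjoint_adjTrace_adjTrace, Submodule.starProjection_eq_self_iff.2 hP,
        smul_smul, smul_smul, lam_eq, mul_assoc, mul_comm (conj _), mul_comm (thetaAt d θ k),
        mul_assoc, Complex.mul_conj, Complex.normSq_eq_norm_sq]
      push_cast; rfl
    rw [e]
    refine hasSum_single k fun j hj => ?_
    rw [map_smul, adjoint_adjTrace_adjTrace_of_ne hd hs hsd hj, smul_zero, smul_zero]

theorem enorm_sq_ne_top (G : L2S d) : ‖G‖ₑ ^ 2 ≠ ⊤ := by simp

theorem enorm_sq_ne_zero {G : L2S d} (hG : G ≠ 0) : ‖G‖ₑ ^ 2 ≠ 0 := by simpa using hG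

/-- The bound holds term by term in Parseval's identity. A nonzero harmonic of degree k forces any
admissible constant below λ_k(θ). -/
theorem isGreatest_infLam (hd : 2 ≤ d) {s : ℝ} (hs : 1 / 2 < s) (hsd : s < d / 2)
    (θ : ℝ≥0 → ℂ) :
    IsGreatest {c : ℝ≥0∞ | ∀ G : L2S d, c * ‖G‖ₑ ^ 2 ≤ normSqSthetaStar s θ G}
      (infLam d s θ) := by
  constructor
  · intro G
    rw [normSqSthetaStar_eq_tsum hd hs hsd, enorm_sq_eq_tsum hd, ← ENNReal.tsum_mul_left]
    exact ENNReal.tsum_le_tsum fun k => mul_le_mul_left (iInf_le _ k) _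
  · intro c hc
    refine le_iInf fun k => ?_
    obtain ⟨P, hP, hP0⟩ := exists_mem_harm_ne_zero hd k
    have := hc P
    rw [normSqSthetaStar_of_mem_harm hd hs hsd θ hP] at this
    exact (ENNReal.mul_le_mul_iff_left (enorm_sq_ne_zero hP0) (enorm_sq_ne_top P)).1 this

theorem isLeast_supLam (hd : 2 ≤ d) {s : ℝ} (hs : 1 / 2 < s) (hsd : s < d / 2)
    (θ : ℝ≥0 → ℂ) :
    IsLeast {C : ℝ≥0∞ | ∀ G : L2S d, normSqSthetaStar s θ G ≤ C * ‖G‖ₑ ^ 2}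
      (supLam d s θ) := by
  constructor
  · intro G
    rw [normSqSthetaStar_eq_tsum hd hs hsd, enorm_sq_eq_tsum hd, ← ENNReal.tsum_mul_left]
    exact ENNReal.tsum_le_tsum fun k =>
      mul_le_mul_left (le_iSup (fun k => ENNReal.ofReal (lam d s θ k)) k) _
  · intro c hc
    refine iSup_le fun k => ?_
    obtain ⟨P, hP, hP0⟩ := exists_mem_harm_ne_zero hd k
    have := hc P
    rw [normSqSthetaStar_of_mem_harm hd hs hsd θ hP] at this
    exact (ENNReal.mul_le_mul_iff_left (enorm_sq_ne_zero hP0) (enorm_sq_ne_top P)).1 this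

theorem mul_starProjection_eq_iff (l m : ℝ≥0∞) (k : ℕ) (G : L2S d) :
    l * ‖(harm d k).starProjection G‖ₑ ^ 2 = m * ‖(harm d k).starProjection G‖ₑ ^ 2 ↔
      ((harm d k).starProjection G ≠ 0 → l = m) := by
  by_cases h : (harm d k).starProjection G = 0
  · simp [h]
  · rw [ENNReal.mul_left_inj (enorm_sq_ne_zero h) (enorm_sq_ne_top _)]
    simp [h]

/-- Equality of the sums means equality in every term, so λ_k(θ) is minimal wherever H_k G ≠ 0. The
smaller sum is finite because the infimum is at most λ_0(θ). -/
theorem normSqSthetaStar_eq_infLam_iff (hd : 2 ≤ d) {s : ℝ} (hs : 1 / 2 < s) (hsd : s < d / 2)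
    (θ : ℝ≥0 → ℂ) (G : L2S d) :
    normSqSthetaStar s θ G = infLam d s θ * ‖G‖ₑ ^ 2 ↔ G ∈ harmSum d (argInf d s θ) := by
  have htop : infLam d s θ * ‖G‖ₑ ^ 2 ≠ ⊤ :=
    ENNReal.mul_ne_top ((iInf_le (fun k => ENNReal.ofReal (lam d s θ k)) 0).trans_lt
      ENNReal.ofReal_lt_top).ne (enorm_sq_ne_top G)
  rw [mem_harmSum_iff hd, eq_comm]
  rw [normSqSthetaStar_eq_tsum hd hs hsd]
  rw [enorm_sq_eq_tsum hd, ← ENNReal.tsum_mul_left] at htop ⊢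
  rw [tsum_eq_iff_of_le htop fun k => mul_le_mul_left (iInf_le _ k) _]
  refine forall_congr' fun k => ?_
  rw [mul_starProjection_eq_iff, argInf, Set.mem_ofPred_eq, eq_comm (a := infLam d s θ)]

/-- The same comparison with the roles exchanged. Parseval's sum is now the smaller one, and a
finite supremum is what makes it finite. -/
theorem normSqSthetaStar_eq_supLam_iff (hd : 2 ≤ d) {s : ℝ} (hs : 1 / 2 < s) (hsd : s < d / 2)
    (θ : ℝ≥0 → ℂ) (hsup : supLam d s θ < ⊤) (G : L2S d) :
    normSqSthetaStar s θ G = supLam d s θ * ‖G‖ₑ ^ 2 ↔ G ∈ harmSum d (argSup d s θ) := by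
  have htop : supLam d s θ * ‖G‖ₑ ^ 2 ≠ ⊤ := ENNReal.mul_ne_top hsup.ne (enorm_sq_ne_top G)
  have hle : ∀ k, ENNReal.ofReal (lam d s θ k) * ‖(harm d k).starProjection G‖ₑ ^ 2 ≤
      supLam d s θ * ‖(harm d k).starProjection G‖ₑ ^ 2 := fun k =>
    mul_le_mul_left (le_iSup (fun k => ENNReal.ofReal (lam d s θ k)) k) _
  rw [mem_harmSum_iff hd, normSqSthetaStar_eq_tsum hd hs hsd]
  rw [enorm_sq_eq_tsum hd, ← ENNReal.tsum_mul_left] at htop ⊢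
  rw [tsum_eq_iff_of_le (ne_top_of_le_ne_top htop (ENNReal.tsum_le_tsum hle)) hle]
  refine forall_congr' fun k => ?_
  rw [mul_starProjection_eq_iff]
  rfl

end Operators

end SphereTrace

theorem theorem3 (d : ℕ) (hd : 2 ≤ d) (s : ℝ) (hs : 1 / 2 < s) (hsd : s < d / 2)
    (θ : NNReal → ℂ) :
    -- `S_θ^*` is the Hilbert space adjoint of `S_θ`
    (∀ (G : SphereTrace.L2S d) (h : SphereTrace.L2E d),
      SphereTrace.IsSthetaStar s θ G h ↔
        ∀ (g : SphereTrace.L2E d) (F : SphereTrace.L2S d),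
          SphereTrace.IsStheta s θ g F → inner ℂ F G = inner ℂ g h) ∧
    -- `S_θ S_θ^* P = λ_k(θ) P` for every spherical harmonic `P` of degree `k`
    (∀ (k : ℕ), ∀ P ∈ SphereTrace.harm d k,
      ∃ h : SphereTrace.L2E d, SphereTrace.IsSthetaStar s θ P h ∧
        SphereTrace.IsStheta s θ h ((SphereTrace.lam d s θ k : ℂ) • P)) ∧
    -- the lower bound, with the optimal constant
    IsGreatest {c : ENNReal | ∀ G : SphereTrace.L2S d,
        c * ‖G‖ₑ ^ 2 ≤ SphereTrace.normSqSthetaStar s θ G} (SphereTrace.infLam d s θ) ∧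
    -- the upper bound, with the optimal constant
    IsLeast {C : ENNReal | ∀ G : SphereTrace.L2S d,
        SphereTrace.normSqSthetaStar s θ G ≤ C * ‖G‖ₑ ^ 2} (SphereTrace.supLam d s θ) ∧
    -- the extremisers for the lower bound
    (0 < SphereTrace.infLam d s θ → ∀ G : SphereTrace.L2S d,
      (G ≠ 0 ∧ SphereTrace.normSqSthetaStar s θ G = SphereTrace.infLam d s θ * ‖G‖ₑ ^ 2) ↔
        (G ≠ 0 ∧ G ∈ SphereTrace.harmSum d (SphereTrace.argInf d s θ))) ∧
    -- the extremisers for the upper bound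
    (SphereTrace.supLam d s θ < ⊤ → ∀ G : SphereTrace.L2S d,
      (G ≠ 0 ∧ SphereTrace.normSqSthetaStar s θ G = SphereTrace.supLam d s θ * ‖G‖ₑ ^ 2) ↔
        (G ≠ 0 ∧ G ∈ SphereTrace.harmSum d (SphereTrace.argSup d s θ))) := by
  exact ⟨SphereTrace.isSthetaStar_iff_adjoint hd hs hsd θ,
    fun k P hP => SphereTrace.exists_isSthetaStar_isStheta hd hs hsd θ k hP,
    SphereTrace.isGreatest_infLam hd hs hsd θ,
    SphereTrace.isLeast_supLam hd hs hsd θ,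
    fun _ G => and_congr_right fun _ =>
      SphereTrace.normSqSthetaStar_eq_infLam_iff hd hs hsd θ G,
    fun hsup G => and_congr_right fun _ =>
      SphereTrace.normSqSthetaStar_eq_supLam_iff hd hs hsd θ hsup G⟩
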